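/- Let $n\ge 3$, let $M^n$ be a connected Riemannian $n$-manifold and let $\phi:M^n\to S^m(1)\subset\mathbb E^{m+1}$ be a smooth isometric immersion into the unit $m$-sphere, with second fundamental form $h$, shape operators $A_\xi$ and mean curvature vector $H=\frac1n\operatorname{trace} h$. Suppose: (i) $\phi$ is ideal: there are $k\ge 1$ and integers $n_1,\dots,n_k$ with $2\le n_j<n$ and $\sum_j n_j\le n$ such that at every point $p\in M^n$ $$\delta(n_1,\dots,n_k)(p)=\frac{n^2\,(n+k-1-\sum_j n_j)}{2\,(n+k-\sum_j n_j)}\,|H(p)|^2+\frac12\Big(n(n-1)-\sum_j n_j(n_j-1)\Big).$$ Here $\delta(n_1,\dots,n_k)(p)=\tau(T_pM)-\inf\{\tau(L_1)+\dots+\tau(L_k)\}$, the infimum being over all mutually orthogonal subspaces $L_1,\dots,L_k$ of $T_pM$ with $\dim L_j=n_j$, and $\tau(L)=\sum_{\alpha<\beta}K(e_\alpha\wedge e_\beta)$ for an orthonormal basis $(e_\alpha)$ of $L$, where $K$ is the sectional curvature of $M^n$. (ii) $\phi$ has type number $\le 2$: for every $p\in M^n$ and every unit vector $\xi$ normal to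 $M^n$ in $S^m(1)$ at $p$, the shape operator $A_\xi$ has at most $2$ nonzero eigenvalues, counted with multiplicity. Then either $\phi$ is minimal in $S^m(1)$ (that is, $H\equiv0$), or $\phi(M^n)$ lies in a totally geodesic $S^{n+1}(1)\subset S^m(1)$ and, for some real number $a$ with $0<a<1$, $\phi$ is congruent to the immersion $F_a$ given by $$\begin{aligned}F_a(x_1,\dots,x_n)=\Big(&\sqrt{1-a^2}\,\sin x_1,\ \cos x_1\sin x_2,\ \dots,\ \sin x_{n-2}\prod_{j=1}^{n-3}\cos x_j,\ \prod_{j=1}^{n-2}\cos x_j,\\ &a\sin x_1\sin x_{n-1},\ a\sin x_1\cos x_{n-1}\sin x_n,\ a\sin x_1\cos x_{n-1}\cos x_n,\ 0,\dots,0\Big)\in\mathbb E^{m+1}.\end{aligned}$$ Congruent means: there is a linear isometry $A$ of $\mathbb E^{m+1}$ such that every $\phi(p)$, $p\in M^n$, is of the form $A F_a(x)$ with $\sin x_1>0$; and whenever $\phi(p)=AF_a(x)$ and $F_a$ has injective differential at $x$, there are smooth local coordinates $\psi$ of $M^n$ around $p$ with $\psi(p)=x$ and $\phi=A\circ F_a\circ\psi$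 near $p$. -/

import Mathlib

open Bundle Filter Topology Metric
open scoped Manifold ContDiff RealInnerProductSpace

noncomputable section

namespace IdealSubmanifold

/-- Euclidean `n`-space. -/
abbrev E (n : ℕ) : Type := EuclideanSpace ℝ (Fin n)

/-- The unit sphere `S^m(1)` in Euclidean `(m+1)`-space. -/
abbrev S (m : ℕ) : Type := sphere (0 : E (m + 1)) 1

section Intrinsic

/-! ### Intrinsic geometry: the curvature of a Riemannian manifold, computed in charts

A Riemannian manifold is a smooth manifold `M` modelled on `E n` whose tangent bundle carries a
smooth Riemannian metric. All chart computations at `p` are made in the chart `extChartAt (𝓡 n) p`.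
-/

variable {n : ℕ} {M : Type*} [TopologicalSpace M] [ChartedSpace (E n) M]

/-- The components of a tangent vector at `p` in the chart at `p`. -/
def coords (p : M) : TangentSpace (𝓡 n) p →L[ℝ] E n :=
  mfderiv (𝓡 n) 𝓘(ℝ, E n) (extChartAt (𝓡 n) p) p

/-- The coordinate vector field `∂ᵢ` of the chart at `p`, at the point with coordinates `x`. -/
def coordField (p : M) (i : Fin n) (x : E n) :
    TangentSpace (𝓡 n) ((extChartAt (𝓡 n) p).symm x) :=
  mfderiv 𝓘(ℝ, E n) (𝓡 n) (extChartAt (𝓡 n) p).symm x (EuclideanSpace.single i (1 : ℝ))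

/-- The partial derivative `∂f/∂xᵢ` of a function on Euclidean space. -/
def pderiv (i : Fin n) (f : E n → ℝ) (x : E n) : ℝ :=
  fderiv ℝ f x (EuclideanSpace.single i (1 : ℝ))

variable [RiemannianBundle (fun x : M => TangentSpace (𝓡 n) x)]

/-- The components `gᵢⱼ = ⟨∂ᵢ, ∂ⱼ⟩` of the metric in the chart at `p`. -/
def metricCoeff (p : M) (x : E n) : Matrix (Fin n) (Fin n) ℝ :=
  Matrix.of fun i j => ⟪coordField p i x, coordField p j x⟫

/-- The Christoffel symbols `Γᵏᵢⱼ` of the Levi-Civita connection in the chart at `p`. -/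
def christoffel (p : M) (k i j : Fin n) (x : E n) : ℝ :=
  (1 / 2) * ∑ l, (metricCoeff p x)⁻¹ k l *
    (pderiv i (fun y => metricCoeff p y j l) x + pderiv j (fun y => metricCoeff p y i l) x
      - pderiv l (fun y => metricCoeff p y i j) x)

/-- The `∂ₗ`-component of `R(∂ᵢ, ∂ⱼ)∂ₖ`, where
`R(X, Y)Z = ∇_X ∇_Y Z - ∇_Y ∇_X Z - ∇_[X, Y] Z`. -/
def riemannCoeff (p : M) (l i j k : Fin n) (x : E n) : ℝ :=
  pderiv i (christoffel p l j k) x - pderiv j (christoffel p l i k) x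
    + ∑ s, (christoffel p s j k x * christoffel p l i s x
      - christoffel p s i k x * christoffel p l j s x)

/-- The Riemann curvature tensor `⟨R(u, v)w, z⟩` at `p`. -/
def curvature (p : M) (u v w z : TangentSpace (𝓡 n) p) : ℝ :=
  ∑ i, ∑ j, ∑ k, ∑ q, coords p u i * coords p v j * coords p w k * coords p z q *
    ∑ l, riemannCoeff p l i j k (extChartAt (𝓡 n) p p) * metricCoeff p (extChartAt (𝓡 n) p p) l q

/-- The sectional curvature of the plane spanned by two linearly independent tangent vectors. -/
def sectionalCurvature (p : M) (u v : TangentSpace (𝓡 n) p) : ℝ :=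
  curvature p u v v u / (⟪u, u⟫ * ⟪v, v⟫ - ⟪u, v⟫ ^ 2)

instance (p : M) : FiniteDimensional ℝ (TangentSpace (𝓡 n) p) :=
  inferInstanceAs (FiniteDimensional ℝ (E n))

/-- The scalar curvature `τ(L) = ∑_{α < β} K(e_α ∧ e_β)` of a subspace `L` of `T_pM`, with
`e_1, …, e_r` an orthonormal basis of `L` (the value does not depend on that basis). -/
def scalarCurvature (p : M) (L : Submodule ℝ (TangentSpace (𝓡 n) p)) : ℝ :=
  ∑ α, ∑ β ∈ Finset.Ioi α,
    sectionalCurvature p (stdOrthonormalBasis ℝ L α : TangentSpace (𝓡 n) p)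
      (stdOrthonormalBasis ℝ L β : TangentSpace (𝓡 n) p)

/-- `δ(n₁, …, n_k)(p) = τ(p) - inf {τ(L₁) + ⋯ + τ(L_k)}`, the infimum over all mutually orthogonal
subspaces `L₁, …, L_k` of `T_pM` with `dim L_j = n_j`. -/
def deltaInvariant {k : ℕ} (ν : Fin k → ℕ) (p : M) : ℝ :=
  scalarCurvature p (⊤ : Submodule ℝ (TangentSpace (𝓡 n) p)) -
    sInf {t : ℝ | ∃ L : Fin k → Submodule ℝ (TangentSpace (𝓡 n) p),
      (∀ j, Module.finrank ℝ (L j) = ν j) ∧ (Pairwise fun i j => L i ⟂ L j) ∧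
      t = ∑ j, scalarCurvature p (L j)}

end Intrinsic

/-- The set `𝒮(n, k)` of `k`-tuples `(n₁, …, n_k)` with `2 ≤ n_j < n` and `∑ n_j ≤ n`, `k ≥ 1`. -/
def admissibleTuples (n k : ℕ) : Set (Fin k → ℕ) :=
  {ν | 1 ≤ k ∧ (∀ j, 2 ≤ ν j ∧ ν j < n) ∧ ∑ j, ν j ≤ n}

section Extrinsic

/-! ### Submanifolds of the unit sphere -/

variable (n : ℕ) {m : ℕ} {M : Type*} [TopologicalSpace M] [ChartedSpace (E n) M]

/-- The differential at `p` of `φ`, regarded as a map into `E (m + 1)`. -/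
def differential (φ : M → S m) (p : M) : TangentSpace (𝓡 n) p →L[ℝ] E (m + 1) :=
  mfderiv (𝓡 n) 𝓘(ℝ, E (m + 1)) (fun q => (φ q : E (m + 1))) p

/-- The normal space of `φ` in `S^m(1)` at `p`: the vectors of `E (m + 1)` that are tangent to
the sphere at `φ p` (orthogonal to the position vector) and orthogonal to `dφ(T_pM)`. -/
def normalSpace (φ : M → S m) (p : M) : Submodule ℝ (E (m + 1)) :=
  ((differential n φ p).range ⊔ Submodule.span ℝ {(φ p : E (m + 1))})ᗮ

/-- The second fundamental form `h` of `φ` in `S^m(1)`. The Levi-Civita connection of the sphere is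
the tangential part of the flat one, so `h(∂ᵢ, ∂ⱼ)` is the normal part of `∂ᵢ∂ⱼφ`. -/
def secondFundamentalForm (φ : M → S m) (p : M) :
    TangentSpace (𝓡 n) p →ₗ[ℝ] TangentSpace (𝓡 n) p →ₗ[ℝ] E (m + 1) :=
  LinearMap.mk₂ ℝ
    (fun v w => (normalSpace n φ p).starProjection
      (fderiv ℝ (fderiv ℝ (fun x => (φ ((extChartAt (𝓡 n) p).symm x) : E (m + 1))))
        (extChartAt (𝓡 n) p p) (coords p v) (coords p w)))
    (by intros; simp) (by intros; simp) (by intros; simp) (by intros; simp)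

variable [RiemannianBundle (fun x : M => TangentSpace (𝓡 n) x)]

/-- `φ` is a smooth isometric immersion of the Riemannian manifold `M` into `S^m(1)`. -/
def IsIsometricImmersion (φ : M → S m) : Prop :=
  ContMDiff (𝓡 n) (𝓡 m) ∞ φ ∧
    ∀ (p : M) (v w : TangentSpace (𝓡 n) p), ⟪differential n φ p v, differential n φ p w⟫ = ⟪v, w⟫

/-- The shape operator `A_ξ`, determined by `⟨A_ξ v, w⟩ = ⟨h(v, w), ξ⟩`. -/
def shapeOperator (φ : M → S m) (p : M) (ξ : E (m + 1)) :
    TangentSpace (𝓡 n) p →ₗ[ℝ] TangentSpace (𝓡 n) p :=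
  ∑ i, ((innerₛₗ ℝ ξ).comp ((secondFundamentalForm n φ p).flip
    (stdOrthonormalBasis ℝ (TangentSpace (𝓡 n) p) i))).smulRight
      (stdOrthonormalBasis ℝ (TangentSpace (𝓡 n) p) i)

theorem inner_shapeOperator (φ : M → S m) (p : M) (ξ : E (m + 1)) (v w : TangentSpace (𝓡 n) p) :
    ⟪shapeOperator n φ p ξ v, w⟫ = ⟪secondFundamentalForm n φ p v w, ξ⟫ := by
  conv_rhs => rw [← (stdOrthonormalBasis ℝ (TangentSpace (𝓡 n) p)).sum_repr' w]
  simp [shapeOperator, sum_inner, inner_smul_left, real_inner_comm, mul_comm]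

/-- The mean curvature vector `H = (1/n) trace h`. -/
def meanCurvature (φ : M → S m) (p : M) : E (m + 1) :=
  (1 / (n : ℝ)) • ∑ i, secondFundamentalForm n φ p
    (stdOrthonormalBasis ℝ (TangentSpace (𝓡 n) p) i)
    (stdOrthonormalBasis ℝ (TangentSpace (𝓡 n) p) i)

/-- `φ` is minimal: its mean curvature vector vanishes identically. -/
def IsMinimal (φ : M → S m) : Prop :=
  ∀ p, meanCurvature n φ p = 0

/-- `φ` has type number `≤ r`: at every point and for every unit normal vector `ξ`, the shape
operator `A_ξ` has at most `r` nonzero eigenvalues, counted with multiplicity. -/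
def TypeNumberLE (φ : M → S m) (r : ℕ) : Prop :=
  ∀ p, ∀ ξ ∈ normalSpace n φ p, ‖ξ‖ = 1 →
    ((shapeOperator n φ p ξ).charpoly.roots.filter (· ≠ 0)).card ≤ r

/-- `φ` is `δ(n₁, …, n_k)`-ideal: at every point, equality holds in
`δ(n₁, …, n_k) ≤ n²(n + k - 1 - ∑ n_j) / (2 (n + k - ∑ n_j)) |H|² + (n(n-1) - ∑ n_j(n_j-1)) / 2`. -/
def IsDeltaIdeal {k : ℕ} (ν : Fin k → ℕ) (φ : M → S m) : Prop :=
  ∀ p, deltaInvariant (n := n) ν p =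
    ((n : ℝ) ^ 2 * (n + k - 1 - ∑ j, (ν j : ℝ))) / (2 * (n + k - ∑ j, (ν j : ℝ))) *
        ‖meanCurvature n φ p‖ ^ 2
      + (1 / 2) * ((n : ℝ) * (n - 1) - ∑ j, (ν j : ℝ) * (ν j - 1))

/-- `φ` is ideal: it is `δ(n₁, …, n_k)`-ideal for some admissible tuple `(n₁, …, n_k)`. -/
def IsIdeal (φ : M → S m) : Prop :=
  ∃ (k : ℕ) (ν : Fin k → ℕ), ν ∈ admissibleTuples n k ∧ IsDeltaIdeal n ν φ

end Extrinsic

section Model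

variable {n : ℕ}

/-- The coordinate `x_j`, numbered from `1`, of a point of `E n`. -/
def angle (x : E n) (j : ℕ) : ℝ :=
  if h : 1 ≤ j ∧ j - 1 < n then x ⟨j - 1, h.2⟩ else 0

/-- The explicit map
`(√(1-a²) sin x₁, cos x₁ sin x₂, …, sin x_{n-2} ∏_{j ≤ n-3} cos x_j, ∏_{j ≤ n-2} cos x_j,
  a sin x₁ sin x_{n-1}, a sin x₁ cos x_{n-1} sin x_n, a sin x₁ cos x_{n-1} cos x_n, 0, …, 0)`
from `E n` to `E (m + 1)`, for `n ≥ 3`. The entries are numbered from `0`. -/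
def modelMap (m : ℕ) (a : ℝ) (x : E n) : E (m + 1) :=
  WithLp.toLp 2 fun i : Fin (m + 1) =>
    if (i : ℕ) = 0 then √(1 - a ^ 2) * Real.sin (angle x 1)
    else if (i : ℕ) < n - 2 then
      Real.sin (angle x (i + 1)) * ∏ j ∈ Finset.Icc 1 (i : ℕ), Real.cos (angle x j)
    else if (i : ℕ) = n - 2 then ∏ j ∈ Finset.Icc 1 (n - 2), Real.cos (angle x j)
    else if (i : ℕ) = n - 1 then a * Real.sin (angle x 1) * Real.sin (angle x (n - 1))
    else if (i : ℕ) = n then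
      a * Real.sin (angle x 1) * Real.cos (angle x (n - 1)) * Real.sin (angle x n)
    else if (i : ℕ) = n + 1 then
      a * Real.sin (angle x 1) * Real.cos (angle x (n - 1)) * Real.cos (angle x n)
    else 0

/-- `φ` is congruent to the explicit immersion: up to one linear isometry `A` of `E (m + 1)`, every
point of `φ(M)` is of the form `modelMap m a x` with `sin x₁ > 0`; and whenever `φ p` has such
coordinates `x` at which `modelMap m a` is an immersion (that is, `x` is not one of the
singularities of the polar coordinates), then `x₁, …, x_n` are smooth local coordinates of `M`
around `p` in which `φ` is `A ∘ modelMap m a`. -/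
def IsCongruentToModel (n : ℕ) {m : ℕ} {M : Type*} [TopologicalSpace M] [ChartedSpace (E n) M]
    (φ : M → S m) (a : ℝ) : Prop :=
  ∃ A : E (m + 1) ≃ₗᵢ[ℝ] E (m + 1),
    (∀ p, ∃ x : E n, 0 < Real.sin (angle x 1) ∧ (φ p : E (m + 1)) = A (modelMap m a x)) ∧
    ∀ (p : M) (x : E n), (φ p : E (m + 1)) = A (modelMap m a x) →
      Function.Injective (fderiv ℝ (modelMap m a : E n → E (m + 1)) x) →
      ∃ ψ : M → E n, ψ p = x ∧ IsLocalDiffeomorphAt (𝓡 n) 𝓘(ℝ, E n) ∞ ψ p ∧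
        ∀ᶠ q in 𝓝 p, (φ q : E (m + 1)) = A (modelMap m a (ψ q))

/-- `φ(M)` lies in a totally geodesic `d`-dimensional unit sphere of `S^m(1)`, i.e. in the
intersection of `S^m(1)` with a linear subspace of dimension `d + 1`. -/
def LiesInTotallyGeodesicSphere {m : ℕ} {M : Type*} (φ : M → S m) (d : ℕ) : Prop :=
  ∃ W : Submodule ℝ (E (m + 1)), Module.finrank ℝ W = d + 1 ∧ ∀ p, (φ p : E (m + 1)) ∈ W

end Model

end IdealSubmanifold

end

open IdealSubmanifold

/-! Pointwise step. By the Gauss equation the defect in Chen's inequality is half of a sum of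
squares: the entries of h between different blocks, plus the variance of the block traces, where
each of the n - ∑ n_j leftover frame vectors counts as a block. Compactness supplies a frame whose
blocks attain the infimum (`exists_orthonormalBasis_sInf_eq`), so equality makes h block diagonal
with equal block traces (`block_structure_of_delta_eq`). If H ≠ 0 at the point, each block
contributes to the rank of the shape operator of H, so rank at most 2 leaves exactly two blocks. The
vanishing of 3 × 3 minors then makes each block of rank one with values in ℝH
(`rank_two_structure`): h = (u₁ ⊗ u₁ + u₂ ⊗ u₂) (n/2) H.

Local step. Where H ≠ 0, write h = λ⟨P·,·⟩ξ with P the projection onto a field of planes and ξ a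
unit normal. The integrability conditions are all obtained as symmetry of second derivatives of
projection-valued maps (`symOp_clairaut`). They show that ξ is parallel in the normal bundle
(`dξ_eq`), that λ is constant along the planes (`dlam_eq_zero`), and that dP is the symmetric
product of P df with the vector L = λξ - f + ∇ log λ (`dP_eq`). The derivative of L stays in the
span of L and the plane (`dL_eq`). This closed system has three constants: the vector ξ - λ|L|⁻²L,
the 3-space spanned by the plane and L, and the (n+2)-space spanned by the tangent space, the
position and ξ.

Global step. The axis vector has square length 1 - λ²/|L|², and |L|² ≥ λ² + 1. A constant axis
therefore bounds λ away from 0, so on a connected M the condition H ≠ 0 at one point propagates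
everywhere, and the three constants are global (`invariants_eq`). Pairing them with the position
vector puts φ(M) on the unit sphere of the (n+2)-space intersected with a quadratic cone
(`exists_quadratic_cone`), where 1 - a² = λ²/|L|².

Model. F_a is a pair of polar coordinate systems on this n-dimensional intersection and reaches
every point with positive axis coordinate (`exists_modelMap_eq`). Two immersions of n-dimensional
spaces into it through a common point differ near that point by a local diffeomorphism, found by
composing both with one linear projection (`exists_angle_coordinates`). -/

noncomputable section

namespace IdealSubmanifold

/-! ### Traces, scalar curvature of a subspace, and operators of rank at most two. -/

section Algebra

variable {V F : Type*} [NormedAddCommGroup V] [InnerProductSpace ℝ V]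
  [NormedAddCommGroup F] [InnerProductSpace ℝ F]

/-- The trace of a bilinear map does not depend on the orthonormal basis. -/
theorem sum_bilin_orthonormalBasis {ι κ G : Type*} [Fintype ι] [Fintype κ]
    [AddCommGroup G] [Module ℝ G]
    (b : OrthonormalBasis ι ℝ V) (c : OrthonormalBasis κ ℝ V) (B : V →ₗ[ℝ] V →ₗ[ℝ] G) :
    ∑ i, B (b i) (b i) = ∑ j, B (c j) (c j) := by
  classical
  have h1 : ∀ i, B (b i) (b i) =
      ∑ j, ∑ k, (⟪c j, b i⟫ * ⟪b i, c k⟫) • B (c j) (c k) := by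
    intro i
    conv_lhs => rw [← c.sum_repr' (b i)]
    simp only [map_sum, map_smul, LinearMap.sum_apply, LinearMap.smul_apply, Finset.smul_sum,
      smul_smul]
    rw [Finset.sum_comm]
    refine Finset.sum_congr rfl fun j _ => Finset.sum_congr rfl fun k _ => ?_
    rw [real_inner_comm (c k) (b i), mul_comm]
  simp_rw [h1]
  rw [Finset.sum_comm]
  refine Finset.sum_congr rfl fun j _ => ?_
  rw [Finset.sum_comm]
  simp_rw [← Finset.sum_smul, b.sum_inner_mul_inner]
  simp [orthonormal_iff_ite.mp c.orthonormal]

/-- The extrinsic part of the scalar curvature of a family of vectors. -/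
def extrinsicScalar {ι : Type*} [Fintype ι] (h : V →ₗ[ℝ] V →ₗ[ℝ] F) (v : ι → V) : ℝ :=
  (1 / 2) * (‖∑ i, h (v i) (v i)‖ ^ 2 - ∑ i, ∑ j, ‖h (v i) (v j)‖ ^ 2)

/-- The form `(u, v) ↦ ⟨h(u, w), h(v, w')⟩`. -/
def pairForm (h : V →ₗ[ℝ] V →ₗ[ℝ] F) (w : V) : V →ₗ[ℝ] V →ₗ[ℝ] ℝ :=
  LinearMap.mk₂ ℝ (fun u v => ⟪h u w, h v w⟫)
    (by intros; simp [inner_add_left]) (by intros; simp [inner_smul_left])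
    (by intros; simp [inner_add_right]) (by intros; simp [inner_smul_right])

/-- With one argument frozen, the sum of squares over the other is the trace of `pairForm`; the
basis is exchanged one slot at a time. -/
theorem sum_normSq_orthonormalBasis {ι κ : Type*} [Fintype ι] [Fintype κ]
    (b : OrthonormalBasis ι ℝ V) (c : OrthonormalBasis κ ℝ V) (h : V →ₗ[ℝ] V →ₗ[ℝ] F) :
    ∑ i, ∑ j, ‖h (b i) (b j)‖ ^ 2 = ∑ i, ∑ j, ‖h (c i) (c j)‖ ^ 2 := by
  have h1 : ∀ w, ∑ i, ‖h (b i) w‖ ^ 2 = ∑ i, ‖h (c i) w‖ ^ 2 := fun w => by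
    simpa [pairForm] using sum_bilin_orthonormalBasis b c (pairForm h w)
  have h2 : ∀ w, ∑ i, ‖h w (b i)‖ ^ 2 = ∑ i, ‖h w (c i)‖ ^ 2 := fun w => by
    simpa [pairForm] using sum_bilin_orthonormalBasis b c (pairForm h.flip w)
  rw [Finset.sum_comm]
  simp_rw [h1]
  rw [Finset.sum_comm]
  simp_rw [h2]

/-- Both terms are traces of `h` restricted to `L`. This is what frees τ(L) from the basis chosen in
its definition. -/
theorem extrinsicScalar_eq {ι κ : Type*} [Fintype ι] [Fintype κ] (h : V →ₗ[ℝ] V →ₗ[ℝ] F)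
    {L : Submodule ℝ V} (b : OrthonormalBasis ι ℝ L) (c : OrthonormalBasis κ ℝ L) :
    extrinsicScalar h (fun i => (b i : V)) = extrinsicScalar h (fun i => (c i : V)) := by
  have h1 := sum_bilin_orthonormalBasis b c (h.compl₁₂ L.subtype L.subtype)
  have h2 := sum_normSq_orthonormalBasis b c (h.compl₁₂ L.subtype L.subtype)
  simp only [LinearMap.compl₁₂_apply, Submodule.subtype_apply] at h1 h2
  simp only [extrinsicScalar, h1, h2]

/-- The summand is the Gauss curvature of an orthonormal pair in a submanifold of the unit sphere.
It is symmetric in α, β, so the sum over α < β is half the off-diagonal sum. Each diagonal term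
equals 1, which accounts for r² - r. -/
theorem sum_Ioi_extrinsic {r : ℕ} (h : V →ₗ[ℝ] V →ₗ[ℝ] F) (hs : ∀ u v, h u v = h v u)
    (v : Fin r → V) :
    ∑ α, ∑ β ∈ Finset.Ioi α,
      (⟪h (v α) (v α), h (v β) (v β)⟫ - ‖h (v α) (v β)‖ ^ 2 + 1) =
      extrinsicScalar h v + (r : ℝ) * (r - 1) / 2 := by
  classical
  set f : Fin r → Fin r → ℝ :=
    fun α β => ⟪h (v α) (v α), h (v β) (v β)⟫ - ‖h (v α) (v β)‖ ^ 2 + 1 with hf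
  have hsym : ∀ α β, f α β = f β α := fun α β => by
    simp only [hf]; rw [real_inner_comm, hs (v α) (v β)]
  have h1 := Finset.sum_sum_Ioi_add_eq_sum_sum_off_diag f
  have h2 : ∑ i, ∑ j ∈ Finset.Ioi i, (f j i + f i j) = 2 * ∑ i, ∑ j ∈ Finset.Ioi i, f i j := by
    simp_rw [Finset.mul_sum]
    refine Finset.sum_congr rfl fun i _ => Finset.sum_congr rfl fun j _ => ?_
    rw [hsym j i]; ring
  have h3 : ∀ i, ∑ j ∈ {i}ᶜ, f j i = ∑ j, f j i - 1 := fun i => by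
    have := Finset.sum_compl_add_sum ({i} : Finset (Fin r)) (fun j => f j i)
    simp only [Finset.sum_singleton] at this
    have h4 : f i i = 1 := by simp [hf]
    linarith
  have h4 : ∑ i, ∑ j, f j i = ‖∑ i, h (v i) (v i)‖ ^ 2 - ∑ i, ∑ j, ‖h (v i) (v j)‖ ^ 2 + r * r := by
    rw [Finset.sum_comm]
    simp only [hf, Finset.sum_add_distrib, Finset.sum_sub_distrib]
    rw [← real_inner_self_eq_norm_sq, sum_inner]
    simp_rw [inner_sum]
    simp
  simp_rw [h3] at h1
  rw [Finset.sum_sub_distrib, h4, h2] at h1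
  simp only [Finset.sum_const, Finset.card_univ, Fintype.card_fin, nsmul_eq_mul, mul_one] at h1
  change ∑ i, ∑ j ∈ Finset.Ioi i, f i j = _
  rw [extrinsicScalar]
  linarith

/-- If a real symmetric operator has at most two nonzero eigenvalues, all its `3 × 3` minors
vanish. -/
theorem det_inner_eq_zero_of_card_roots_le [FiniteDimensional ℝ V] {A : V →ₗ[ℝ] V}
    (hA : A.IsSymmetric) (hr : (A.charpoly.roots.filter (· ≠ 0)).card ≤ 2) (x y : Fin 3 → V) :
    (Matrix.of fun i j => ⟪A (x i), y j⟫).det = 0 := by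
  classical
  have hn : Module.finrank ℝ V = Module.finrank ℝ V := rfl
  set e := hA.eigenvectorBasis hn
  set Z := (Finset.univ.filter fun i => hA.eigenvalues hn i ≠ 0)
  have hcard : Z.card ≤ 2 := by
    rw [hA.roots_charpoly_eq_eigenvalues hn, Multiset.filter_map, Multiset.card_map] at hr
    exact hr
  -- The range of `A` is spanned by the at most two eigenvectors with nonzero eigenvalue, so three
  -- vectors `A (x i)` are dependent, and a dependency is a left null vector of the matrix.
  have hmem : ∀ v, A v ∈ Submodule.span ℝ (e '' Z) := by
    intro v
    rw [← e.sum_repr' (A v)]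
    refine Submodule.sum_mem _ fun i _ => ?_
    by_cases hi : hA.eigenvalues hn i = 0
    · have : ⟪e i, A v⟫ = 0 := by
        rw [← hA, hA.apply_eigenvectorBasis, hi]; simp
      rw [this]; simp
    · exact Submodule.smul_mem _ _ (Submodule.subset_span ⟨i, by simpa [Z] using hi, rfl⟩)
  have hfin : Module.finrank ℝ (Submodule.span ℝ (e '' (Z : Set (Fin (Module.finrank ℝ V))))) ≤ 2 := by
    refine le_trans (finrank_span_le_card (R := ℝ) _) ?_
    rw [Set.toFinset_card, ← Nat.card_eq_fintype_card]
    refine le_trans (Nat.card_image_le (Z.finite_toSet)) ?_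
    simpa using hcard
  have hdep : ¬ LinearIndependent ℝ (fun i : Fin 3 =>
      (⟨A (x i), hmem (x i)⟩ : Submodule.span ℝ (e '' (Z : Set _)))) := by
    intro hli
    have := hli.fintype_card_le_finrank
    simp at this
    omega
  obtain ⟨g, hg, i, hi⟩ := Fintype.not_linearIndependent_iff.mp hdep
  have hg' : ∑ i, g i • A (x i) = 0 := by
    have := congrArg (Submodule.subtype _) hg
    simpa using this
  refine Matrix.exists_vecMul_eq_zero_iff.mp ⟨g, fun h0 => hi (congrFun h0 i), ?_⟩
  ext j
  have := congrArg (fun w => ⟪w, y j⟫) hg'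
  simpa [Matrix.vecMul, dotProduct, sum_inner, inner_smul_left] using this

end Algebra

/-! ### The equality case of Chen's inequality. -/

section Chen

variable {V F : Type*} [NormedAddCommGroup V] [InnerProductSpace ℝ V]
  [NormedAddCommGroup F] [InnerProductSpace ℝ F]

/-- The index set of a frame adapted to blocks of sizes `ν j` and `r` further vectors. -/
abbrev BlockIndex {k : ℕ} (ν : Fin k → ℕ) (r : ℕ) : Type := (Σ j, Fin (ν j)) ⊕ Fin r

/-- The block of an index; each of the last `r` vectors is a block of its own. -/
def block {k : ℕ} (ν : Fin k → ℕ) (r : ℕ) : BlockIndex ν r → Fin k ⊕ Fin r :=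
  Sum.map Sigma.fst id

@[simp]
theorem block_inl {k : ℕ} (ν : Fin k → ℕ) (r : ℕ) (a : Σ j, Fin (ν j)) :
    block ν r (Sum.inl a) = Sum.inl a.1 := rfl

@[simp]
theorem block_inr {k : ℕ} (ν : Fin k → ℕ) (r : ℕ) (a : Fin r) :
    block ν r (Sum.inr a) = Sum.inr a := rfl

/-- Needed so that the infimum in the δ-invariant is a minimum. -/
theorem isCompact_setOf_orthonormal {ι : Type*} [Fintype ι] [FiniteDimensional ℝ V] :
    IsCompact {e : ι → V | Orthonormal ℝ e} := by
  classical
  have : ProperSpace V := FiniteDimensional.proper_real V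
  refine Metric.isCompact_of_isClosed_isBounded ?_ ?_
  · simp_rw [orthonormal_iff_ite]
    simp only [Set.ofPred_forall]
    refine isClosed_iInter fun i => isClosed_iInter fun j => ?_
    exact isClosed_eq ((continuous_apply i).inner (continuous_apply j)) continuous_const
  · refine (Metric.isBounded_closedBall (x := (0 : ι → V)) (r := 1)).subset fun e he => ?_
    rw [mem_closedBall_zero_iff, pi_norm_le_iff_of_nonneg zero_le_one]
    exact fun i => (he.1 i).le

theorem continuous_extrinsicScalar {ι κ : Type*} [Fintype ι] [Fintype κ] [FiniteDimensional ℝ V]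
    (h : V →ₗ[ℝ] V →ₗ[ℝ] F) (g : ι → κ) :
    Continuous fun e : κ → V => extrinsicScalar h (fun i => e (g i)) := by
  have hc : ∀ i j : κ, Continuous fun e : κ → V => h (e i) (e j) := by
    intro i j
    have h1 : Continuous fun p : V × V => h p.1 p.2 := by
      let b := Module.finBasis ℝ V
      have : (fun p : V × V => h p.1 p.2) =
          fun p => ∑ i, b.repr p.1 i • h (b i) p.2 := by
        ext p
        conv_lhs => rw [← b.sum_repr p.1]
        simp only [map_sum, map_smul, LinearMap.sum_apply, LinearMap.smul_apply]
      rw [this]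
      refine continuous_finsetSum _ fun i _ => ?_
      refine Continuous.smul ?_ ?_
      · exact (LinearMap.continuous_of_finiteDimensional (b.coord i)).comp continuous_fst
      · exact (LinearMap.continuous_of_finiteDimensional (h (b i))).comp continuous_snd
    exact h1.comp (f := fun e : κ → V => (e i, e j)) (by fun_prop)
  exact continuous_const.mul (((continuous_finsetSum _ fun i _ => hc _ _).norm.pow 2).sub
    (continuous_finsetSum _ fun i _ => continuous_finsetSum _ fun j _ => (hc _ _).norm.pow 2))

/-- The infimum in the definition of the `δ`-invariant is attained on the blocks of an orthonormal
basis. -/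
theorem exists_orthonormalBasis_sInf_eq [FiniteDimensional ℝ V] {k : ℕ} {ν : Fin k → ℕ} {r : ℕ}
    (hdim : Module.finrank ℝ V = ∑ j, ν j + r)
    (h : V →ₗ[ℝ] V →ₗ[ℝ] F) (τ : Submodule ℝ V → ℝ)
    (hτ : ∀ (L : Submodule ℝ V) (s : ℕ) (b : OrthonormalBasis (Fin s) ℝ L),
      τ L = extrinsicScalar h (fun i => (b i : V)) + (s : ℝ) * (s - 1) / 2) :
    ∃ e : OrthonormalBasis (BlockIndex ν r) ℝ V,
      sInf {t : ℝ | ∃ L : Fin k → Submodule ℝ V,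
        (∀ j, Module.finrank ℝ (L j) = ν j) ∧ (Pairwise fun i j => L i ⟂ L j) ∧
        t = ∑ j, τ (L j)} =
      ∑ j, (extrinsicScalar h (fun i : Fin (ν j) => e (Sum.inl ⟨j, i⟩)) +
        (ν j : ℝ) * (ν j - 1) / 2) := by
  classical
  have hcard : Module.finrank ℝ V = Fintype.card (BlockIndex ν r) := by
    simp [hdim]
  set Φ : (BlockIndex ν r → V) → ℝ := fun e =>
    ∑ j, (extrinsicScalar h (fun i : Fin (ν j) => e (Sum.inl ⟨j, i⟩)) +
        (ν j : ℝ) * (ν j - 1) / 2) with hΦ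
  have hΦc : Continuous Φ := by
    refine continuous_finsetSum _ fun j _ => Continuous.add ?_ continuous_const
    exact continuous_extrinsicScalar h (fun i : Fin (ν j) => (Sum.inl ⟨j, i⟩ : BlockIndex ν r))
  have hne : {e : BlockIndex ν r → V | Orthonormal ℝ e}.Nonempty := by
    let b := (stdOrthonormalBasis ℝ V).reindex (Fintype.equivOfCardEq (by simp [hdim]) :
      Fin (Module.finrank ℝ V) ≃ BlockIndex ν r)
    exact ⟨b, b.orthonormal⟩
  obtain ⟨e, he, hmin⟩ := isCompact_setOf_orthonormal.exists_isMinOn hne hΦc.continuousOn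
  have hspan : ⊤ ≤ Submodule.span ℝ (Set.range e) := by
    rw [he.linearIndependent.span_eq_top_of_card_eq_finrank' hcard.symm]
  refine ⟨OrthonormalBasis.mk he hspan, ?_⟩
  simp only [OrthonormalBasis.coe_mk]
  change _ = Φ e
  -- The blocks of the minimizing frame span an admissible family of subspaces; conversely every
  -- admissible family extends to a frame, on which Φ is no smaller.
  refine IsLeast.csInf_eq ⟨?_, ?_⟩
  · refine ⟨fun j => Submodule.span ℝ (Set.range fun i : Fin (ν j) => e (Sum.inl ⟨j, i⟩)),
      fun j => ?_, fun i j hij => ?_, ?_⟩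
    · have hli : LinearIndependent ℝ fun i : Fin (ν j) => e (Sum.inl ⟨j, i⟩) :=
        he.linearIndependent.comp (fun i : Fin (ν j) => (Sum.inl ⟨j, i⟩ : BlockIndex ν r))
          fun a b hab => by simpa using hab
      simpa using finrank_span_eq_card hli
    · change Submodule.span ℝ _ ⟂ Submodule.span ℝ _
      rw [Submodule.isOrtho_span]
      rintro _ ⟨a, rfl⟩ _ ⟨b, rfl⟩
      exact he.2 (by simp [hij])
    · refine Finset.sum_congr rfl fun j _ => ?_
      have ho : Orthonormal ℝ fun i : Fin (ν j) => e (Sum.inl ⟨j, i⟩) :=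
        he.comp (fun i : Fin (ν j) => (Sum.inl ⟨j, i⟩ : BlockIndex ν r))
          fun a b hab => by simpa using hab
      have hli := ho.linearIndependent
      let b := Module.Basis.span hli
      have hb : Orthonormal ℝ b := by
        have : ∀ i, (b i : V) = e (Sum.inl ⟨j, i⟩) := fun i => by simp [b, Module.Basis.span_apply]
        rw [orthonormal_iff_ite]
        intro a c
        rw [Submodule.coe_inner, this, this]
        exact orthonormal_iff_ite.mp ho a c
      rw [hτ _ (ν j) (b.toOrthonormalBasis hb)]
      congr 2
      ext i
      simp [b, Module.Basis.span_apply]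
  · rintro t ⟨L, hL, hort, rfl⟩
    let b : ∀ j, OrthonormalBasis (Fin (ν j)) ℝ (L j) := fun j =>
      (stdOrthonormalBasis ℝ (L j)).reindex (finCongr (hL j))
    set v : BlockIndex ν r → V := Sum.elim (fun p => (b p.1 p.2 : V)) (fun _ => 0) with hv
    have hvi : ∀ a c : Σ j, Fin (ν j), ⟪v (Sum.inl a), v (Sum.inl c)⟫ = if a = c then 1 else 0 := by
      rintro ⟨j, i⟩ ⟨j', i'⟩
      simp only [hv, Sum.elim_inl]
      by_cases hj : j = j'
      · subst hj
        rw [← Submodule.coe_inner, orthonormal_iff_ite.mp (b j).orthonormal]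
        simp
      · rw [(Submodule.isOrtho_iff_inner_eq.mp (hort hj)) _ (b j i).2 _ (b j' i').2]
        simp [hj]
    have hvo : Orthonormal ℝ
        ((Set.range (Sum.inl : (Σ j, Fin (ν j)) → BlockIndex ν r)).domRestrict v) := by
      rw [orthonormal_iff_ite]
      rintro ⟨x, hx⟩ ⟨y, hy⟩
      obtain ⟨a, rfl⟩ := id hx
      obtain ⟨c, rfl⟩ := id hy
      simpa [Subtype.ext_iff] using hvi a c
    obtain ⟨c, hc⟩ := hvo.exists_orthonormalBasis_extension_of_card_eq hcard
    have h1 : Φ e ≤ Φ c := hmin c.orthonormal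
    refine h1.trans_eq ?_
    refine Finset.sum_congr rfl fun j _ => ?_
    rw [hτ _ (ν j) (b j)]
    congr 2
    ext i
    rw [hc _ ⟨_, rfl⟩]
    simp [hv]

/-- The variance identity. With B the set of blocks, it turns the Cauchy–Schwarz loss for the block
traces into a sum of squares. -/
theorem norm_sum_sub_mean {B : Type*} [Fintype B] (T : B → F) (hB : 0 < Fintype.card B) :
    ∑ b, ‖T b - (1 / (Fintype.card B : ℝ)) • ∑ c, T c‖ ^ 2 =
      ∑ b, ‖T b‖ ^ 2 - (1 / (Fintype.card B : ℝ)) * ‖∑ c, T c‖ ^ 2 := by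
  have hN : (Fintype.card B : ℝ) ≠ 0 := by positivity
  simp_rw [norm_sub_sq_real, Finset.sum_add_distrib, Finset.sum_sub_distrib, inner_smul_right,
    ← Finset.mul_sum, ← sum_inner, real_inner_self_eq_norm_sq]
  rw [norm_smul]
  simp
  field_simp
  ring

/-- The equality case of Chen's inequality: the second fundamental form is block diagonal, and the
traces of all blocks agree. -/
theorem block_structure_of_delta_eq [FiniteDimensional ℝ V] {k : ℕ} {ν : Fin k → ℕ} {r n : ℕ}
    (hk : 0 < k) (h : V →ₗ[ℝ] V →ₗ[ℝ] F) (e : OrthonormalBasis (BlockIndex ν r) ℝ V) (τ : ℝ)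
    (hτ : τ = extrinsicScalar h e + (n : ℝ) * (n - 1) / 2)
    (hδ : τ - ∑ j, (extrinsicScalar h (fun i : Fin (ν j) => e (Sum.inl ⟨j, i⟩)) +
        (ν j : ℝ) * (ν j - 1) / 2) =
      ((k : ℝ) + r - 1) / (2 * (k + r)) * ‖∑ i, h (e i) (e i)‖ ^ 2
      + (1 / 2) * ((n : ℝ) * (n - 1) - ∑ j, (ν j : ℝ) * (ν j - 1))) :
    (∀ i j, block ν r i ≠ block ν r j → h (e i) (e j) = 0) ∧
    ∀ b, ∑ i with block ν r i = b, h (e i) (e i) =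
      (1 / ((k : ℝ) + r)) • ∑ i, h (e i) (e i) := by
  classical
  set T : Fin k ⊕ Fin r → F := fun b => ∑ i with block ν r i = b, h (e i) (e i) with hT
  have hsumT : ∑ b, T b = ∑ i, h (e i) (e i) :=
    Finset.sum_fiberwise _ _ _
  have hT1 : ∀ j, T (Sum.inl j) = ∑ i : Fin (ν j), h (e (Sum.inl ⟨j, i⟩)) (e (Sum.inl ⟨j, i⟩)) := by
    intro j
    simp only [hT, Finset.sum_filter, Fintype.sum_sum_type, block_inl, block_inr,
      Sum.inl.injEq, reduceCtorEq, if_false, Finset.sum_const_zero, add_zero]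
    rw [Fintype.sum_sigma]
    rw [Finset.sum_eq_single j]
    · simp
    · intro b _ hb; simp [hb]
    · simp
  have hT2 : ∀ j, T (Sum.inr j) = h (e (Sum.inr j)) (e (Sum.inr j)) := by
    intro j
    simp only [hT, Finset.sum_filter, Fintype.sum_sum_type, block_inl, block_inr,
      Sum.inr.injEq, reduceCtorEq, if_false, Finset.sum_const_zero, zero_add]
    simp
  -- the part of `∑ ‖h‖²` within the blocks
  have hin : ∑ i, ∑ j, (if block ν r i = block ν r j then ‖h (e i) (e j)‖ ^ 2 else 0) =
      ∑ j, (∑ a : Fin (ν j), ∑ b : Fin (ν j),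
        ‖h (e (Sum.inl ⟨j, a⟩)) (e (Sum.inl ⟨j, b⟩))‖ ^ 2) +
      ∑ j : Fin r, ‖h (e (Sum.inr j)) (e (Sum.inr j))‖ ^ 2 := by
    rw [Fintype.sum_sum_type]
    congr 1
    · rw [Fintype.sum_sigma]
      refine Finset.sum_congr rfl fun j _ => Finset.sum_congr rfl fun a _ => ?_
      simp only [Fintype.sum_sum_type, block_inl, block_inr,
        Sum.inl.injEq, reduceCtorEq, if_false, Finset.sum_const_zero, add_zero]
      rw [Fintype.sum_sigma, Finset.sum_eq_single j]
      · simp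
      · intro b _ hb; simp [Ne.symm hb]
      · simp
    · refine Finset.sum_congr rfl fun j _ => ?_
      simp [Fintype.sum_sum_type]
  have hsplit : ∑ i, ∑ j, ‖h (e i) (e j)‖ ^ 2 =
      ∑ i, ∑ j, (if block ν r i = block ν r j then ‖h (e i) (e j)‖ ^ 2 else 0) +
      ∑ i, ∑ j, (if block ν r i = block ν r j then 0 else ‖h (e i) (e j)‖ ^ 2) := by
    simp_rw [← Finset.sum_add_distrib]
    refine Finset.sum_congr rfl fun i _ => Finset.sum_congr rfl fun j _ => ?_
    split_ifs <;> simp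
  have hN : ((Fintype.card (Fin k ⊕ Fin r) : ℕ) : ℝ) = k + r := by simp
  have hmean := norm_sum_sub_mean T (by simp; omega)
  rw [hN, hsumT, Fintype.sum_sum_type (fun b => ‖T b‖ ^ 2)] at hmean
  simp_rw [hT1, hT2] at hmean
  have hNpos : (0 : ℝ) < k + r := by positivity
  rw [hτ] at hδ
  simp only [extrinsicScalar, Finset.sum_add_distrib, ← Finset.mul_sum, Finset.sum_sub_distrib,
    ← Finset.sum_div] at hδ
  rw [hsplit, hin] at hδ
  have hfrac : ((k : ℝ) + r - 1) / (2 * (k + r)) = 1 / 2 - 1 / 2 * (1 / (k + r)) := by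
    field_simp
  rw [hfrac] at hδ
  have hA := Finset.sum_nonneg fun b (_ : b ∈ Finset.univ) =>
    sq_nonneg ‖T b - (1 / ((k : ℝ) + r)) • ∑ i, h (e i) (e i)‖
  have hC : 0 ≤ ∑ i, ∑ j, (if block ν r i = block ν r j then 0 else ‖h (e i) (e j)‖ ^ 2) :=
    Finset.sum_nonneg fun i _ => Finset.sum_nonneg fun j _ => by split_ifs <;> positivity
  -- For a one-element block ‖h‖² is already the square of its trace. Hence `hδ` compares ‖∑ T‖²/(k
  -- + r) with ∑ ‖T b‖² plus the cross-block terms, which says exactly that two nonnegative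
  -- quantities add up to 0.
  have key : ∑ b, ‖T b - (1 / ((k : ℝ) + r)) • ∑ i, h (e i) (e i)‖ ^ 2 +
      ∑ i, ∑ j, (if block ν r i = block ν r j then 0 else ‖h (e i) (e j)‖ ^ 2) = 0 := by
    rw [hmean]; linarith
  constructor
  · intro i j hij
    have h0 : ∑ i, ∑ j, (if block ν r i = block ν r j then 0 else ‖h (e i) (e j)‖ ^ 2) = 0 := by
      linarith
    rw [Finset.sum_eq_zero_iff_of_nonneg fun i _ => Finset.sum_nonneg fun j _ => by
      split_ifs <;> positivity] at h0
    have h1 := h0 i (Finset.mem_univ _)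
    rw [Finset.sum_eq_zero_iff_of_nonneg fun j _ => by split_ifs <;> positivity] at h1
    simpa [hij] using h1 j (Finset.mem_univ _)
  · intro b
    have h0 : ∑ b, ‖T b - (1 / ((k : ℝ) + r)) • ∑ i, h (e i) (e i)‖ ^ 2 = 0 := by linarith
    rw [Finset.sum_eq_zero_iff_of_nonneg fun b _ => sq_nonneg _] at h0
    have := h0 b (Finset.mem_univ _)
    rw [pow_eq_zero_iff two_ne_zero, norm_eq_zero, sub_eq_zero] at this
    exact this

end Chen

/-! ### Block diagonal forms with equal traces and rank at most two. -/

section TypeNumber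

variable {V F : Type*} [NormedAddCommGroup V] [InnerProductSpace ℝ V]
  [NormedAddCommGroup F] [InnerProductSpace ℝ F]

/-- Three nonzero sample points determine a quadratic. This replaces a limit t → 0 in passing from ξ
+ tT to ξ. -/
theorem constant_coeff_eq_zero_of_quadratic {a b c : ℝ}
    (h : ∀ t : ℝ, t ≠ 0 → a * t ^ 2 + b * t + c = 0) : c = 0 := by
  have h1 := h 1 (by norm_num)
  have h2 := h (-1) (by norm_num)
  have h3 := h 2 (by norm_num)
  linarith

/-- A block diagonal bilinear form with nonvanishing equal block traces, all of whose scalar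
components have rank at most two, has exactly two blocks, and each of them has rank one and takes
its values in the line of the trace. -/
theorem rank_two_structure {I B : Type*} [Fintype I] [Fintype B] [DecidableEq B]
    (e : OrthonormalBasis I ℝ V) (blk : I → B) (h : V →ₗ[ℝ] V →ₗ[ℝ] F)
    (hs : ∀ u v, h u v = h v u) (N : Submodule ℝ F) (hN : ∀ u v, h u v ∈ N)
    (hdet : ∀ ξ ∈ N, ∀ x y : Fin 3 → V, (Matrix.of fun i j => ⟪h (x i) (y j), ξ⟫).det = 0)
    (hcross : ∀ i j, blk i ≠ blk j → h (e i) (e j) = 0) (T : F) (hT : T ≠ 0)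
    (htr : ∀ b, ∑ i with blk i = b, h (e i) (e i) = T) (hB : 2 ≤ Fintype.card B) :
    Fintype.card B = 2 ∧ ∃ u₁ u₂ : V, ‖u₁‖ = 1 ∧ ‖u₂‖ = 1 ∧ ⟪u₁, u₂⟫ = 0 ∧
      ∀ v w, h v w = (⟪u₁, v⟫ * ⟪u₁, w⟫ + ⟪u₂, v⟫ * ⟪u₂, w⟫) • T := by
  classical
  have hTT : ⟪T, T⟫ ≠ 0 := inner_self_ne_zero.mpr hT
  have hTN : T ∈ N := by
    have : Nonempty B := Fintype.card_pos_iff.mp (by omega)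
    rw [← htr (Classical.arbitrary B)]
    exact N.sum_mem fun i _ => hN _ _
  -- Every block has trace T, so for ⟪T, ξ⟫ ≠ 0 some diagonal entry of the ξ-component is nonzero in
  -- each block.
  have hex : ∀ b, ∀ ξ, ⟪T, ξ⟫ ≠ 0 → ∃ i, blk i = b ∧ ⟪h (e i) (e i), ξ⟫ ≠ 0 := by
    intro b ξ hξ
    by_contra! hcon
    apply hξ
    rw [← htr b, sum_inner]
    exact Finset.sum_eq_zero fun i hi => hcon i (by simpa using hi)
  -- Nonzero diagonal entries from three different blocks would form a diagonal 3 × 3 minor with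
  -- nonzero determinant.
  have hcard : Fintype.card B = 2 := by
    by_contra hne
    obtain ⟨b₀, b₁, b₂, h01, h02, h12⟩ := Fintype.two_lt_card_iff.mp (by omega : 2 < Fintype.card B)
    obtain ⟨i₀, hi₀, hh₀⟩ := hex b₀ T hTT
    obtain ⟨i₁, hi₁, hh₁⟩ := hex b₁ T hTT
    obtain ⟨i₂, hi₂, hh₂⟩ := hex b₂ T hTT
    have hd := hdet T hTN ![e i₀, e i₁, e i₂] ![e i₀, e i₁, e i₂]
    have c01 : h (e i₀) (e i₁) = 0 := hcross _ _ (by rw [hi₀, hi₁]; exact h01)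
    have c02 : h (e i₀) (e i₂) = 0 := hcross _ _ (by rw [hi₀, hi₂]; exact h02)
    have c12 : h (e i₁) (e i₂) = 0 := hcross _ _ (by rw [hi₁, hi₂]; exact h12)
    have c10 : h (e i₁) (e i₀) = 0 := by rw [hs, c01]
    have c20 : h (e i₂) (e i₀) = 0 := by rw [hs, c02]
    have c21 : h (e i₂) (e i₁) = 0 := by rw [hs, c12]
    simp [Matrix.det_fin_three, c01, c02, c12, c10, c20, c21] at hd
    tauto
  refine ⟨hcard, ?_⟩
  -- the `2 × 2` minors in a block
  have hminor : ∀ ξ ∈ N, ⟪T, ξ⟫ ≠ 0 → ∀ a c d, blk c = blk a → blk d = blk a →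
      ⟪h (e a) (e a), ξ⟫ * ⟪h (e c) (e d), ξ⟫ = ⟪h (e a) (e c), ξ⟫ * ⟪h (e a) (e d), ξ⟫ := by
    intro ξ hξN hξ a c d hc hd
    -- Bordering the 2 × 2 minor by a nonzero diagonal entry of the other block gives a 3 × 3
    -- determinant equal to their product, so the minor itself vanishes.
    obtain ⟨b, hb⟩ := Fintype.exists_ne_of_one_lt_card (by omega) (blk a)
    obtain ⟨f, hf, hff⟩ := hex b ξ hξ
    have hdt := hdet ξ hξN ![e a, e c, e f] ![e a, e d, e f]
    have c1 : h (e a) (e f) = 0 := hcross _ _ (by rw [hf]; exact hb.symm)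
    have c2 : h (e f) (e a) = 0 := by rw [hs, c1]
    have c3 : h (e c) (e f) = 0 := hcross _ _ (by rw [hf, hc]; exact hb.symm)
    have c4 : h (e f) (e d) = 0 := hcross _ _ (by rw [hf, hd]; exact hb)
    simp only [Matrix.det_fin_three, Matrix.of_apply, Matrix.cons_val_zero, Matrix.cons_val_one,
      Matrix.cons_val_two, Matrix.tail_cons, Matrix.head_cons, c1, c2, c3, c4,
      inner_zero_left] at hdt
    have : (⟪h (e a) (e a), ξ⟫ * ⟪h (e c) (e d), ξ⟫ - ⟪h (e a) (e d), ξ⟫ * ⟪h (e c) (e a), ξ⟫) *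
        ⟪h (e f) (e f), ξ⟫ = 0 := by linarith
    rcases mul_eq_zero.mp this with h0 | h0
    · rw [hs (e c) (e a)] at h0; linarith
    · exact absurd h0 hff
  -- For ξ orthogonal to T no bordering entry is available. The previous identity holds for ξ + tT
  -- with t ≠ 0, and its constant coefficient in t is the claim.
  have hminor0 : ∀ ξ ∈ N, ⟪T, ξ⟫ = 0 → ∀ a c, blk c = blk a →
      ⟪h (e a) (e a), ξ⟫ * ⟪h (e c) (e c), ξ⟫ = ⟪h (e a) (e c), ξ⟫ ^ 2 := by
    intro ξ hξN hξ a c hc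
    have := constant_coeff_eq_zero_of_quadratic
      (a := ⟪h (e a) (e a), T⟫ * ⟪h (e c) (e c), T⟫ - ⟪h (e a) (e c), T⟫ ^ 2)
      (b := ⟪h (e a) (e a), ξ⟫ * ⟪h (e c) (e c), T⟫ + ⟪h (e a) (e a), T⟫ * ⟪h (e c) (e c), ξ⟫
        - 2 * ⟪h (e a) (e c), ξ⟫ * ⟪h (e a) (e c), T⟫)
      (c := ⟪h (e a) (e a), ξ⟫ * ⟪h (e c) (e c), ξ⟫ - ⟪h (e a) (e c), ξ⟫ ^ 2) ?_
    · linarith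
    · intro t ht
      have := hminor (ξ + t • T) (N.add_mem hξN (N.smul_mem t hTN))
        (by rw [inner_add_right, inner_smul_right, hξ, zero_add]; exact mul_ne_zero ht hTT) a c c hc hc
      simp only [inner_add_right, inner_smul_right] at this
      linear_combination this
  have hperp : ∀ ξ ∈ N, ⟪T, ξ⟫ = 0 → ∀ i j, ⟪h (e i) (e j), ξ⟫ = 0 := by
    intro ξ hξN hξ i j
    by_cases hij : blk i = blk j
    -- Summing the vanishing minors over a whole block gives ∑ ⟪h_ac, ξ⟫² = (∑ ⟪h_aa, ξ⟫)² = ⟪T, ξ⟫²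
    -- = 0; so h has no component orthogonal to T.
    · have h1 : ∑ a with blk a = blk i, ∑ c with blk c = blk i, ⟪h (e a) (e c), ξ⟫ ^ 2 = 0 := by
        have : ∑ a with blk a = blk i, ∑ c with blk c = blk i, ⟪h (e a) (e c), ξ⟫ ^ 2 =
            ∑ a with blk a = blk i, ∑ c with blk c = blk i,
              ⟪h (e a) (e a), ξ⟫ * ⟪h (e c) (e c), ξ⟫ := by
          refine Finset.sum_congr rfl fun a ha => Finset.sum_congr rfl fun c hc => ?_
          simp only [Finset.mem_filter, Finset.mem_univ, true_and] at ha hc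
          exact (hminor0 ξ hξN hξ a c (by rw [ha, hc])).symm
        rw [this, ← Finset.sum_mul_sum, ← sum_inner, htr, hξ, zero_mul]
      rw [Finset.sum_eq_zero_iff_of_nonneg fun a _ => Finset.sum_nonneg fun c _ => sq_nonneg _] at h1
      have h2 := h1 i (by simp)
      rw [Finset.sum_eq_zero_iff_of_nonneg fun c _ => sq_nonneg _] at h2
      simpa using h2 j (by simp [hij])
    · rw [hcross i j hij, inner_zero_left]
  set β : I → I → ℝ := fun i j => ⟪h (e i) (e j), T⟫ / ⟪T, T⟫ with hβ
  have hβh : ∀ i j, h (e i) (e j) = β i j • T := by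
    intro i j
    have hmem : h (e i) (e j) - β i j • T ∈ N := N.sub_mem (hN _ _) (N.smul_mem _ hTN)
    have horth : ⟪T, h (e i) (e j) - β i j • T⟫ = 0 := by
      rw [inner_sub_right, inner_smul_right, hβ, div_mul_cancel₀ _ hTT, real_inner_comm, sub_self]
    have h1 := hperp _ hmem horth i j
    have h2 : ⟪h (e i) (e j) - β i j • T, h (e i) (e j) - β i j • T⟫ = 0 := by
      rw [inner_sub_left, h1, inner_smul_left, horth]; simp
    exact sub_eq_zero.mp (inner_self_eq_zero.mp h2)
  have hβm : ∀ a c d, blk c = blk a → blk d = blk a → β a a * β c d = β a c * β a d := by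
    intro a c d hc hd
    have := hminor T hTN hTT a c d hc hd
    simp only [hβ]
    field_simp
    exact this
  have hβtr : ∀ b, ∑ i with blk i = b, β i i = 1 := by
    intro b
    simp only [hβ]
    rw [← Finset.sum_div, ← sum_inner, htr, div_self hTT]
  have hpos : ∀ b, ∃ a, blk a = b ∧ 0 < β a a := by
    intro b
    by_contra! hcon
    have := hβtr b
    have h2 : ∑ i with blk i = b, β i i ≤ 0 :=
      Finset.sum_nonpos fun i hi => hcon i (by simpa using hi)
    linarith
  -- In each block pick a positive pivot. Vanishing of the minors makes the form the square of the
  -- pivot row divided by the root of the pivot, which defines `c`.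
  choose p hpb hpp using hpos
  set c : I → ℝ := fun i => β (p (blk i)) i / √(β (p (blk i)) (p (blk i))) with hc
  have hcc : ∀ i j, blk i = blk j → β i j = c i * c j := by
    intro i j hij
    have h0 := hpp (blk i)
    have h1 := hβm (p (blk i)) i j (hpb _).symm (by rw [hpb, hij])
    simp only [hc, ← hij]
    rw [div_mul_div_comm, Real.mul_self_sqrt h0.le, ← h1, mul_div_cancel_left₀ _ h0.ne']
  set U : B → V := fun b => ∑ i with blk i = b, c i • e i with hU
  have hUe : ∀ b i, ⟪U b, e i⟫ = if blk i = b then c i else 0 := by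
    intro b i
    simp only [hU, sum_inner, inner_smul_left, orthonormal_iff_ite.mp e.orthonormal]
    simp [Finset.mem_filter]
  have hUU : ∀ b b', ⟪U b, U b'⟫ = if b = b' then 1 else 0 := by
    intro b b'
    have hU' : U b' = ∑ i with blk i = b', c i • e i := rfl
    rw [hU']
    simp only [inner_sum, inner_smul_right, hUe]
    by_cases hb : b = b'
    · subst hb
      rw [if_pos rfl, ← hβtr b]
      refine Finset.sum_congr rfl fun i hi => ?_
      simp only [Finset.mem_filter, Finset.mem_univ, true_and] at hi
      rw [if_pos hi, hcc i i rfl]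
    · rw [if_neg hb]
      refine Finset.sum_eq_zero fun i hi => ?_
      simp only [Finset.mem_filter, Finset.mem_univ, true_and] at hi
      rw [if_neg (by rw [hi]; exact Ne.symm hb), mul_zero]
  have hUn : ∀ b, ‖U b‖ = 1 := fun b => by
    have := hUU b b
    rw [real_inner_self_eq_norm_sq, if_pos rfl] at this
    exact (pow_eq_one_iff_of_nonneg (norm_nonneg _) two_ne_zero).mp this
  obtain ⟨b₁, b₂, hb, huniv'⟩ := Finset.card_eq_two.mp (Finset.card_univ.trans hcard)
  have huniv : ∀ b, b = b₁ ∨ b = b₂ := fun b => by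
    have := Finset.mem_univ b
    rw [huniv'] at this
    simpa using this
  refine ⟨U b₁, U b₂, hUn _, hUn _, by rw [hUU, if_neg hb], ?_⟩
  have hmain : ∀ i j, h (e i) (e j) =
      (⟪U b₁, e i⟫ * ⟪U b₁, e j⟫ + ⟪U b₂, e i⟫ * ⟪U b₂, e j⟫) • T := by
    intro i j
    simp only [hUe]
    by_cases hij : blk i = blk j
    · rw [hβh, hcc i j hij, ← hij]
      rcases huniv (blk i) with h1 | h1
      · simp [h1, hb]
      · simp [h1, hb.symm]
    · rw [hcross i j hij]
      rcases huniv (blk i) with h1 | h1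
      · have h2 : blk j ≠ b₁ := fun h2 => hij (h1.trans h2.symm)
        simp [h1, h2, hb]
      · have h2 : blk j ≠ b₂ := fun h2 => hij (h1.trans h2.symm)
        simp [h1, h2, hb.symm]
  let q : V →ₗ[ℝ] V →ₗ[ℝ] F := LinearMap.mk₂ ℝ
    (fun v w => (⟪U b₁, v⟫ * ⟪U b₁, w⟫ + ⟪U b₂, v⟫ * ⟪U b₂, w⟫) • T)
    (by intros; rw [← add_smul]; congr 1; simp only [inner_add_right]; ring)
    (by intros; rw [smul_smul]; congr 1; simp only [inner_smul_right]; ring)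
    (by intros; rw [← add_smul]; congr 1; simp only [inner_add_right]; ring)
    (by intros; rw [smul_smul]; congr 1; simp only [inner_smul_right]; ring)
  have hq : h = q := LinearMap.ext_basis e.toBasis e.toBasis fun i j => by
    simpa [q] using hmain i j
  intro v w
  rw [hq]
  rfl

end TypeNumber

/-! ### Derivatives of projection-valued maps. -/

section Calculus

variable {V F W : Type*} [NormedAddCommGroup V] [NormedSpace ℝ V]
  [NormedAddCommGroup F] [InnerProductSpace ℝ F] [NormedAddCommGroup W] [NormedSpace ℝ W]

theorem two_le_infty : (2 : WithTop ℕ∞) ≤ ∞ := by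
  exact WithTop.coe_le_coe.2 (le_top : (2 : ℕ∞) ≤ ⊤)

theorem fderiv_fderiv_apply_comm {G : V → W} {x : V} (hG : ContDiffAt ℝ ∞ G x) (u v : V) :
    fderiv ℝ (fun y => fderiv ℝ G y v) x u = fderiv ℝ (fun y => fderiv ℝ G y u) x v := by
  have h1 : DifferentiableAt ℝ (fderiv ℝ G) x :=
    (hG.fderiv_right (m := ∞) (by simp)).differentiableAt (by simp)
  rw [fderiv_clm_apply h1 (by simp), fderiv_clm_apply h1 (by simp)]
  simpa using (hG.isSymmSndFDerivAt (by simpa using two_le_infty)) u v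

/-- A symmetric operator that is off-diagonal for a symmetric `p` and vanishes on the range of `p`
is zero. -/
theorem offDiagonal_eq_zero {S p : F →L[ℝ] F} (hS : ∀ v w, ⟪S v, w⟫ = ⟪v, S w⟫)
    (hp : ∀ v w, ⟪p v, w⟫ = ⟪v, p w⟫) (hSp : ∀ w, S w = p (S w) + S (p w))
    (h0 : ∀ w, S (p w) = 0) : S = 0 := by
  ext w
  refine ext_inner_right ℝ fun y => ?_
  rw [hSp w, h0, add_zero, hp, hS, h0]
  simp

/-- The symmetric product of two vectors, as an operator. -/
def symOp (a b : F) : F →L[ℝ] F := (innerSL ℝ a).smulRight b + (innerSL ℝ b).smulRight a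

theorem symOp_apply (a b w : F) : symOp a b w = ⟪a, w⟫ • b + ⟪b, w⟫ • a := by
  simp [symOp]

theorem symOp_symm (a b v w : F) : ⟪symOp a b v, w⟫ = ⟪v, symOp a b w⟫ := by
  simp only [symOp_apply, inner_add_left, inner_add_right, inner_smul_left, inner_smul_right]
  simp only [conj_trivial, real_inner_comm v]
  ring

section ProjectionField

variable {p : V → F →L[ℝ] F} {Ω : Set V} {x : V}

theorem fderiv_symm_of_symm (hΩ : IsOpen Ω) (hx : x ∈ Ω) (hd : DifferentiableAt ℝ p x)
    (hs : ∀ y ∈ Ω, ∀ v w, ⟪p y v, w⟫ = ⟪v, p y w⟫) (u : V) (v w : F) :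
    ⟪fderiv ℝ p x u v, w⟫ = ⟪v, fderiv ℝ p x u w⟫ := by
  have hev : (fun y => ⟪p y v, w⟫) =ᶠ[𝓝 x] fun y => ⟪v, p y w⟫ :=
    eventually_of_mem (hΩ.mem_nhds hx) fun y hy => hs y hy v w
  have h1 := congrArg (fun T : V →L[ℝ] ℝ => T u) hev.fderiv_eq
  rw [fderiv_inner_apply ℝ (by fun_prop) (by fun_prop),
    fderiv_inner_apply ℝ (by fun_prop) (by fun_prop), fderiv_clm_apply hd (by fun_prop),
    fderiv_clm_apply hd (by fun_prop)] at h1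
  simpa using h1

/-- The product rule for an identity p g = k. It evaluates the derivative of a projection on a
vector field whose image under the projection is known. -/
theorem fderiv_clm_apply_of_eqOn {g k : V → F} (hΩ : IsOpen Ω) (hx : x ∈ Ω)
    (hd : DifferentiableAt ℝ p x) (hg : DifferentiableAt ℝ g x)
    (h : ∀ y ∈ Ω, p y (g y) = k y) (u : V) :
    fderiv ℝ p x u (g x) + p x (fderiv ℝ g x u) = fderiv ℝ k x u := by
  have hev : (fun y => p y (g y)) =ᶠ[𝓝 x] k :=
    eventually_of_mem (hΩ.mem_nhds hx) h
  rw [← hev.fderiv_eq, fderiv_clm_apply hd hg]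
  simp [add_comm]

/-- Differentiating p² = p. The derivative exchanges the range and the kernel of p, so together with
symmetry it is determined by its values on either one. -/
theorem fderiv_offDiagonal_of_idem (hΩ : IsOpen Ω) (hx : x ∈ Ω) (hd : DifferentiableAt ℝ p x)
    (hi : ∀ y ∈ Ω, ∀ v, p y (p y v) = p y v) (u : V) (w : F) :
    fderiv ℝ p x u w = p x (fderiv ℝ p x u w) + fderiv ℝ p x u (p x w) := by
  have h1 := fderiv_clm_apply_of_eqOn (g := fun y => p y w) (k := fun y => p y w) hΩ hx hd
    (by fun_prop) (fun y hy => hi y hy w) u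
  rw [fderiv_clm_apply hd (by fun_prop)] at h1
  simp at h1
  rw [add_comm]; exact h1.symm

end ProjectionField

/-- Symmetry of second derivatives for a map whose derivative is a symmetric product. -/
theorem symOp_clairaut {Ω : Set V} {x : V} (hΩ : IsOpen Ω) (hx : x ∈ Ω) {p : V → F →L[ℝ] F}
    (hp : ContDiffAt ℝ ∞ p x) (A : V → V → F) (B : V → F)
    (hA : ∀ v, DifferentiableAt ℝ (A v) x) (hB : DifferentiableAt ℝ B x)
    (hpd : ∀ y ∈ Ω, DifferentiableAt ℝ p y)
    (h : ∀ y ∈ Ω, ∀ v, fderiv ℝ p y v = symOp (A v y) (B y)) (u v : V) (w : F) :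
    ⟪fderiv ℝ (A v) x u - fderiv ℝ (A u) x v, w⟫ • B x + ⟪A v x, w⟫ • fderiv ℝ B x u
      - ⟪A u x, w⟫ • fderiv ℝ B x v + ⟪fderiv ℝ B x u, w⟫ • A v x
      - ⟪fderiv ℝ B x v, w⟫ • A u x
      + ⟪B x, w⟫ • (fderiv ℝ (A v) x u - fderiv ℝ (A u) x v) = 0 := by
  have key : ∀ u v, fderiv ℝ (fun y => fderiv ℝ (fun z => p z w) y v) x u =
      ⟪fderiv ℝ (A v) x u, w⟫ • B x + ⟪A v x, w⟫ • fderiv ℝ B x u +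
      ⟪fderiv ℝ B x u, w⟫ • A v x + ⟪B x, w⟫ • fderiv ℝ (A v) x u := by
    intro u v
    have hev : (fun y => fderiv ℝ (fun z => p z w) y v) =ᶠ[𝓝 x]
        fun y => ⟪A v y, w⟫ • B y + ⟪B y, w⟫ • A v y := by
      filter_upwards [hΩ.mem_nhds hx] with y hy
      rw [fderiv_clm_apply (hpd y hy) (by fun_prop)]
      simp [h y hy v, symOp_apply]
    have hA' := hA v
    have h1 : DifferentiableAt ℝ (fun y => ⟪A v y, w⟫) x := hA'.inner ℝ (by fun_prop)
    have h2 : DifferentiableAt ℝ (fun y => ⟪B y, w⟫) x := hB.inner ℝ (by fun_prop)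
    rw [hev.fderiv_eq, fderiv_fun_add (h1.fun_smul hB) (h2.fun_smul hA'), fderiv_fun_smul h1 hB,
      fderiv_fun_smul h2 hA']
    simp only [add_apply, smul_apply, ContinuousLinearMap.smulRight_apply]
    rw [fderiv_inner_apply ℝ hA' (by fun_prop), fderiv_inner_apply ℝ hB (by fun_prop)]
    simp
    abel
  have hs := fderiv_fderiv_apply_comm (G := fun z => p z w) (x := x)
    (hp.clm_apply contDiffAt_const) u v
  rw [key, key] at hs
  rw [← sub_eq_zero] at hs
  rw [← hs, inner_sub_left]
  module

end Calculus

/-! ### Local theory of immersions with an umbilical rank-two second fundamental form. -/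

section RankTwo

variable {V F : Type*} [NormedAddCommGroup V] [NormedSpace ℝ V]
  [NormedAddCommGroup F] [InnerProductSpace ℝ F]

/-- An immersion `f` of `Ω` into the unit sphere with `h(u, v) = λ ⟨Pu, v⟩ ξ`, where `P` is the
orthogonal projection onto a field of tangent planes, `ξ` is a unit normal field and `λ > 0`.
The projection onto the span of the tangent space and the position vector is `τ`. -/
structure IsRankTwoImmersion (Ω : Set V) (f ξ : V → F) (lam : V → ℝ) (P τ : V → F →L[ℝ] F) :
    Prop where
  isOpen : IsOpen Ω
  smooth_f : ∀ x ∈ Ω, ContDiffAt ℝ ∞ f x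
  smooth_ξ : ∀ x ∈ Ω, ContDiffAt ℝ ∞ ξ x
  smooth_lam : ∀ x ∈ Ω, ContDiffAt ℝ ∞ lam x
  smooth_P : ∀ x ∈ Ω, ContDiffAt ℝ ∞ P x
  smooth_τ : ∀ x ∈ Ω, ContDiffAt ℝ ∞ τ x
  f_f : ∀ x ∈ Ω, ⟪f x, f x⟫ = 1
  ξ_ξ : ∀ x ∈ Ω, ⟪ξ x, ξ x⟫ = 1
  ξ_f : ∀ x ∈ Ω, ⟪ξ x, f x⟫ = 0
  ξ_df : ∀ x ∈ Ω, ∀ v, ⟪ξ x, fderiv ℝ f x v⟫ = 0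
  lam_pos : ∀ x ∈ Ω, 0 < lam x
  τ_symm : ∀ x ∈ Ω, ∀ v w, ⟪τ x v, w⟫ = ⟪v, τ x w⟫
  τ_df : ∀ x ∈ Ω, ∀ v, τ x (fderiv ℝ f x v) = fderiv ℝ f x v
  τ_f : ∀ x ∈ Ω, τ x (f x) = f x
  τ_range : ∀ x ∈ Ω, ∀ w, ∃ v, ∃ c : ℝ, τ x w = fderiv ℝ f x v + c • f x
  P_symm : ∀ x ∈ Ω, ∀ v w, ⟪P x v, w⟫ = ⟪v, P x w⟫
  P_idem : ∀ x ∈ Ω, ∀ v, P x (P x v) = P x v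
  P_range : ∀ x ∈ Ω, ∀ w, ∃ v, P x w = fderiv ℝ f x v
  P_two : ∀ x ∈ Ω, ∀ w, ∃ v, P x v = v ∧ ⟪v, v⟫ = 1 ∧ ⟪v, w⟫ = 0
  second : ∀ x ∈ Ω, ∀ u v, τ x (fderiv ℝ (fderiv ℝ f) x u v) =
    fderiv ℝ (fderiv ℝ f) x u v -
      (lam x * ⟪P x (fderiv ℝ f x u), fderiv ℝ f x v⟫) • ξ x

namespace IsRankTwoImmersion

variable {Ω : Set V} {f ξ : V → F} {lam : V → ℝ} {P τ : V → F →L[ℝ] F} {x : V}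

section
variable (H : IsRankTwoImmersion Ω f ξ lam P τ)
include H

theorem diff_f (hx : x ∈ Ω) : DifferentiableAt ℝ f x := (H.smooth_f x hx).differentiableAt (by simp)
theorem diff_ξ (hx : x ∈ Ω) : DifferentiableAt ℝ ξ x := (H.smooth_ξ x hx).differentiableAt (by simp)
theorem diff_lam (hx : x ∈ Ω) : DifferentiableAt ℝ lam x :=
  (H.smooth_lam x hx).differentiableAt (by simp)
theorem diff_P (hx : x ∈ Ω) : DifferentiableAt ℝ P x := (H.smooth_P x hx).differentiableAt (by simp)
theorem diff_τ (hx : x ∈ Ω) : DifferentiableAt ℝ τ x := (H.smooth_τ x hx).differentiableAt (by simp)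
theorem diff_df (hx : x ∈ Ω) : DifferentiableAt ℝ (fderiv ℝ f) x :=
  ((H.smooth_f x hx).fderiv_right (m := ∞) (by simp)).differentiableAt (by simp)

theorem diff_df_apply (hx : x ∈ Ω) (v : V) : DifferentiableAt ℝ (fun y => fderiv ℝ f y v) x :=
  (H.diff_df hx).clm_apply (by fun_prop)

theorem f_df (hx : x ∈ Ω) (v : V) : ⟪f x, fderiv ℝ f x v⟫ = 0 := by
  have hev : (fun y => ⟪f y, f y⟫) =ᶠ[𝓝 x] fun _ => (1 : ℝ) :=
    eventually_of_mem (H.isOpen.mem_nhds hx) H.f_f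
  have h1 := congrArg (fun T : V →L[ℝ] ℝ => T v) hev.fderiv_eq
  rw [fderiv_inner_apply ℝ (H.diff_f hx) (H.diff_f hx)] at h1
  simp only [fderiv_fun_const, Pi.zero_apply, zero_apply] at h1
  rw [real_inner_comm (f x)] at h1
  linarith

theorem ξ_dξ (hx : x ∈ Ω) (v : V) : ⟪fderiv ℝ ξ x v, ξ x⟫ = 0 := by
  have hev : (fun y => ⟪ξ y, ξ y⟫) =ᶠ[𝓝 x] fun _ => (1 : ℝ) :=
    eventually_of_mem (H.isOpen.mem_nhds hx) H.ξ_ξ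
  have h1 := congrArg (fun T : V →L[ℝ] ℝ => T v) hev.fderiv_eq
  rw [fderiv_inner_apply ℝ (H.diff_ξ hx) (H.diff_ξ hx)] at h1
  simp only [fderiv_fun_const, Pi.zero_apply, zero_apply] at h1
  rw [real_inner_comm] at h1
  linarith

theorem P_f (hx : x ∈ Ω) : P x (f x) = 0 := by
  refine ext_inner_right ℝ fun w => ?_
  obtain ⟨v, hv⟩ := H.P_range x hx w
  rw [H.P_symm x hx, hv, H.f_df hx, inner_zero_left]

theorem P_ξ (hx : x ∈ Ω) : P x (ξ x) = 0 := by
  refine ext_inner_right ℝ fun w => ?_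
  obtain ⟨v, hv⟩ := H.P_range x hx w
  rw [H.P_symm x hx, hv, H.ξ_df x hx, inner_zero_left]

theorem τ_ξ (hx : x ∈ Ω) : τ x (ξ x) = 0 := by
  refine ext_inner_right ℝ fun w => ?_
  obtain ⟨v, c, hv⟩ := H.τ_range x hx w
  rw [H.τ_symm x hx, hv, inner_add_right, inner_smul_right, H.ξ_df x hx, H.ξ_f x hx,
    inner_zero_left]
  simp

theorem τ_idem (hx : x ∈ Ω) (w : F) : τ x (τ x w) = τ x w := by
  obtain ⟨v, c, hv⟩ := H.τ_range x hx w
  rw [hv, map_add, map_smul, H.τ_df x hx, H.τ_f x hx]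

theorem τ_P (hx : x ∈ Ω) (w : F) : τ x (P x w) = P x w := by
  obtain ⟨v, hv⟩ := H.P_range x hx w
  rw [hv, H.τ_df x hx]

/-- A linear form `g` with `g(v) Pu = g(u) Pv` vanishes, since `P` has rank at least two. -/
theorem form_eq_zero (hx : x ∈ Ω) (g : V → ℝ)
    (h : ∀ u v, g u • P x (fderiv ℝ f x v) = g v • P x (fderiv ℝ f x u)) (u : V) : g u = 0 := by
  -- Pairing with a unit vector of the plane orthogonal to P df(u) isolates the coefficient `g u`.
  obtain ⟨w, hw, hw1, hw0⟩ := H.P_two x hx (P x (fderiv ℝ f x u))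
  obtain ⟨v, hv⟩ := H.P_range x hx w
  have h1 := congrArg (fun z => ⟪w, z⟫) (h u v)
  simp only [inner_smul_right, hw0, mul_zero] at h1
  rw [← hv, hw, hw, hw1, mul_one] at h1
  exact h1

/-- Both sides are symmetric and off-diagonal for τ, so they need only agree on its range: on f the
derivative vanishes, and on df(v) it is the normal part of the second derivative. -/
theorem dτ_eq (hx : x ∈ Ω) (u : V) :
    fderiv ℝ τ x u = symOp (lam x • P x (fderiv ℝ f x u)) (ξ x) := by
  have hP : ∀ w, ⟪ξ x, P x w⟫ = 0 := fun w => by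
    rw [← H.P_symm x hx, H.P_ξ hx, inner_zero_left]
  have hξτ : ∀ w, ⟪ξ x, τ x w⟫ = 0 := fun w => by
    rw [← H.τ_symm x hx, H.τ_ξ hx, inner_zero_left]
  have hdf : fderiv ℝ τ x u (f x) = 0 := by
    have := fderiv_clm_apply_of_eqOn H.isOpen hx (H.diff_τ hx) (H.diff_f hx) H.τ_f u
    rwa [H.τ_df x hx, add_eq_right] at this
  have hdX : ∀ v, fderiv ℝ τ x u (fderiv ℝ f x v) =
      (lam x * ⟪P x (fderiv ℝ f x u), fderiv ℝ f x v⟫) • ξ x := fun v => by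
    have := fderiv_clm_apply_of_eqOn H.isOpen hx (H.diff_τ hx) (H.diff_df_apply hx v)
      (fun y hy => H.τ_df y hy v) u
    rw [fderiv_clm_apply (H.diff_df hx) (by fun_prop)] at this
    simp only [fderiv_fun_const, Pi.zero_apply, ContinuousLinearMap.comp_zero, zero_add,
      ContinuousLinearMap.flip_apply] at this
    rw [H.second x hx] at this
    rw [← sub_eq_zero] at this ⊢
    rw [← this]; abel
  rw [← sub_eq_zero]
  refine offDiagonal_eq_zero (p := τ x) ?_ (H.τ_symm x hx) ?_ ?_
  · intro v w
    simp only [sub_apply, inner_sub_left, inner_sub_right, symOp_symm]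
    rw [fderiv_symm_of_symm H.isOpen hx (H.diff_τ hx) H.τ_symm]
  · intro w
    have h1 := fderiv_offDiagonal_of_idem H.isOpen hx (H.diff_τ hx) (fun y hy => H.τ_idem hy) u w
    simp only [sub_apply, symOp_apply, map_sub, map_add, map_smul, H.τ_P hx, H.τ_ξ hx, hξτ]
    conv_lhs => rw [h1]
    have h2 : ⟪lam x • P x (fderiv ℝ f x u), τ x w⟫ = ⟪lam x • P x (fderiv ℝ f x u), w⟫ := by
      rw [← H.τ_symm x hx, map_smul, H.τ_P hx]
    rw [h2]
    module
  · intro w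
    obtain ⟨v, c, hv⟩ := H.τ_range x hx w
    rw [sub_apply, hv, map_add, map_smul, hdf, hdX, ← hv, symOp_apply, hξτ, hv]
    rw [inner_add_right, inner_smul_right, inner_smul_left, inner_smul_left,
      real_inner_comm (f x), ← H.P_symm x hx, H.P_f hx]
    simp

theorem diff_shape (hx : x ∈ Ω) (v : V) :
    DifferentiableAt ℝ (fun y => lam y • P y (fderiv ℝ f y v)) x :=
  (H.diff_lam hx).smul ((H.diff_P hx).clm_apply (H.diff_df_apply hx v))

theorem diff_P_df (hx : x ∈ Ω) (v : V) :
    DifferentiableAt ℝ (fun y => P y (fderiv ℝ f y v)) x :=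
  (H.diff_P hx).clm_apply (H.diff_df_apply hx v)

/-- The terms containing the Hessian of f are symmetric in u and v and cancel. -/
theorem fderiv_P_df_sub (hx : x ∈ Ω) (u v : V) :
    fderiv ℝ (fun y => P y (fderiv ℝ f y v)) x u - fderiv ℝ (fun y => P y (fderiv ℝ f y u)) x v =
    fderiv ℝ P x u (fderiv ℝ f x v) - fderiv ℝ P x v (fderiv ℝ f x u) := by
  have h1 : ∀ v u, fderiv ℝ (fun y => P y (fderiv ℝ f y v)) x u =
      P x (fderiv ℝ (fun y => fderiv ℝ f y v) x u) + fderiv ℝ P x u (fderiv ℝ f x v) := fun v u => by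
    rw [fderiv_clm_apply (H.diff_P hx) (H.diff_df_apply hx v)]
    simp
  rw [h1, h1, fderiv_fderiv_apply_comm (H.smooth_f x hx) u v]
  abel

theorem fderiv_shape_sub (hx : x ∈ Ω) (u v : V) :
    fderiv ℝ (fun y => lam y • P y (fderiv ℝ f y v)) x u -
      fderiv ℝ (fun y => lam y • P y (fderiv ℝ f y u)) x v =
    fderiv ℝ lam x u • P x (fderiv ℝ f x v) - fderiv ℝ lam x v • P x (fderiv ℝ f x u) +
      lam x • (fderiv ℝ P x u (fderiv ℝ f x v) - fderiv ℝ P x v (fderiv ℝ f x u)) := by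
  rw [fderiv_fun_smul (H.diff_lam hx) (H.diff_P_df hx v),
    fderiv_fun_smul (H.diff_lam hx) (H.diff_P_df hx u), ← H.fderiv_P_df_sub hx]
  simp only [add_apply, smul_apply, ContinuousLinearMap.smulRight_apply]
  module

/-- Differentiating τP = P: a vector in the kernel of τ sees only the contribution of dτ. -/
theorem normal_dP (hx : x ∈ Ω) {η : F} (hη : τ x η = 0) (u : V) (z : F) :
    ⟪fderiv ℝ P x u (P x z), η⟫ = lam x * ⟪P x (fderiv ℝ f x u), z⟫ * ⟪ξ x, η⟫ := by
  have h1 := fderiv_clm_apply_of_eqOn (g := fun y => P y z) (k := fun y => P y z) H.isOpen hx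
    (H.diff_τ hx) ((H.diff_P hx).clm_apply (by fun_prop)) (fun y hy => H.τ_P hy z) u
  have h2 := fderiv_offDiagonal_of_idem H.isOpen hx (H.diff_P hx) H.P_idem u z
  rw [fderiv_clm_apply (H.diff_P hx) (by fun_prop)] at h1
  simp only [fderiv_fun_const, Pi.zero_apply, ContinuousLinearMap.comp_zero, zero_add,
      ContinuousLinearMap.flip_apply] at h1
  have h3 : ⟪fderiv ℝ P x u z, η⟫ = ⟪fderiv ℝ τ x u (P x z), η⟫ := by
    rw [← h1, inner_add_left, H.τ_symm x hx, hη, inner_zero_right, add_zero]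
  have h4 : ⟪P x (fderiv ℝ P x u z), η⟫ = 0 := by
    rw [← H.τ_P hx, H.τ_symm x hx, hη, inner_zero_right]
  have h5 : ⟪fderiv ℝ P x u z, η⟫ = ⟪fderiv ℝ P x u (P x z), η⟫ := by
    conv_lhs => rw [h2]
    rw [inner_add_left, h4, zero_add]
  rw [← h5, h3, H.dτ_eq hx, symOp_apply, inner_add_left, inner_smul_left, inner_smul_left,
    inner_smul_left, ← H.P_symm x hx (ξ x), H.P_ξ hx, H.P_symm x hx, H.P_idem x hx,
    ← H.P_symm x hx]
  simp

/-- The symmetry of second derivatives of τ, tested against ξ, leaves only this difference once its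
own ξ-component is known to vanish. That component vanishes because the normal part of dP on the
plane is symmetric in u and v. -/
theorem codazzi (hx : x ∈ Ω) (u v : V) :
    fderiv ℝ (fun y => lam y • P y (fderiv ℝ f y v)) x u -
      fderiv ℝ (fun y => lam y • P y (fderiv ℝ f y u)) x v = 0 := by
  have h1 := symOp_clairaut H.isOpen hx (H.smooth_τ x hx) (fun v y => lam y • P y (fderiv ℝ f y v)) ξ
    (H.diff_shape hx) (H.diff_ξ hx) (fun y hy => H.diff_τ hy) (fun y hy v => H.dτ_eq hy v) u v (ξ x)
  have hP : ∀ w, ⟪P x w, ξ x⟫ = 0 := fun w => by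
    rw [H.P_symm x hx, H.P_ξ hx, inner_zero_right]
  have hZ : ⟪fderiv ℝ (fun y => lam y • P y (fderiv ℝ f y v)) x u -
      fderiv ℝ (fun y => lam y • P y (fderiv ℝ f y u)) x v, ξ x⟫ = 0 := by
    have h2 : ∀ u v, ⟪fderiv ℝ P x u (fderiv ℝ f x v), ξ x⟫ =
        lam x * ⟪P x (fderiv ℝ f x u), fderiv ℝ f x v⟫ := fun u v => by
      have := H.normal_dP hx (H.τ_ξ hx) u (fderiv ℝ f x v)
      rw [H.ξ_ξ x hx, mul_one] at this
      rw [fderiv_offDiagonal_of_idem H.isOpen hx (H.diff_P hx) H.P_idem, inner_add_left, hP, this,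
        zero_add]
    rw [H.fderiv_shape_sub hx, inner_add_left, inner_sub_left, inner_smul_left, inner_smul_left,
      inner_smul_left, inner_sub_left, hP, hP, h2, h2, H.P_symm x hx,
      real_inner_comm (P x (fderiv ℝ f x v))]
    simp
  simp only [hZ, H.ξ_dξ hx, inner_smul_left, hP, H.ξ_ξ x hx] at h1
  simpa using h1

/-- The τ-part comes from differentiating τξ = 0. For η in the kernel of τ, the symmetry of second
derivatives tested against η gives ⟪dξ(u), η⟫ P df(v) = ⟪dξ(v), η⟫ P df(u), and `form_eq_zero` makes
ξ parallel: this is where the plane having dimension at least two matters. -/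
theorem dξ_eq (hx : x ∈ Ω) (u : V) : fderiv ℝ ξ x u = -(lam x • P x (fderiv ℝ f x u)) := by
  have hτd : τ x (fderiv ℝ ξ x u) = -(lam x • P x (fderiv ℝ f x u)) := by
    have := fderiv_clm_apply_of_eqOn (k := fun _ => 0) H.isOpen hx (H.diff_τ hx) (H.diff_ξ hx)
      (fun y hy => H.τ_ξ hy) u
    rw [H.dτ_eq hx, symOp_apply, inner_smul_left, H.P_symm x hx, H.P_ξ hx, H.ξ_ξ x hx] at this
    simp at this
    rw [eq_neg_iff_add_eq_zero, add_comm]; exact this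
  have horth : ∀ η, τ x η = 0 → ⟪fderiv ℝ ξ x u, η⟫ = 0 := by
    intro η hη
    refine H.form_eq_zero hx (fun u => ⟪fderiv ℝ ξ x u, η⟫) (fun u v => ?_) u
    have h1 := symOp_clairaut H.isOpen hx (H.smooth_τ x hx)
      (fun v y => lam y • P y (fderiv ℝ f y v)) ξ
      (H.diff_shape hx) (H.diff_ξ hx) (fun y hy => H.diff_τ hy) (fun y hy v => H.dτ_eq hy v) u v η
    have hP : ∀ w, ⟪P x w, η⟫ = 0 := fun w => by
      rw [← H.τ_P hx, H.τ_symm x hx, hη, inner_zero_right]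
    simp only [H.codazzi hx u v, inner_smul_left, hP] at h1
    simp only [inner_zero_left, zero_smul, mul_zero, smul_zero, zero_add, add_zero, sub_zero] at h1
    rw [smul_comm, smul_comm _ (lam x), ← smul_sub, smul_eq_zero] at h1
    exact sub_eq_zero.mp (h1.resolve_left (H.lam_pos x hx).ne')
  have hr : τ x (fderiv ℝ ξ x u - τ x (fderiv ℝ ξ x u)) = 0 := by
    rw [map_sub, H.τ_idem hx, sub_self]
  have h0 : ⟪fderiv ℝ ξ x u - τ x (fderiv ℝ ξ x u), fderiv ℝ ξ x u - τ x (fderiv ℝ ξ x u)⟫ = 0 := by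
    conv_lhs => rw [inner_sub_left, horth _ hr, H.τ_symm x hx, hr]
    simp
  rw [← hτd]
  exact sub_eq_zero.mp (inner_self_eq_zero.mp h0)

/-- The Codazzi equation, in terms of the derivative of `P`. -/
theorem dP_sub (hx : x ∈ Ω) (u v : V) :
    fderiv ℝ P x u (fderiv ℝ f x v) - fderiv ℝ P x v (fderiv ℝ f x u) =
      (fderiv ℝ lam x v / lam x) • P x (fderiv ℝ f x u) -
      (fderiv ℝ lam x u / lam x) • P x (fderiv ℝ f x v) := by
  have h := H.codazzi hx u v
  rw [H.fderiv_shape_sub hx] at h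
  have hl := (H.lam_pos x hx).ne'
  have h2 := congrArg (fun z => (lam x)⁻¹ • z) h
  simp only [smul_add, smul_sub, smul_smul, inv_mul_cancel₀ hl, one_smul, smul_zero] at h2
  rw [← sub_eq_zero, ← h2, div_eq_inv_mul, div_eq_inv_mul]
  abel

theorem dP_offDiag (hx : x ∈ Ω) (u : V) (w : F) :
    fderiv ℝ P x u w = P x (fderiv ℝ P x u w) + fderiv ℝ P x u (P x w) :=
  fderiv_offDiagonal_of_idem H.isOpen hx (H.diff_P hx) H.P_idem u w

theorem dP_symm (hx : x ∈ Ω) (u : V) (v w : F) :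
    ⟪fderiv ℝ P x u v, w⟫ = ⟪v, fderiv ℝ P x u w⟫ :=
  fderiv_symm_of_symm H.isOpen hx (H.diff_P hx) H.P_symm u v w

/-- The right side of `dP_sub` lies in the range of P, so the part of the left side outside that
range vanishes; that part is dP applied to the plane. -/
theorem dP_P_comm (hx : x ∈ Ω) (u v : V) :
    fderiv ℝ P x u (P x (fderiv ℝ f x v)) = fderiv ℝ P x v (P x (fderiv ℝ f x u)) := by
  have h1 := H.dP_sub hx u v
  have h2 := congrArg (P x) h1
  simp only [map_sub, map_smul, H.P_idem x hx] at h2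
  rw [← h1] at h2
  have h3 := H.dP_offDiag hx u (fderiv ℝ f x v)
  have h4 := H.dP_offDiag hx v (fderiv ℝ f x u)
  rw [← sub_eq_zero]
  calc _ = (fderiv ℝ P x u (fderiv ℝ f x v) - fderiv ℝ P x v (fderiv ℝ f x u)) -
        (P x (fderiv ℝ P x u (fderiv ℝ f x v)) - P x (fderiv ℝ P x v (fderiv ℝ f x u))) := by
        nth_rw 1 [h3, h4]; abel
    _ = 0 := by rw [h2, sub_self]

theorem dP_compl_sub (hx : x ∈ Ω) (u v : V) :
    fderiv ℝ P x u (fderiv ℝ f x v - P x (fderiv ℝ f x v)) -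
      fderiv ℝ P x v (fderiv ℝ f x u - P x (fderiv ℝ f x u)) =
      (fderiv ℝ lam x v / lam x) • P x (fderiv ℝ f x u) -
      (fderiv ℝ lam x u / lam x) • P x (fderiv ℝ f x v) := by
  rw [map_sub, map_sub, H.dP_P_comm hx u v, ← H.dP_sub hx u v]
  abel

/-- By `dP_P_comm`, the restriction of dP(u) to the plane depends on u only through P df(u), and an
off-diagonal symmetric operator is determined by that restriction. In particular the planes are
constant along the directions P annihilates. -/
theorem dP_eq_of_P_df_eq (hx : x ∈ Ω) {u u' : V}
    (h : P x (fderiv ℝ f x u) = P x (fderiv ℝ f x u')) : fderiv ℝ P x u = fderiv ℝ P x u' := by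
  rw [← sub_eq_zero, ← map_sub]
  refine offDiagonal_eq_zero (H.dP_symm hx _) (H.P_symm x hx) (H.dP_offDiag hx _) fun w => ?_
  obtain ⟨v, hv⟩ := H.P_range x hx w
  rw [← H.P_idem x hx w, hv, H.dP_P_comm hx, map_sub, map_sub, h, sub_self, map_zero]

/-- Take v in the plane with df(v) a unit vector orthogonal to df(u). The complementary parts of
both vanish, and the df(v)-component of Codazzi is the derivative of log λ along u. -/
theorem dlam_eq_zero (hx : x ∈ Ω) {u : V} (hu : P x (fderiv ℝ f x u) = fderiv ℝ f x u) :
    fderiv ℝ lam x u / lam x = 0 := by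
  obtain ⟨w, hw, hw1, hw0⟩ := H.P_two x hx (fderiv ℝ f x u)
  obtain ⟨v, hv⟩ := H.P_range x hx w
  rw [hw] at hv
  have h1 := H.dP_compl_sub hx u v
  rw [← hv, hw, hu] at h1
  simp only [sub_self, map_zero] at h1
  have h2 := congrArg (fun z => ⟪w, z⟫) h1
  simp only [inner_zero_right, inner_sub_right, inner_smul_right, hw1, hw0] at h2
  linarith

end

/-! ### The vector L and the three constants of the motion. -/

section
variable {R : V → F} (H : IsRankTwoImmersion Ω f ξ lam P τ)
  (hR : ∀ x ∈ Ω, ∃ v, R x = fderiv ℝ f x v)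
  (hRX : ∀ x ∈ Ω, ∀ v, ⟪R x, fderiv ℝ f x v⟫ = fderiv ℝ lam x v / lam x)
include H hR hRX

/-- The vector field `L = λ ξ - f + ∇ log λ` is orthogonal to the planes `P`. -/
theorem P_L (hx : x ∈ Ω) : P x (lam x • ξ x - f x + R x) = 0 := by
  rw [map_add, map_sub, map_smul, H.P_ξ hx, H.P_f hx]
  simp only [smul_zero, sub_self, zero_add]
  refine ext_inner_right ℝ fun w => ?_
  obtain ⟨v, hv⟩ := H.P_range x hx w
  rw [H.P_symm x hx, hv, hRX x hx, inner_zero_left]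
  exact H.dlam_eq_zero hx (by rw [← hv, H.P_idem x hx])

theorem L_df (hx : x ∈ Ω) (v : V) :
    ⟪lam x • ξ x - f x + R x, fderiv ℝ f x v⟫ = fderiv ℝ lam x v / lam x := by
  rw [inner_add_left, inner_sub_left, inner_smul_left, H.ξ_df x hx, H.f_df hx, hRX x hx]
  simp

/-- L collects three coefficients of dP on the complement of the plane: ∇ log λ from Codazzi on the
remaining tangent directions, -f from differentiating P f = 0, and λξ from the normal part of dP. -/
theorem dP_eq (hx : x ∈ Ω) (u : V) :
    fderiv ℝ P x u = symOp (P x (fderiv ℝ f x u)) (lam x • ξ x - f x + R x) := by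
  set L := lam x • ξ x - f x + R x with hL
  have hPL : P x L = 0 := H.P_L hR hRX hx
  have hLP : ∀ w, ⟪L, P x w⟫ = 0 := fun w => by rw [← H.P_symm x hx, hPL, inner_zero_left]
  have hpr : ∃ u', P x (fderiv ℝ f x u) = fderiv ℝ f x u' := H.P_range x hx _
  -- Since dP(u) depends only on P df(u), u may be traded for a vector tangent to the plane, along
  -- which λ is constant.
  obtain ⟨u', hu'⟩ := hpr
  have huu : P x (fderiv ℝ f x u') = fderiv ℝ f x u' := by rw [← hu', H.P_idem x hx]
  have hfR : ⟪f x, R x⟫ = 0 := by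
    obtain ⟨v, hv⟩ := hR x hx
    rw [hv, H.f_df hx]
  have hτR : τ x (R x) = R x := by
    obtain ⟨v, hv⟩ := hR x hx
    rw [hv, H.τ_df x hx]
  have hX : ∀ v, fderiv ℝ P x u (fderiv ℝ f x v - P x (fderiv ℝ f x v)) =
      ⟪L, fderiv ℝ f x v⟫ • P x (fderiv ℝ f x u) := fun v => by
    have h1 := H.dP_compl_sub hx u' v
    rw [huu, sub_self, map_zero, sub_zero, H.dlam_eq_zero hx huu, zero_smul, sub_zero,
      H.dP_eq_of_P_df_eq hx (huu.trans hu'.symm), ← hu'] at h1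
    rw [h1, H.L_df hR hRX hx]
  have hf : fderiv ℝ P x u (f x) = -P x (fderiv ℝ f x u) := by
    have := fderiv_clm_apply_of_eqOn (k := fun _ => 0) H.isOpen hx (H.diff_P hx) (H.diff_f hx)
      (fun y hy => H.P_f hy) u
    simpa [eq_neg_iff_add_eq_zero] using this
  have hη : ∀ η, τ x η = 0 → fderiv ℝ P x u η = ⟪L, η⟫ • P x (fderiv ℝ f x u) := by
    intro η hη
    have hPη : P x η = 0 := by
      refine ext_inner_right ℝ fun w => ?_
      rw [H.P_symm x hx, ← H.τ_P hx, ← H.τ_symm x hx, hη, inner_zero_left, inner_zero_left]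
    refine ext_inner_right ℝ fun w => ?_
    have h1 : fderiv ℝ P x u η = P x (fderiv ℝ P x u η) := by
      conv_lhs => rw [H.dP_offDiag hx u η, hPη, map_zero, add_zero]
    rw [h1, H.P_symm x hx, H.dP_symm hx, real_inner_comm, H.normal_dP hx hη, inner_smul_left, hL,
      inner_add_left, inner_sub_left, inner_smul_left, ← H.τ_f x hx, ← hτR, H.τ_symm x hx,
      H.τ_symm x hx, hη]
    simp
    ring
  rw [← sub_eq_zero]
  -- The comparison is made on the complement of the plane, split in `hdec` into tangent vectors,
  -- the position line and the kernel of τ.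
  refine offDiagonal_eq_zero (p := ContinuousLinearMap.id ℝ F - P x) ?_ ?_ ?_ ?_
  · intro v w
    simp only [sub_apply, inner_sub_left, inner_sub_right, symOp_symm, H.dP_symm hx]
  · intro v w
    simp [inner_sub_left, inner_sub_right, H.P_symm x hx]
  · intro w
    have h1 := H.dP_offDiag hx u w
    simp only [sub_apply, symOp_apply, map_sub, map_add, map_smul, ContinuousLinearMap.id_apply,
      hPL, H.P_idem x hx, hLP]
    have h2 : ⟪P x (fderiv ℝ f x u), P x w⟫ = ⟪P x (fderiv ℝ f x u), w⟫ := by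
      rw [← H.P_symm x hx, H.P_idem x hx]
    rw [h2]
    generalize P x (fderiv ℝ P x u w) = B at *
    generalize fderiv ℝ P x u (P x w) = C at *
    rw [h1]
    module
  · intro w
    have hdec : ∃ v, ∃ c : ℝ, ∃ η, τ x η = 0 ∧ w = fderiv ℝ f x v + c • f x + η := by
      obtain ⟨v, c, hv⟩ := H.τ_range x hx w
      exact ⟨v, c, w - τ x w, by rw [map_sub, H.τ_idem hx, sub_self], by rw [← hv]; abel⟩
    obtain ⟨v, c, η, hτη, rfl⟩ := hdec
    have hPη : P x η = 0 := by
      refine ext_inner_right ℝ fun w => ?_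
      rw [H.P_symm x hx, ← H.τ_P hx, ← H.τ_symm x hx, hτη, inner_zero_left, inner_zero_left]
    have hLf : ⟪L, f x⟫ = -1 := by
      rw [hL, inner_add_left, inner_sub_left, inner_smul_left, H.ξ_f x hx, H.f_f x hx,
        real_inner_comm, hfR]
      simp
    have e1 : (ContinuousLinearMap.id ℝ F - P x) (fderiv ℝ f x v + c • f x + η) =
        (fderiv ℝ f x v - P x (fderiv ℝ f x v)) + c • f x + η := by
      simp [H.P_f hx, hPη]
      abel
    have e2 : ⟪P x (fderiv ℝ f x u), (fderiv ℝ f x v - P x (fderiv ℝ f x v)) + c • f x + η⟫ = 0 := by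
      rw [H.P_symm x hx]
      simp [H.P_f hx, hPη, H.P_idem x hx]
    rw [e1, sub_apply, symOp_apply, e2, map_add, map_add, map_smul, hX, hf, hη η hτη,
      inner_add_right, inner_add_right, inner_sub_right, hLP, inner_smul_right, hLf]
    module

/-- The plane component comes from differentiating P L = 0. For w orthogonal to the plane, the
symmetry of second derivatives of P shows that ⟪dL(u), w⟫ - d log λ(u) ⟪L, w⟫ satisfies the
hypothesis of `form_eq_zero`. -/
theorem dL_eq (hx : x ∈ Ω) (hRd : ∀ y ∈ Ω, DifferentiableAt ℝ R y) (u : V) :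
    fderiv ℝ (fun y => lam y • ξ y - f y + R y) x u =
      (fderiv ℝ lam x u / lam x) • (lam x • ξ x - f x + R x) -
      ⟪lam x • ξ x - f x + R x, lam x • ξ x - f x + R x⟫ • P x (fderiv ℝ f x u) := by
  set L : V → F := fun y => lam y • ξ y - f y + R y with hL
  change fderiv ℝ L x u = (fderiv ℝ lam x u / lam x) • L x - ⟪L x, L x⟫ • P x (fderiv ℝ f x u)
  have hLd : ∀ y ∈ Ω, DifferentiableAt ℝ L y := fun y hy =>
    (((H.diff_lam hy).smul (H.diff_ξ hy)).sub (H.diff_f hy)).add (hRd y hy)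
  have hPL : ∀ y ∈ Ω, P y (L y) = 0 := fun y hy => H.P_L hR hRX hy
  have hdP : ∀ y ∈ Ω, ∀ v, fderiv ℝ P y v = symOp (P y (fderiv ℝ f y v)) (L y) := fun y hy v =>
    H.dP_eq hR hRX hy v
  have hLP : ⟪P x (fderiv ℝ f x u), L x⟫ = 0 := by
    rw [H.P_symm x hx, hPL x hx, inner_zero_right]
  have hPd : P x (fderiv ℝ L x u) = -(⟪L x, L x⟫ • P x (fderiv ℝ f x u)) := by
    have := fderiv_clm_apply_of_eqOn (k := fun _ => 0) H.isOpen hx (H.diff_P hx) (hLd x hx)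
      hPL u
    rw [hdP x hx, symOp_apply, hLP] at this
    simp at this
    rw [eq_neg_iff_add_eq_zero, add_comm, real_inner_self_eq_norm_sq]; exact this
  have horth : ∀ w, P x w = 0 → ⟪fderiv ℝ L x u, w⟫ - fderiv ℝ lam x u / lam x * ⟪L x, w⟫ = 0 := by
    intro w hw
    refine H.form_eq_zero hx
      (fun u => ⟪fderiv ℝ L x u, w⟫ - fderiv ℝ lam x u / lam x * ⟪L x, w⟫) (fun u v => ?_) u
    have h1 := symOp_clairaut H.isOpen hx (H.smooth_P x hx) (fun v y => P y (fderiv ℝ f y v)) L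
      (H.diff_P_df hx) (hLd x hx) (fun y hy => H.diff_P hy) hdP u v w
    have hPw : ∀ z, ⟪P x z, w⟫ = 0 := fun z => by rw [H.P_symm x hx, hw, inner_zero_right]
    simp only [H.fderiv_P_df_sub hx, H.dP_sub hx, hPw, inner_sub_left, inner_smul_left] at h1
    simp only [mul_zero, sub_self, zero_smul, zero_add] at h1
    rw [← sub_eq_zero, ← h1]
    module
  set r := fderiv ℝ L x u - (fderiv ℝ lam x u / lam x) • L x + ⟪L x, L x⟫ • P x (fderiv ℝ f x u)
    with hr
  have hPr : P x r = 0 := by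
    rw [hr, map_add, map_sub, map_smul, map_smul, hPd, hPL x hx, H.P_idem x hx]
    simp
  have h0 : ⟪r, r⟫ = 0 := by
    have h1 := horth r hPr
    have h2 : ⟪P x (fderiv ℝ f x u), r⟫ = 0 := by rw [H.P_symm x hx, hPr, inner_zero_right]
    conv_lhs => enter [2]; rw [hr]
    rw [inner_add_left, inner_sub_left, inner_smul_left, inner_smul_left, h2]
    simpa using h1
  have h3 : r = 0 := inner_self_eq_zero.mp h0
  rw [← sub_eq_zero, ← h3, hr]
  abel

theorem L_f (hx : x ∈ Ω) : ⟪lam x • ξ x - f x + R x, f x⟫ = -1 := by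
  obtain ⟨v, hv⟩ := hR x hx
  rw [inner_add_left, inner_sub_left, inner_smul_left, H.ξ_f x hx, H.f_f x hx, hv,
    real_inner_comm, H.f_df hx]
  simp

/-- The component along the position vector is -1; this permits division by |L|² below. -/
theorem L_ne_zero (hx : x ∈ Ω) : lam x • ξ x - f x + R x ≠ 0 := by
  intro h
  have := H.L_f hR hRX hx
  rw [h, inner_zero_left] at this
  norm_num at this

theorem L_ξ (hx : x ∈ Ω) : ⟪lam x • ξ x - f x + R x, ξ x⟫ = lam x := by
  obtain ⟨v, hv⟩ := hR x hx
  rw [inner_add_left, inner_sub_left, inner_smul_left, H.ξ_ξ x hx, real_inner_comm, H.ξ_f x hx,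
    hv, real_inner_comm, H.ξ_df x hx]
  simp

/-- L is orthogonal to the plane, so `dL_eq` gives d|L|² = 2 |L|² d log λ. In particular λ²/|L|² is
locally constant; it will be 1 - a². -/
theorem fderiv_inv_normSq_L (hx : x ∈ Ω) (hRd : ∀ y ∈ Ω, DifferentiableAt ℝ R y) (u : V) :
    DifferentiableAt ℝ (fun y => (⟪lam y • ξ y - f y + R y, lam y • ξ y - f y + R y⟫ : ℝ)⁻¹) x ∧
    fderiv ℝ (fun y => (⟪lam y • ξ y - f y + R y, lam y • ξ y - f y + R y⟫ : ℝ)⁻¹) x u =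
      -(2 * (fderiv ℝ lam x u / lam x) *
        (⟪lam x • ξ x - f x + R x, lam x • ξ x - f x + R x⟫)⁻¹) := by
  have hdL := H.dL_eq hR hRX hx hRd u
  have hLX := H.P_L hR hRX hx
  have hne : (⟪lam x • ξ x - f x + R x, lam x • ξ x - f x + R x⟫ : ℝ) ≠ 0 :=
    inner_self_ne_zero.mpr (H.L_ne_zero hR hRX hx)
  have hLd : DifferentiableAt ℝ (fun y => lam y • ξ y - f y + R y) x :=
    (((H.diff_lam hx).fun_smul (H.diff_ξ hx)).fun_sub (H.diff_f hx)).fun_add (hRd x hx)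
  have hq : DifferentiableAt ℝ
      (fun y => (⟪lam y • ξ y - f y + R y, lam y • ξ y - f y + R y⟫ : ℝ)) x := hLd.inner ℝ hLd
  refine ⟨hq.fun_inv hne, ?_⟩
  have hinv := (hasDerivAt_inv hne).comp_hasFDerivAt x hq.hasFDerivAt
  refine (congrArg (fun T : V →L[ℝ] ℝ => T u) hinv.fderiv).trans ?_
  simp only [smul_apply]
  rw [fderiv_inner_apply ℝ hLd hLd, hdL]
  rw [inner_sub_right, inner_smul_right, inner_smul_right, inner_sub_left, inner_smul_left,
    inner_smul_left, H.P_symm x hx, hLX, ← H.P_symm x hx, hLX]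
  simp only [inner_zero_left, inner_zero_right, conj_trivial, smul_eq_mul]
  field_simp
  ring

/-- The factor λ|L|⁻² is chosen so that the plane parts of dξ and dL cancel. The coefficient of L
then collects d log λ with weights 1 - 2 + 1. -/
theorem fderiv_axis (hx : x ∈ Ω) (hRd : ∀ y ∈ Ω, DifferentiableAt ℝ R y) :
    fderiv ℝ (fun y => ξ y - (lam y * (⟪lam y • ξ y - f y + R y, lam y • ξ y - f y + R y⟫ : ℝ)⁻¹) •
      (lam y • ξ y - f y + R y)) x = 0 := by
  ext u
  obtain ⟨hκd, hκ⟩ := H.fderiv_inv_normSq_L hR hRX hx hRd u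
  have hdL := H.dL_eq hR hRX hx hRd u
  have hne : (⟪lam x • ξ x - f x + R x, lam x • ξ x - f x + R x⟫ : ℝ) ≠ 0 :=
    inner_self_ne_zero.mpr (H.L_ne_zero hR hRX hx)
  have hLd : DifferentiableAt ℝ (fun y => lam y • ξ y - f y + R y) x :=
    (((H.diff_lam hx).fun_smul (H.diff_ξ hx)).fun_sub (H.diff_f hx)).fun_add (hRd x hx)
  rw [fderiv_fun_sub (H.diff_ξ hx) (((H.diff_lam hx).fun_mul hκd).fun_smul hLd),
    fderiv_fun_smul ((H.diff_lam hx).fun_mul hκd) hLd, fderiv_fun_mul (H.diff_lam hx) hκd]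
  simp only [sub_apply, add_apply, smul_apply, ContinuousLinearMap.smulRight_apply, hdL, hκ,
    H.dξ_eq hx, zero_apply, smul_eq_mul]
  have hl := (H.lam_pos x hx).ne'
  set q : ℝ := ⟪lam x • ξ x - f x + R x, lam x • ξ x - f x + R x⟫
  set L := lam x • ξ x - f x + R x
  match_scalars <;> field_simp <;> ring

/-- The symmetric product of P df and L in dP is cancelled by differentiating L ⊗ L/|L|², whose L ⊗
L terms cancel against the derivative of |L|⁻². -/
theorem fderiv_projection (hx : x ∈ Ω) (hRd : ∀ y ∈ Ω, DifferentiableAt ℝ R y) (w : F) :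
    fderiv ℝ (fun y => P y w + ((⟪lam y • ξ y - f y + R y, lam y • ξ y - f y + R y⟫ : ℝ)⁻¹ *
      ⟪lam y • ξ y - f y + R y, w⟫) • (lam y • ξ y - f y + R y)) x = 0 := by
  ext u
  obtain ⟨hκd, hκ⟩ := H.fderiv_inv_normSq_L hR hRX hx hRd u
  have hdL := H.dL_eq hR hRX hx hRd u
  have hne : (⟪lam x • ξ x - f x + R x, lam x • ξ x - f x + R x⟫ : ℝ) ≠ 0 :=
    inner_self_ne_zero.mpr (H.L_ne_zero hR hRX hx)
  have hLd : DifferentiableAt ℝ (fun y => lam y • ξ y - f y + R y) x :=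
    (((H.diff_lam hx).fun_smul (H.diff_ξ hx)).fun_sub (H.diff_f hx)).fun_add (hRd x hx)
  have hLw : DifferentiableAt ℝ (fun y => (⟪lam y • ξ y - f y + R y, w⟫ : ℝ)) x :=
    hLd.inner ℝ (by fun_prop)
  have hPw : DifferentiableAt ℝ (fun y => P y w) x := (H.diff_P hx).clm_apply (by fun_prop)
  rw [fderiv_fun_add hPw ((hκd.fun_mul hLw).fun_smul hLd),
    fderiv_fun_smul (hκd.fun_mul hLw) hLd, fderiv_fun_mul hκd hLw,
    fderiv_clm_apply (H.diff_P hx) (by fun_prop)]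
  simp only [add_apply, smul_apply, ContinuousLinearMap.smulRight_apply, hdL, hκ,
    zero_apply, smul_eq_mul, fderiv_fun_const, Pi.zero_apply, ContinuousLinearMap.comp_zero,
    zero_add, ContinuousLinearMap.flip_apply, H.dP_eq hR hRX hx, symOp_apply]
  rw [fderiv_inner_apply ℝ hLd (by fun_prop), hdL]
  simp only [fderiv_fun_const, Pi.zero_apply, zero_apply, inner_zero_right, zero_add,
    inner_sub_left, inner_smul_left, conj_trivial]
  have hl := (H.lam_pos x hx).ne'
  set q : ℝ := ⟪lam x • ξ x - f x + R x, lam x • ξ x - f x + R x⟫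
  set L := lam x • ξ x - f x + R x
  match_scalars <;> field_simp <;> ring

end

/-- Reduction of codimension: the derivative of ξ ⊗ ξ is the negative of dτ, because ξ is parallel.
-/
theorem fderiv_osculating (H : IsRankTwoImmersion Ω f ξ lam P τ) (hx : x ∈ Ω) (w : F) :
    fderiv ℝ (fun y => τ y w + ⟪ξ y, w⟫ • ξ y) x = 0 := by
  ext u
  have h1 : DifferentiableAt ℝ (fun y => τ y w) x := (H.diff_τ hx).clm_apply (by fun_prop)
  have h2 : DifferentiableAt ℝ (fun y => (⟪ξ y, w⟫ : ℝ)) x := (H.diff_ξ hx).inner ℝ (by fun_prop)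
  rw [fderiv_fun_add h1 (h2.fun_smul (H.diff_ξ hx)), fderiv_fun_smul h2 (H.diff_ξ hx),
    fderiv_clm_apply (H.diff_τ hx) (by fun_prop)]
  simp only [add_apply, smul_apply, ContinuousLinearMap.smulRight_apply, 
    zero_apply, fderiv_fun_const, Pi.zero_apply, ContinuousLinearMap.comp_zero,
    zero_add, ContinuousLinearMap.flip_apply, H.dτ_eq hx, symOp_apply, H.dξ_eq hx]
  rw [fderiv_inner_apply ℝ (H.diff_ξ hx) (by fun_prop), H.dξ_eq hx]
  simp only [fderiv_fun_const, Pi.zero_apply, zero_apply, inner_zero_right, zero_add,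
    inner_neg_left]
  module

end IsRankTwoImmersion

end RankTwo

/-! ### A smooth formula for orthogonal projection onto the range of an injective operator. -/

section LeftInverse

variable {V F : Type*} [NormedAddCommGroup V] [InnerProductSpace ℝ V] [FiniteDimensional ℝ V]
  [NormedAddCommGroup F] [InnerProductSpace ℝ F] [FiniteDimensional ℝ F]

/-- The adjoint of a real operator, as a linear map. -/
def adjointLinear : (V →L[ℝ] F) →ₗ[ℝ] (F →L[ℝ] V) where
  toFun A := ContinuousLinearMap.adjoint A
  map_add' := by simp
  map_smul' := by simp

theorem contDiff_adjoint {n : WithTop ℕ∞} :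
    ContDiff ℝ n fun A : V →L[ℝ] F => ContinuousLinearMap.adjoint A :=
  (LinearMap.toContinuousLinearMap (adjointLinear (V := V) (F := F))).contDiff

/-- The left inverse `(A* A)⁻¹ A*` of an injective operator `A`, vanishing on `(range A)ᗮ`. -/
def leftInv (A : V →L[ℝ] F) : F →L[ℝ] V :=
  (ContinuousLinearMap.adjoint A ∘L A).inverse ∘L ContinuousLinearMap.adjoint A

theorem exists_equiv_adjoint_comp {A : V →L[ℝ] F} (hA : Function.Injective A) :
    ∃ e : V ≃L[ℝ] V, (e : V →L[ℝ] V) = ContinuousLinearMap.adjoint A ∘L A := by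
  have hinj : Function.Injective (ContinuousLinearMap.adjoint A ∘L A : V →L[ℝ] V) := by
    refine (injective_iff_map_eq_zero _).mpr fun v hv => ?_
    have : ⟪A v, A v⟫ = 0 := by
      rw [← ContinuousLinearMap.adjoint_inner_left]
      have h1 : ContinuousLinearMap.adjoint A (A v) = 0 := hv
      rw [h1, inner_zero_left]
    exact hA (by rw [inner_self_eq_zero.mp this, map_zero])
  refine ⟨(LinearEquiv.ofInjectiveEndo
    (ContinuousLinearMap.adjoint A ∘L A : V →L[ℝ] V).toLinearMap hinj).toContinuousLinearEquiv, ?_⟩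
  ext v
  rfl

theorem leftInv_apply_self {A : V →L[ℝ] F} (hA : Function.Injective A) (v : V) :
    leftInv A (A v) = v := by
  obtain ⟨e, he⟩ := exists_equiv_adjoint_comp hA
  have h1 : ContinuousLinearMap.adjoint A (A v) = e v := congrArg (fun T : V →L[ℝ] V => T v) he.symm
  simp only [leftInv, ContinuousLinearMap.comp_apply]
  rw [h1, ← he, ContinuousLinearMap.inverse_equiv]
  simp

/-- Together with `apply_leftInv_symm`, this says that A composed with `leftInv A` is the orthogonal
projection onto the range of A. -/
theorem inner_apply_leftInv {A : V →L[ℝ] F} (hA : Function.Injective A) (w : F) (v : V) :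
    ⟪A (leftInv A w), A v⟫ = ⟪w, A v⟫ := by
  obtain ⟨e, he⟩ := exists_equiv_adjoint_comp hA
  have h1 : ∀ v, ContinuousLinearMap.adjoint A (A v) = e v := fun v =>
    congrArg (fun T : V →L[ℝ] V => T v) he.symm
  rw [← ContinuousLinearMap.adjoint_inner_left, h1, ← ContinuousLinearMap.adjoint_inner_left]
  simp only [leftInv, ContinuousLinearMap.comp_apply]
  rw [← he, ContinuousLinearMap.inverse_equiv]
  simp

theorem apply_leftInv_symm {A : V →L[ℝ] F} (hA : Function.Injective A) (w z : F) :
    ⟪A (leftInv A w), z⟫ = ⟪w, A (leftInv A z)⟫ := by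
  rw [← inner_apply_leftInv hA w, real_inner_comm, ← inner_apply_leftInv hA z, real_inner_comm]

theorem leftInv_eq_zero (A : V →L[ℝ] F) {w : F} (hw : ∀ v, ⟪w, A v⟫ = 0) : leftInv A w = 0 := by
  have : ContinuousLinearMap.adjoint A w = 0 := by
    refine ext_inner_right ℝ fun v => ?_
    rw [ContinuousLinearMap.adjoint_inner_left, hw, inner_zero_left]
  simp [leftInv, this]

/-- Inversion is smooth at the invertible operator A* A. The explicit formula is what makes the
tangential projections smooth in the base point. -/
theorem contDiffAt_leftInv {W : Type*} [NormedAddCommGroup W] [NormedSpace ℝ W] {x : W}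
    {n : WithTop ℕ∞} {A : W → V →L[ℝ] F} (hA : ContDiffAt ℝ n A x)
    (hinj : Function.Injective (A x)) : ContDiffAt ℝ n (fun y => leftInv (A y)) x := by
  have h1 : ContDiffAt ℝ n (fun y => ContinuousLinearMap.adjoint (A y)) x :=
    contDiff_adjoint.contDiffAt.comp x hA
  obtain ⟨e, he⟩ := exists_equiv_adjoint_comp hinj
  have h2 : ContDiffAt ℝ n (fun y => ContinuousLinearMap.adjoint (A y) ∘L A y) x := h1.clm_comp hA
  have h3 : ContDiffAt ℝ n (fun y => (ContinuousLinearMap.adjoint (A y) ∘L A y).inverse) x := by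
    refine ContDiffAt.comp x (g := ContinuousLinearMap.inverse) ?_ h2
    rw [← he]
    exact contDiffAt_map_inverse e
  exact h3.clm_comp h1

/-- The trace of a bilinear form over `V`, computed with an orthonormal basis of an ambient space
and the adjoint of an isometric embedding. -/
theorem sum_bilin_of_isometry {ι κ U G : Type*} [Fintype ι] [Fintype κ] [NormedAddCommGroup U]
    [InnerProductSpace ℝ U] [AddCommGroup G] [Module ℝ G] (b : OrthonormalBasis ι ℝ U)
    (c : OrthonormalBasis κ ℝ F) (X : U →ₗ[ℝ] F) (hX : ∀ v w, ⟪X v, X w⟫ = ⟪v, w⟫) (K : F → U)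
    (hK : ∀ w v, ⟪K w, v⟫ = ⟪w, X v⟫) (B : U →ₗ[ℝ] U →ₗ[ℝ] G) :
    ∑ a, B (K (c a)) (K (c a)) = ∑ i, B (b i) (b i) := by
  classical
  have h1 : ∀ a, B (K (c a)) (K (c a)) =
      ∑ j, ∑ k, (⟪X (b j), c a⟫ * ⟪c a, X (b k)⟫) • B (b j) (b k) := by
    intro a
    conv_lhs => rw [← b.sum_repr' (K (c a))]
    simp only [map_sum, map_smul, LinearMap.sum_apply, LinearMap.smul_apply, Finset.smul_sum,
      smul_smul]
    rw [Finset.sum_comm]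
    refine Finset.sum_congr rfl fun j _ => Finset.sum_congr rfl fun k _ => ?_
    rw [real_inner_comm, hK, real_inner_comm (K (c a)), hK, real_inner_comm (c a), mul_comm]
  simp_rw [h1]
  rw [Finset.sum_comm]
  refine Finset.sum_congr rfl fun j _ => ?_
  rw [Finset.sum_comm]
  simp_rw [← Finset.sum_smul, c.sum_inner_mul_inner, hX]
  simp [orthonormal_iff_ite.mp b.orthonormal]

end LeftInverse

/-! ### The immersion in a chart; tangent and normal spaces. -/

section Charts

variable {n : ℕ} {M : Type*} [TopologicalSpace M] [ChartedSpace (E n) M] [IsManifold (𝓡 n) ∞ M]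

theorem contMDiffAt_chart_symm (p : M) {x : E n} (hx : x ∈ (extChartAt (𝓡 n) p).target) :
    ContMDiffAt 𝓘(ℝ, E n) (𝓡 n) ∞ (extChartAt (𝓡 n) p).symm x :=
  (contMDiffOn_extChartAt_symm p).contMDiffAt ((isOpen_extChartAt_target p).mem_nhds hx)

theorem contMDiffAt_chart (p : M) {q : M} (hq : q ∈ (extChartAt (𝓡 n) p).source) :
    ContMDiffAt (𝓡 n) 𝓘(ℝ, E n) ∞ (extChartAt (𝓡 n) p) q :=
  contMDiffAt_extChartAt' (by rwa [extChartAt_source] at hq)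

theorem isInvertible_mfderiv_chart_symm (p : M) {x : E n} (hx : x ∈ (extChartAt (𝓡 n) p).target) :
    (mfderiv 𝓘(ℝ, E n) (𝓡 n) (extChartAt (𝓡 n) p).symm x).IsInvertible := by
  have : IsManifold (𝓡 n) 1 M := IsManifold.of_le (n := ∞) (by simp)
  have := isInvertible_mfderivWithin_extChartAt_symm (I := 𝓡 n) hx
  rwa [modelWithCornersSelf_coe, Set.range_id, mfderivWithin_univ] at this

theorem contDiffAt_comp_chart_symm {W : Type*} [NormedAddCommGroup W] [NormedSpace ℝ W] {G : M → W}
    (p : M) {x : E n} (hx : x ∈ (extChartAt (𝓡 n) p).target)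
    (hG : ContMDiffAt (𝓡 n) 𝓘(ℝ, W) ∞ G ((extChartAt (𝓡 n) p).symm x)) :
    ContDiffAt ℝ ∞ (fun y => G ((extChartAt (𝓡 n) p).symm y)) x :=
  (hG.comp x (contMDiffAt_chart_symm p hx)).contDiffAt

theorem fderiv_comp_chart_symm {W : Type*} [NormedAddCommGroup W] [NormedSpace ℝ W] {G : M → W}
    (p : M) {x : E n} (hx : x ∈ (extChartAt (𝓡 n) p).target)
    (hG : ContMDiffAt (𝓡 n) 𝓘(ℝ, W) ∞ G ((extChartAt (𝓡 n) p).symm x)) (v : E n) :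
    fderiv ℝ (fun y => G ((extChartAt (𝓡 n) p).symm y)) x v =
      mfderiv (𝓡 n) 𝓘(ℝ, W) G ((extChartAt (𝓡 n) p).symm x)
        (mfderiv 𝓘(ℝ, E n) (𝓡 n) (extChartAt (𝓡 n) p).symm x v) := by
  have h := mfderiv_comp x (hG.mdifferentiableAt (by simp))
    ((contMDiffAt_chart_symm p hx).mdifferentiableAt (by simp))
  rw [← mfderiv_eq_fderiv]
  exact congrArg (fun T : E n →L[ℝ] W => T v) h

variable {m : ℕ} {φ : M → S m}

/-- The map `φ` in the chart at `p`. -/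
def chartMap (φ : M → S m) (p : M) (x : E n) : E (m + 1) := φ ((extChartAt (𝓡 n) p).symm x)

theorem contMDiff_coe_comp (hφ : ContMDiff (𝓡 n) (𝓡 m) ∞ φ) :
    ContMDiff (𝓡 n) 𝓘(ℝ, E (m + 1)) ∞ fun q => (φ q : E (m + 1)) :=
  have := Fact.mk (@finrank_euclideanSpace_fin ℝ _ (m + 1))
  (contMDiff_coe_sphere (E := E (m + 1)) (n := m)).comp hφ

theorem contDiffAt_chartMap (hφ : ContMDiff (𝓡 n) (𝓡 m) ∞ φ) (p : M) {x : E n}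
    (hx : x ∈ (extChartAt (𝓡 n) p).target) : ContDiffAt ℝ ∞ (chartMap φ p) x :=
  contDiffAt_comp_chart_symm p hx (contMDiff_coe_comp hφ).contMDiffAt

theorem fderiv_chartMap (hφ : ContMDiff (𝓡 n) (𝓡 m) ∞ φ) (p : M) {x : E n}
    (hx : x ∈ (extChartAt (𝓡 n) p).target) (v : E n) :
    fderiv ℝ (chartMap φ p) x v = differential n φ ((extChartAt (𝓡 n) p).symm x)
        (mfderiv 𝓘(ℝ, E n) (𝓡 n) (extChartAt (𝓡 n) p).symm x v) :=
  fderiv_comp_chart_symm p hx (contMDiff_coe_comp hφ).contMDiffAt v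

theorem range_fderiv_chartMap (hφ : ContMDiff (𝓡 n) (𝓡 m) ∞ φ) (p : M) {x : E n}
    (hx : x ∈ (extChartAt (𝓡 n) p).target) (w : E (m + 1)) :
    (∃ v, differential n φ ((extChartAt (𝓡 n) p).symm x) v = w) ↔
      ∃ v, fderiv ℝ (chartMap φ p) x v = w := by
  constructor
  · rintro ⟨v, rfl⟩
    obtain ⟨e, he⟩ := isInvertible_mfderiv_chart_symm p hx
    refine ⟨e.symm v, (fderiv_chartMap hφ p hx (e.symm v)).trans ?_⟩
    rw [← he]
    exact congrArg _ (e.apply_symm_apply v)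
  · rintro ⟨v, rfl⟩
    exact ⟨_, (fderiv_chartMap hφ p hx v).symm⟩

theorem inner_chartMap_self (φ : M → S m) (p : M) (x : E n) :
    ⟪chartMap φ p x, chartMap φ p x⟫ = 1 := by
  rw [real_inner_self_eq_norm_sq, chartMap, norm_eq_of_mem_sphere]
  norm_num

theorem inner_chartMap_fderiv (hφ : ContMDiff (𝓡 n) (𝓡 m) ∞ φ) (p : M) {x : E n}
    (hx : x ∈ (extChartAt (𝓡 n) p).target) (v : E n) :
    ⟪chartMap φ p x, fderiv ℝ (chartMap φ p) x v⟫ = 0 := by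
  have hd := (contDiffAt_chartMap hφ p hx).differentiableAt (by simp)
  have h1 : fderiv ℝ (fun y => ⟪chartMap φ p y, chartMap φ p y⟫) x v = 0 := by
    simp only [inner_chartMap_self]
    simp
  rw [fderiv_inner_apply ℝ hd hd, real_inner_comm (chartMap φ p x)] at h1
  linarith

/-- Differentiating ⟪f, df(v)⟫ = 0. This is the second fundamental form of the unit sphere, the
source of the constant curvature term in the Gauss equation. -/
theorem inner_chartMap_second (hφ : ContMDiff (𝓡 n) (𝓡 m) ∞ φ) (p : M) {x : E n}
    (hx : x ∈ (extChartAt (𝓡 n) p).target) (u v : E n) :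
    ⟪chartMap φ p x, fderiv ℝ (fderiv ℝ (chartMap φ p)) x u v⟫ =
      -⟪fderiv ℝ (chartMap φ p) x u, fderiv ℝ (chartMap φ p) x v⟫ := by
  have hd := (contDiffAt_chartMap hφ p hx).differentiableAt (by simp)
  have hdd : DifferentiableAt ℝ (fderiv ℝ (chartMap φ p)) x :=
    ((contDiffAt_chartMap hφ p hx).fderiv_right (m := ∞) (by simp)).differentiableAt (by simp)
  have hev : (fun y => ⟪chartMap φ p y, fderiv ℝ (chartMap φ p) y v⟫) =ᶠ[𝓝 x] fun _ => (0 : ℝ) :=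
    eventually_of_mem ((isOpen_extChartAt_target p).mem_nhds hx)
      fun y hy => inner_chartMap_fderiv hφ p hy v
  have h1 := congrArg (fun T : E n →L[ℝ] ℝ => T u) hev.fderiv_eq
  rw [fderiv_inner_apply ℝ hd (hdd.clm_apply (by fun_prop)),
    fderiv_clm_apply hdd (by fun_prop)] at h1
  simp at h1
  linarith

section Isometric

variable [RiemannianBundle (fun x : M => TangentSpace (𝓡 n) x)]

theorem injective_differential (hφ : IsIsometricImmersion n φ) (q : M) :
    Function.Injective (differential n φ q) := by
  refine (injective_iff_map_eq_zero _).mpr fun v hv => ?_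
  have := hφ.2 q v v
  rw [hv, inner_zero_left] at this
  exact inner_self_eq_zero.mp this.symm

theorem injective_fderiv_chartMap (hφ : IsIsometricImmersion n φ) (p : M) {x : E n}
    (hx : x ∈ (extChartAt (𝓡 n) p).target) : Function.Injective (fderiv ℝ (chartMap φ p) x) := by
  obtain ⟨e, he⟩ := isInvertible_mfderiv_chart_symm p hx
  intro v w hvw
  rw [fderiv_chartMap hφ.1 p hx, fderiv_chartMap hφ.1 p hx] at hvw
  have := injective_differential hφ _ hvw
  rw [← he] at this
  exact e.injective this

end Isometric

/-- The orthogonal projection onto the span of the tangent space and the position vector. -/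
def oscProj (φ : M → S m) (p : M) (x : E n) : E (m + 1) →L[ℝ] E (m + 1) :=
  fderiv ℝ (chartMap φ p) x ∘L leftInv (fderiv ℝ (chartMap φ p) x) +
    (innerSL ℝ (chartMap φ p x)).smulRight (chartMap φ p x)

theorem oscProj_apply (φ : M → S m) (p : M) (x : E n) (w : E (m + 1)) :
    oscProj φ p x w = fderiv ℝ (chartMap φ p) x (leftInv (fderiv ℝ (chartMap φ p) x) w) +
      ⟪chartMap φ p x, w⟫ • chartMap φ p x := by
  simp [oscProj]

variable [RiemannianBundle (fun x : M => TangentSpace (𝓡 n) x)]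
variable (hφ : IsIsometricImmersion n φ) (p : M) {x : E n} (hx : x ∈ (extChartAt (𝓡 n) p).target)
include hφ hx

theorem oscProj_fderiv (v : E n) :
    oscProj φ p x (fderiv ℝ (chartMap φ p) x v) = fderiv ℝ (chartMap φ p) x v := by
  rw [oscProj_apply, leftInv_apply_self (injective_fderiv_chartMap hφ p hx),
    inner_chartMap_fderiv hφ.1 p hx, zero_smul, add_zero]

theorem leftInv_chartMap : leftInv (fderiv ℝ (chartMap φ p) x) (chartMap φ p x) = 0 :=
  leftInv_eq_zero _ fun v => inner_chartMap_fderiv hφ.1 p hx v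

theorem oscProj_self : oscProj φ p x (chartMap φ p x) = chartMap φ p x := by
  rw [oscProj_apply, leftInv_chartMap hφ p hx, inner_chartMap_self]
  simp

theorem oscProj_symm (v w : E (m + 1)) : ⟪oscProj φ p x v, w⟫ = ⟪v, oscProj φ p x w⟫ := by
  rw [oscProj_apply, oscProj_apply, inner_add_left, inner_add_right,
    apply_leftInv_symm (injective_fderiv_chartMap hφ p hx), inner_smul_left, inner_smul_right,
    real_inner_comm v]
  simp [mul_comm]

theorem contDiffAt_oscProj : ContDiffAt ℝ ∞ (oscProj φ p) x := by
  have h0 := contDiffAt_chartMap hφ.1 p hx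
  have h1 : ContDiffAt ℝ ∞ (fderiv ℝ (chartMap φ p)) x := h0.fderiv_right (m := ∞) (by simp)
  have h2 := contDiffAt_leftInv h1 (injective_fderiv_chartMap hφ p hx)
  refine (h1.clm_comp h2).add ?_
  exact ((innerSL ℝ (E := E (m + 1))).contDiff.contDiffAt.comp x h0).smulRight h0

theorem mem_normalSpace_iff (w : E (m + 1)) :
    w ∈ normalSpace n φ ((extChartAt (𝓡 n) p).symm x) ↔ oscProj φ p x w = 0 := by
  rw [normalSpace, Submodule.mem_orthogonal']
  constructor
  · intro h
    have h1 : ∀ v, ⟪w, fderiv ℝ (chartMap φ p) x v⟫ = 0 := fun v => by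
      refine h _ (Submodule.mem_sup_left ?_)
      exact (range_fderiv_chartMap hφ.1 p hx _).mpr ⟨v, rfl⟩
    have h2 : ⟪w, chartMap φ p x⟫ = 0 :=
      h _ (Submodule.mem_sup_right (Submodule.mem_span_singleton_self _))
    rw [oscProj_apply, leftInv_eq_zero _ h1, real_inner_comm, h2]
    simp
  · intro h u hu
    obtain ⟨a, ha, b, hb, rfl⟩ := Submodule.mem_sup.mp hu
    obtain ⟨c, rfl⟩ := Submodule.mem_span_singleton.mp hb
    obtain ⟨v, rfl⟩ := (range_fderiv_chartMap hφ.1 p hx a).mp ha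
    change ⟪w, _ + c • chartMap φ p x⟫ = 0
    rw [inner_add_right, inner_smul_right, ← oscProj_fderiv hφ p hx, ← oscProj_symm hφ p hx, h,
      ← oscProj_self hφ p hx, ← oscProj_symm hφ p hx, h]
    simp

theorem oscProj_idem (w : E (m + 1)) : oscProj φ p x (oscProj φ p x w) = oscProj φ p x w := by
  conv_lhs => rw [oscProj_apply φ p x w]
  rw [map_add, map_smul, oscProj_fderiv hφ p hx, oscProj_self hφ p hx, ← oscProj_apply]

theorem starProjection_normalSpace (w : E (m + 1)) :
    (normalSpace n φ ((extChartAt (𝓡 n) p).symm x)).starProjection w = w - oscProj φ p x w := by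
  refine Submodule.eq_starProjection_of_mem_orthogonal ?_ ?_
  · rw [mem_normalSpace_iff hφ p hx, map_sub, oscProj_idem hφ p hx, sub_self]
  · rw [sub_sub_cancel, Submodule.mem_orthogonal]
    intro u hu
    rw [mem_normalSpace_iff hφ p hx] at hu
    rw [← oscProj_symm hφ p hx, hu, inner_zero_left]

end Charts

/-! ### Chart independence of h and smoothness of the mean curvature vector. -/

section SecondFundamentalForm

/-- Applied to a change of charts: the second term lies in the range of the differential and
disappears from the normal part. -/
theorem fderiv_fderiv_comp {V W Z : Type*} [NormedAddCommGroup V] [NormedSpace ℝ V]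
    [NormedAddCommGroup W] [NormedSpace ℝ W] [NormedAddCommGroup Z] [NormedSpace ℝ Z]
    {g : W → Z} {θ : V → W} {x : V} (hg : ContDiffAt ℝ ∞ g (θ x)) (hθ : ContDiffAt ℝ ∞ θ x)
    (u v : V) :
    fderiv ℝ (fderiv ℝ (g ∘ θ)) x u v =
      fderiv ℝ (fderiv ℝ g) (θ x) (fderiv ℝ θ x u) (fderiv ℝ θ x v) +
      fderiv ℝ g (θ x) (fderiv ℝ (fderiv ℝ θ) x u v) := by
  have hg1 : DifferentiableAt ℝ (fderiv ℝ g) (θ x) :=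
    (hg.fderiv_right (m := ∞) (by simp)).differentiableAt (by simp)
  have hθ1 : DifferentiableAt ℝ (fderiv ℝ θ) x :=
    (hθ.fderiv_right (m := ∞) (by simp)).differentiableAt (by simp)
  have hθd : DifferentiableAt ℝ θ x := hθ.differentiableAt (by simp)
  have hge : ∀ᶠ z in 𝓝 (θ x), DifferentiableAt ℝ g z :=
    ((hg.of_le (m := 1) (by simp)).eventually (by simp)).mono fun z hz =>
      hz.differentiableAt (by simp)
  have hθe : ∀ᶠ y in 𝓝 x, DifferentiableAt ℝ θ y :=
    ((hθ.of_le (m := 1) (by simp)).eventually (by simp)).mono fun z hz =>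
      hz.differentiableAt (by simp)
  have hev : fderiv ℝ (g ∘ θ) =ᶠ[𝓝 x] fun y => (fderiv ℝ g (θ y)).comp (fderiv ℝ θ y) := by
    filter_upwards [hθe, hθd.continuousAt.eventually hge] with y h1 h2
    exact fderiv_comp y h2 h1
  have hgθ : DifferentiableAt ℝ (fun y => fderiv ℝ g (θ y)) x := hg1.comp x hθd
  rw [hev.fderiv_eq, fderiv_clm_comp hgθ hθ1]
  have h2 : fderiv ℝ (fun y => fderiv ℝ g (θ y)) x = (fderiv ℝ (fderiv ℝ g) (θ x)).comp (fderiv ℝ θ x) :=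
    fderiv_comp x hg1 hθd
  rw [h2]
  simp [add_comm]

variable {n : ℕ} {M : Type*} [TopologicalSpace M] [ChartedSpace (E n) M] [IsManifold (𝓡 n) ∞ M]
variable {m : ℕ} {φ : M → S m}

theorem range_differential_self (hφ : ContMDiff (𝓡 n) (𝓡 m) ∞ φ) (q : M) (w : E (m + 1)) :
    (∃ v, differential n φ q v = w) ↔
      ∃ v, fderiv ℝ (chartMap φ q) (extChartAt (𝓡 n) q q) v = w := by
  have := range_fderiv_chartMap hφ q (mem_extChartAt_target (I := 𝓡 n) q) w
  rwa [extChartAt_to_inv] at this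

variable [RiemannianBundle (fun x : M => TangentSpace (𝓡 n) x)]
variable (hφ : IsIsometricImmersion n φ) (p : M) {x : E n} (hx : x ∈ (extChartAt (𝓡 n) p).target)
include hφ hx

theorem oscProj_of_mem_range {w : E (m + 1)}
    (hw : ∃ v, differential n φ ((extChartAt (𝓡 n) p).symm x) v = w) : oscProj φ p x w = w := by
  obtain ⟨v, rfl⟩ := (range_fderiv_chartMap hφ.1 p hx w).mp hw
  exact oscProj_fderiv hφ p hx v

/-- The second fundamental form in a chart that need not be centred at the point. -/
theorem secondFundamentalForm_chart (u v : E n) :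
    secondFundamentalForm n φ ((extChartAt (𝓡 n) p).symm x)
      (mfderiv 𝓘(ℝ, E n) (𝓡 n) (extChartAt (𝓡 n) p).symm x u)
      (mfderiv 𝓘(ℝ, E n) (𝓡 n) (extChartAt (𝓡 n) p).symm x v) =
    fderiv ℝ (fderiv ℝ (chartMap φ p)) x u v -
      oscProj φ p x (fderiv ℝ (fderiv ℝ (chartMap φ p)) x u v) := by
  set q := (extChartAt (𝓡 n) p).symm x with hq
  set θ : E n → E n := fun y => extChartAt (𝓡 n) q ((extChartAt (𝓡 n) p).symm y) with hθ
  have hqs : ContMDiffAt (𝓡 n) 𝓘(ℝ, E n) ∞ (extChartAt (𝓡 n) q) q :=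
    contMDiffAt_chart q (mem_extChartAt_source q)
  have hθs : ContDiffAt ℝ ∞ θ x := contDiffAt_comp_chart_symm p hx hqs
  have hθx : θ x = extChartAt (𝓡 n) q q := rfl
  have hθd : ∀ u, fderiv ℝ θ x u =
      coords q (mfderiv 𝓘(ℝ, E n) (𝓡 n) (extChartAt (𝓡 n) p).symm x u) := fun u =>
    fderiv_comp_chart_symm p hx hqs u
  have hfq : ContDiffAt ℝ ∞ (chartMap φ q) (θ x) :=
    contDiffAt_chartMap hφ.1 q (mem_extChartAt_target q)
  have hev : chartMap φ p =ᶠ[𝓝 x] chartMap φ q ∘ θ := by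
    have hc : ContinuousAt (extChartAt (𝓡 n) p).symm x :=
      (contMDiffAt_chart_symm p hx).continuousAt
    filter_upwards [hc.eventually_mem ((isOpen_extChartAt_source (I := 𝓡 n) q).mem_nhds
      (mem_extChartAt_source (I := 𝓡 n) q))] with y hy
    simp only [chartMap, Function.comp_apply, hθ]
    rw [(extChartAt (𝓡 n) q).left_inv hy]
  have h2 : fderiv ℝ (fderiv ℝ (chartMap φ p)) x u v =
      fderiv ℝ (fderiv ℝ (chartMap φ q)) (θ x) (fderiv ℝ θ x u) (fderiv ℝ θ x v) +
      fderiv ℝ (chartMap φ q) (θ x) (fderiv ℝ (fderiv ℝ θ) x u v) := by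
    rw [hev.fderiv.fderiv_eq, fderiv_fderiv_comp hfq hθs]
  -- The Hessian of the transition map contributes a tangent vector, which the normal projection
  -- removes.
  have h3 : oscProj φ p x (fderiv ℝ (chartMap φ q) (θ x) (fderiv ℝ (fderiv ℝ θ) x u v)) =
      fderiv ℝ (chartMap φ q) (θ x) (fderiv ℝ (fderiv ℝ θ) x u v) :=
    oscProj_of_mem_range hφ p hx ((range_differential_self hφ.1 q _).mpr ⟨_, rfl⟩)
  rw [h2, map_add, h3, hθd, hθd, hθx, add_sub_add_right_eq_sub]
  exact starProjection_normalSpace hφ p hx _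

/-- The orthonormal basis of the tangent space is chosen separately at each point, with no control
on its smoothness. Projecting a fixed ambient basis to the tangent space computes the same trace
smoothly in the point. -/
theorem sum_secondFundamentalForm (B : TangentSpace (𝓡 n) ((extChartAt (𝓡 n) p).symm x) →ₗ[ℝ]
      TangentSpace (𝓡 n) ((extChartAt (𝓡 n) p).symm x) →ₗ[ℝ] E (m + 1)) {ι : Type*} [Fintype ι]
    (b : OrthonormalBasis ι ℝ (TangentSpace (𝓡 n) ((extChartAt (𝓡 n) p).symm x))) :
    ∑ a, B (mfderiv 𝓘(ℝ, E n) (𝓡 n) (extChartAt (𝓡 n) p).symm x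
        (leftInv (fderiv ℝ (chartMap φ p) x) (EuclideanSpace.basisFun (Fin (m + 1)) ℝ a)))
      (mfderiv 𝓘(ℝ, E n) (𝓡 n) (extChartAt (𝓡 n) p).symm x
        (leftInv (fderiv ℝ (chartMap φ p) x) (EuclideanSpace.basisFun (Fin (m + 1)) ℝ a))) =
    ∑ i, B (b i) (b i) := by
  refine sum_bilin_of_isometry b (EuclideanSpace.basisFun (Fin (m + 1)) ℝ)
    (differential n φ ((extChartAt (𝓡 n) p).symm x)).toLinearMap (hφ.2 _)
    (fun w => mfderiv 𝓘(ℝ, E n) (𝓡 n) (extChartAt (𝓡 n) p).symm x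
        (leftInv (fderiv ℝ (chartMap φ p) x) w)) (fun w v => ?_) B
  obtain ⟨v', hv'⟩ := (range_fderiv_chartMap hφ.1 p hx _).mp ⟨v, rfl⟩
  rw [← hφ.2, ← fderiv_chartMap hφ.1 p hx]
  change _ = ⟪w, differential n φ _ v⟫
  rw [← hv', inner_apply_leftInv (injective_fderiv_chartMap hφ p hx)]

/-- The trace of the second fundamental form, in a chart. -/
theorem meanCurvature_chart (hn : n ≠ 0) :
    (n : ℝ) • meanCurvature n φ ((extChartAt (𝓡 n) p).symm x) =
    ∑ a, (fderiv ℝ (fderiv ℝ (chartMap φ p)) x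
        (leftInv (fderiv ℝ (chartMap φ p) x) (EuclideanSpace.basisFun (Fin (m + 1)) ℝ a))
        (leftInv (fderiv ℝ (chartMap φ p) x) (EuclideanSpace.basisFun (Fin (m + 1)) ℝ a)) -
      oscProj φ p x (fderiv ℝ (fderiv ℝ (chartMap φ p)) x
        (leftInv (fderiv ℝ (chartMap φ p) x) (EuclideanSpace.basisFun (Fin (m + 1)) ℝ a))
        (leftInv (fderiv ℝ (chartMap φ p) x) (EuclideanSpace.basisFun (Fin (m + 1)) ℝ a)))) := by
  have hn' : (n : ℝ) ≠ 0 := by exact_mod_cast hn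
  rw [meanCurvature, smul_smul, mul_one_div_cancel hn', one_smul]
  rw [← sum_secondFundamentalForm hφ p hx (secondFundamentalForm n φ _)]
  exact Finset.sum_congr rfl fun a _ => secondFundamentalForm_chart hφ p hx _ _

omit hx in
theorem contMDiff_meanCurvature (hn : n ≠ 0) :
    ContMDiff (𝓡 n) 𝓘(ℝ, E (m + 1)) ∞ (meanCurvature n φ) := by
  have hn' : (n : ℝ) ≠ 0 := by exact_mod_cast hn
  intro p
  have hx := mem_extChartAt_target (I := 𝓡 n) p
  have hc : ContDiffAt ℝ ∞ (fun x => meanCurvature n φ ((extChartAt (𝓡 n) p).symm x))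
      (extChartAt (𝓡 n) p p) := by
    have h0 := contDiffAt_chartMap hφ.1 p hx
    have h1 : ContDiffAt ℝ ∞ (fderiv ℝ (chartMap φ p)) (extChartAt (𝓡 n) p p) :=
      h0.fderiv_right (m := ∞) (by simp)
    have h2 : ContDiffAt ℝ ∞ (fderiv ℝ (fderiv ℝ (chartMap φ p))) (extChartAt (𝓡 n) p p) :=
      h1.fderiv_right (m := ∞) (by simp)
    have hJ := contDiffAt_leftInv h1 (injective_fderiv_chartMap hφ p hx)
    have hτ := contDiffAt_oscProj hφ p hx
    have hs : ContDiffAt ℝ ∞ (fun x => (1 / (n : ℝ)) • ∑ a, (fderiv ℝ (fderiv ℝ (chartMap φ p)) x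
        (leftInv (fderiv ℝ (chartMap φ p) x) (EuclideanSpace.basisFun (Fin (m + 1)) ℝ a))
        (leftInv (fderiv ℝ (chartMap φ p) x) (EuclideanSpace.basisFun (Fin (m + 1)) ℝ a)) -
      oscProj φ p x (fderiv ℝ (fderiv ℝ (chartMap φ p)) x
        (leftInv (fderiv ℝ (chartMap φ p) x) (EuclideanSpace.basisFun (Fin (m + 1)) ℝ a))
        (leftInv (fderiv ℝ (chartMap φ p) x) (EuclideanSpace.basisFun (Fin (m + 1)) ℝ a)))))
        (extChartAt (𝓡 n) p p) := by
      refine ContDiffAt.const_smul (1 / (n : ℝ)) ?_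
      refine ContDiffAt.sum fun a _ => ?_
      have hJa := hJ.clm_apply (contDiffAt_const (x := extChartAt (𝓡 n) p p) (n := ∞)
        (c := EuclideanSpace.basisFun (Fin (m + 1)) ℝ a))
      have h3 := (h2.clm_apply hJa).clm_apply hJa
      exact h3.sub (hτ.clm_apply h3)
    refine hs.congr_of_eventuallyEq ?_
    filter_upwards [(isOpen_extChartAt_target (I := 𝓡 n) p).mem_nhds hx] with x hx
    rw [← meanCurvature_chart hφ p hx hn, smul_smul, one_div_mul_cancel hn', one_smul]
  have h4 := hc.contMDiffAt.comp p (contMDiffAt_chart p (mem_extChartAt_source (I := 𝓡 n) p))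
  refine h4.congr_of_eventuallyEq ?_
  filter_upwards [(isOpen_extChartAt_source (I := 𝓡 n) p).mem_nhds
    (mem_extChartAt_source (I := 𝓡 n) p)] with q hq
  simp only [Function.comp_apply]
  rw [(extChartAt (𝓡 n) p).left_inv hq]

end SecondFundamentalForm

/-! ### The Gauss equation for curvature computed from Christoffel symbols. -/

section Gauss

section Immersion

variable {V F : Type*} [NormedAddCommGroup V] [InnerProductSpace ℝ V] [FiniteDimensional ℝ V]
  [NormedAddCommGroup F] [InnerProductSpace ℝ F] [FiniteDimensional ℝ F]

/-- The tangential part `Γ(b, c)` of the second derivative, in the parameter space. -/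
def tangentialPart (f : V → F) (b c : V) (x : V) : V :=
  leftInv (fderiv ℝ f x) (fderiv ℝ (fderiv ℝ f) x b c)

theorem differentiableAt_tangentialPart {f : V → F} {x : V} (hf : ContDiffAt ℝ ∞ f x)
    (hinj : Function.Injective (fderiv ℝ f x)) (b c : V) :
    DifferentiableAt ℝ (tangentialPart f b c) x := by
  have h1 : ContDiffAt ℝ ∞ (fderiv ℝ f) x := hf.fderiv_right (m := ∞) (by simp)
  have h2 : ContDiffAt ℝ ∞ (fderiv ℝ (fderiv ℝ f)) x := h1.fderiv_right (m := ∞) (by simp)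
  have h3 := (contDiffAt_leftInv h1 hinj).differentiableAt (by simp)
  have h4 := h2.differentiableAt (by simp)
  exact h3.clm_apply ((h4.clm_apply (by fun_prop)).clm_apply (by fun_prop))

/-- The Gauss equation for an immersion into a Euclidean space, in coordinates. -/
theorem gauss_equation_coordinates {f : V → F} {Ω : Set V} (hΩ : IsOpen Ω)
    (hf : ∀ x ∈ Ω, ContDiffAt ℝ ∞ f x) (hinj : ∀ x ∈ Ω, Function.Injective (fderiv ℝ f x))
    {x : V} (hx : x ∈ Ω) (a b c w : V) :
    ⟪fderiv ℝ f x (fderiv ℝ (tangentialPart f b c) x a - fderiv ℝ (tangentialPart f a c) x b +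
        (tangentialPart f a (tangentialPart f b c x) x -
        tangentialPart f b (tangentialPart f a c x) x)), fderiv ℝ f x w⟫ =
      ⟪fderiv ℝ (fderiv ℝ f) x b c - fderiv ℝ f x (tangentialPart f b c x),
        fderiv ℝ (fderiv ℝ f) x a w⟫ -
      ⟪fderiv ℝ (fderiv ℝ f) x a c - fderiv ℝ f x (tangentialPart f a c x),
        fderiv ℝ (fderiv ℝ f) x b w⟫ := by
  have hA : ∀ x ∈ Ω, ContDiffAt ℝ ∞ (fderiv ℝ f) x := fun x hx =>
    (hf x hx).fderiv_right (m := ∞) (by simp)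
  have hA1 : DifferentiableAt ℝ (fderiv ℝ f) x := (hA x hx).differentiableAt (by simp)
  have hS1 : DifferentiableAt ℝ (fderiv ℝ (fderiv ℝ f)) x :=
    ((hA x hx).fderiv_right (m := ∞) (by simp)).differentiableAt (by simp)
  have key : ∀ a b, ⟪fderiv ℝ f x (fderiv ℝ (tangentialPart f b c) x a), fderiv ℝ f x w⟫ +
      ⟪fderiv ℝ f x (tangentialPart f a (tangentialPart f b c x) x), fderiv ℝ f x w⟫ =
      ⟪fderiv ℝ (fun y => fderiv ℝ (fderiv ℝ f) y b c) x a, fderiv ℝ f x w⟫ +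
      ⟪fderiv ℝ (fderiv ℝ f) x b c - fderiv ℝ f x (tangentialPart f b c x),
        fderiv ℝ (fderiv ℝ f) x a w⟫ := by
    intro a b
    have hΓ := differentiableAt_tangentialPart (hf x hx) (hinj x hx) b c
    have hSb : DifferentiableAt ℝ (fun y => fderiv ℝ (fderiv ℝ f) y b c) x :=
      (hS1.clm_apply (by fun_prop)).clm_apply (by fun_prop)
    have hAΓ : DifferentiableAt ℝ (fun y => fderiv ℝ f y (tangentialPart f b c y)) x :=
      hA1.clm_apply hΓ
    have hAw : DifferentiableAt ℝ (fun y => fderiv ℝ f y w) x := hA1.clm_apply (by fun_prop)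
    -- The normal part of the second derivative is orthogonal to df(w); differentiating this along a
    -- produces the identity.
    have hev : (fun y => ⟪fderiv ℝ (fderiv ℝ f) y b c - fderiv ℝ f y (tangentialPart f b c y),
        fderiv ℝ f y w⟫) =ᶠ[𝓝 x] fun _ => (0 : ℝ) := by
      filter_upwards [hΩ.mem_nhds hx] with y hy
      rw [inner_sub_left, tangentialPart, inner_apply_leftInv (hinj y hy), sub_self]
    have h1 := congrArg (fun T : V →L[ℝ] ℝ => T a) hev.fderiv_eq
    rw [fderiv_inner_apply ℝ (hSb.fun_sub hAΓ) hAw, fderiv_fun_sub hSb hAΓ,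
      fderiv_clm_apply hA1 hΓ, fderiv_clm_apply hA1 (by fun_prop)] at h1
    simp only [fderiv_fun_const, Pi.zero_apply, zero_apply, ContinuousLinearMap.comp_zero,
      zero_add, ContinuousLinearMap.flip_apply, sub_apply, add_apply,
      ContinuousLinearMap.comp_apply, inner_sub_left, inner_add_left] at h1
    have h2 : ⟪fderiv ℝ f x (tangentialPart f a (tangentialPart f b c x) x), fderiv ℝ f x w⟫ =
        ⟪fderiv ℝ (fderiv ℝ f) x a (tangentialPart f b c x), fderiv ℝ f x w⟫ := by
      rw [tangentialPart, inner_apply_leftInv (hinj x hx)]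
    rw [h2, inner_sub_left]
    linarith
  -- The third derivatives of f cancel on antisymmetrizing in a and b.
  have hsymm : fderiv ℝ (fun y => fderiv ℝ (fderiv ℝ f) y b c) x a =
      fderiv ℝ (fun y => fderiv ℝ (fderiv ℝ f) y a c) x b := by
    have h := fderiv_fderiv_apply_comm (G := fun y => fderiv ℝ f y c) (x := x)
      ((hA x hx).clm_apply contDiffAt_const) a b
    have he : ∀ b, (fun y => fderiv ℝ (fun y => fderiv ℝ f y c) y b) =ᶠ[𝓝 x]
        fun y => fderiv ℝ (fderiv ℝ f) y b c := fun b => by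
      filter_upwards [hΩ.mem_nhds hx] with y hy
      rw [fderiv_clm_apply ((hA y hy).differentiableAt (by simp)) (by fun_prop)]
      simp
    rwa [(he a).fderiv_eq, (he b).fderiv_eq] at h
  have k1 := key a b
  have k2 := key b a
  rw [hsymm] at k1
  simp only [map_add, map_sub, inner_add_left, inner_sub_left] at k1 k2 ⊢
  linarith

end Immersion

theorem inner_bilin_eq_sum {n : ℕ} {F : Type*} [NormedAddCommGroup F] [InnerProductSpace ℝ F]
    (B C : E n →L[ℝ] E n →L[ℝ] F) (u z v w : E n) :
    ⟪B v w, C u z⟫ = ∑ i, ∑ j, ∑ k, ∑ q, u i * v j * w k * z q *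
      ⟪B (EuclideanSpace.single j 1) (EuclideanSpace.single k 1),
        C (EuclideanSpace.single i 1) (EuclideanSpace.single q 1)⟫ := by
  have hexp : ∀ (B : E n →L[ℝ] E n →L[ℝ] F) (v w : E n), B v w =
      ∑ j, ∑ k, (v j * w k) • B (EuclideanSpace.single j 1) (EuclideanSpace.single k 1) := by
    intro B v w
    have hy : ∀ y : E n, y = ∑ k, y k • EuclideanSpace.single k (1 : ℝ) := fun y => by
      simpa using ((EuclideanSpace.basisFun (Fin n) ℝ).sum_repr y).symm
    conv_lhs => rw [hy v, hy w]
    simp only [map_sum, map_smul, sum_apply, smul_apply, Finset.smul_sum,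
      smul_smul]
    rw [Finset.sum_comm]
    simp_rw [mul_comm]
  rw [hexp B v w, hexp C u z]
  simp only [sum_inner, inner_sum, inner_smul_left, inner_smul_right, conj_trivial, Finset.mul_sum]
  refine Finset.sum_congr rfl fun i _ => ?_
  rw [Finset.sum_comm]
  refine Finset.sum_congr rfl fun j _ => ?_
  rw [Finset.sum_comm]
  exact Finset.sum_congr rfl fun k _ => Finset.sum_congr rfl fun q _ => by ring

variable {n : ℕ} {M : Type*} [TopologicalSpace M] [ChartedSpace (E n) M] [IsManifold (𝓡 n) ∞ M]
variable {m : ℕ} {φ : M → S m}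
variable [RiemannianBundle (fun x : M => TangentSpace (𝓡 n) x)]
variable (hφ : IsIsometricImmersion n φ) (p : M) 
include hφ

theorem metricCoeff_eq {x : E n} (hx : x ∈ (extChartAt (𝓡 n) p).target) (i j : Fin n) :
    metricCoeff p x i j = ⟪fderiv ℝ (chartMap φ p) x (EuclideanSpace.single i 1),
      fderiv ℝ (chartMap φ p) x (EuclideanSpace.single j 1)⟫ := by
  rw [fderiv_chartMap hφ.1 p hx, fderiv_chartMap hφ.1 p hx, hφ.2]
  rfl

theorem metricCoeff_mulVec {x : E n} (hx : x ∈ (extChartAt (𝓡 n) p).target) (y : E n) (l : Fin n) :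
    (metricCoeff p x).mulVec y l = ⟪fderiv ℝ (chartMap φ p) x y,
      fderiv ℝ (chartMap φ p) x (EuclideanSpace.single l 1)⟫ := by
  have hy : y = ∑ k, y k • EuclideanSpace.single k (1 : ℝ) := by
    simpa using ((EuclideanSpace.basisFun (Fin n) ℝ).sum_repr y).symm
  conv_rhs => rw [hy]
  simp only [map_sum, map_smul, sum_inner, inner_smul_left, Matrix.mulVec, dotProduct,
    metricCoeff_eq hφ p hx]
  refine Finset.sum_congr rfl fun k _ => ?_
  rw [real_inner_comm, mul_comm]
  rfl

theorem isUnit_metricCoeff {x : E n} (hx : x ∈ (extChartAt (𝓡 n) p).target) :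
    IsUnit (metricCoeff p x).det := by
  rw [← Matrix.isUnit_iff_isUnit_det, ← Matrix.mulVec_injective_iff_isUnit]
  have h : ∀ z : E n, (metricCoeff p x).mulVec z = 0 → z = 0 := by
    intro z hz
    have h1 : ∀ v : E n, ⟪fderiv ℝ (chartMap φ p) x z, fderiv ℝ (chartMap φ p) x v⟫ = 0 := by
      intro v
      have hv : v = ∑ k, v k • EuclideanSpace.single k (1 : ℝ) := by
        simpa using ((EuclideanSpace.basisFun (Fin n) ℝ).sum_repr v).symm
      rw [hv]
      simp only [map_sum, map_smul, inner_sum, inner_smul_right, ← metricCoeff_mulVec hφ p hx, hz]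
      simp
    exact injective_fderiv_chartMap hφ p hx (by rw [inner_self_eq_zero.mp (h1 z), map_zero])
  intro a b hab
  have := h (WithLp.toLp 2 (a - b)) (by simp [Matrix.mulVec_sub, hab])
  have h2 := congrArg WithLp.ofLp this
  simpa [sub_eq_zero] using h2

/-- Each derivative of the metric is a sum of two products ⟪∂∂f, ∂f⟫. In the Koszul combination four
of the six cancel by symmetry of the Hessian, leaving 2⟪∂ᵢ∂ⱼf, ∂ₗf⟫. -/
theorem christoffel_eq {x : E n} (hx : x ∈ (extChartAt (𝓡 n) p).target) (k i j : Fin n) :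
    christoffel p k i j x = tangentialPart (chartMap φ p) (EuclideanSpace.single i 1)
      (EuclideanSpace.single j 1) x k := by
  have hd : DifferentiableAt ℝ (fderiv ℝ (chartMap φ p)) x :=
    ((contDiffAt_chartMap hφ.1 p hx).fderiv_right (m := ∞) (by simp)).differentiableAt (by simp)
  have hg : ∀ i j l, pderiv i (fun y => metricCoeff p y j l) x =
      ⟪fderiv ℝ (fderiv ℝ (chartMap φ p)) x (EuclideanSpace.single i 1) (EuclideanSpace.single j 1),
        fderiv ℝ (chartMap φ p) x (EuclideanSpace.single l 1)⟫ +
      ⟪fderiv ℝ (fderiv ℝ (chartMap φ p)) x (EuclideanSpace.single i 1) (EuclideanSpace.single l 1),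
        fderiv ℝ (chartMap φ p) x (EuclideanSpace.single j 1)⟫ := by
    intro i j l
    have hev : (fun y => metricCoeff p y j l) =ᶠ[𝓝 x] fun y =>
        ⟪fderiv ℝ (chartMap φ p) y (EuclideanSpace.single j 1),
          fderiv ℝ (chartMap φ p) y (EuclideanSpace.single l 1)⟫ :=
      eventually_of_mem ((isOpen_extChartAt_target p).mem_nhds hx)
        fun y hy => metricCoeff_eq hφ p hy j l
    rw [pderiv, hev.fderiv_eq, fderiv_inner_apply ℝ (hd.clm_apply (by fun_prop))
      (hd.clm_apply (by fun_prop)), fderiv_clm_apply hd (by fun_prop),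
      fderiv_clm_apply hd (by fun_prop)]
    simp only [fderiv_fun_const, Pi.zero_apply, ContinuousLinearMap.comp_zero,
      zero_add, ContinuousLinearMap.flip_apply]
    rw [add_comm, real_inner_comm (fderiv ℝ (chartMap φ p) x (EuclideanSpace.single j 1))]
  have hs : ∀ u v, fderiv ℝ (fderiv ℝ (chartMap φ p)) x u v =
      fderiv ℝ (fderiv ℝ (chartMap φ p)) x v u := fun u v =>
    ((contDiffAt_chartMap hφ.1 p hx).isSymmSndFDerivAt (by simpa using two_le_infty)) u v
  have h1 : ∀ l, pderiv i (fun y => metricCoeff p y j l) x + pderiv j (fun y => metricCoeff p y i l) x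
      - pderiv l (fun y => metricCoeff p y i j) x =
      2 * (metricCoeff p x).mulVec (tangentialPart (chartMap φ p) (EuclideanSpace.single i 1)
      (EuclideanSpace.single j 1) x).ofLp l := by
    intro l
    rw [metricCoeff_mulVec hφ p hx, tangentialPart,
      inner_apply_leftInv (injective_fderiv_chartMap hφ p hx), hg, hg, hg,
      hs (EuclideanSpace.single j 1) (EuclideanSpace.single i 1),
      hs (EuclideanSpace.single l 1) (EuclideanSpace.single i 1),
      hs (EuclideanSpace.single l 1) (EuclideanSpace.single j 1)]
    ring
  set y := tangentialPart (chartMap φ p) (EuclideanSpace.single i 1) (EuclideanSpace.single j 1) x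
  rw [christoffel]
  simp_rw [h1]
  have h2 : (metricCoeff p x)⁻¹.mulVec ((metricCoeff p x).mulVec y) k = y k := by
    rw [Matrix.mulVec_mulVec, Matrix.nonsing_inv_mul _ (isUnit_metricCoeff hφ p hx),
      Matrix.one_mulVec]
  rw [← h2, Matrix.mulVec, dotProduct, Finset.mul_sum]
  exact Finset.sum_congr rfl fun l _ => by ring

theorem riemannCoeff_eq (l i j k : Fin n) :
    riemannCoeff p l i j k (extChartAt (𝓡 n) p p) =
    (fderiv ℝ (tangentialPart (chartMap φ p) (EuclideanSpace.single j 1)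
        (EuclideanSpace.single k 1)) (extChartAt (𝓡 n) p p) (EuclideanSpace.single i 1) -
      fderiv ℝ (tangentialPart (chartMap φ p) (EuclideanSpace.single i 1)
        (EuclideanSpace.single k 1)) (extChartAt (𝓡 n) p p) (EuclideanSpace.single j 1) +
      (tangentialPart (chartMap φ p) (EuclideanSpace.single i 1)
        (tangentialPart (chartMap φ p) (EuclideanSpace.single j 1) (EuclideanSpace.single k 1)
          (extChartAt (𝓡 n) p p)) (extChartAt (𝓡 n) p p) -
      tangentialPart (chartMap φ p) (EuclideanSpace.single j 1)
        (tangentialPart (chartMap φ p) (EuclideanSpace.single i 1) (EuclideanSpace.single k 1)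
          (extChartAt (𝓡 n) p p)) (extChartAt (𝓡 n) p p))) l := by
  have hx := mem_extChartAt_target (I := 𝓡 n) p
  set x := extChartAt (𝓡 n) p p
  have hd : ∀ i j k : Fin n, pderiv i (christoffel p l j k) x =
      fderiv ℝ (tangentialPart (chartMap φ p) (EuclideanSpace.single j 1)
        (EuclideanSpace.single k 1)) x (EuclideanSpace.single i 1) l := by
    intro i j k
    have hev : christoffel p l j k =ᶠ[𝓝 x] fun y =>
        EuclideanSpace.proj (𝕜 := ℝ) l (tangentialPart (chartMap φ p) (EuclideanSpace.single j 1)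
        (EuclideanSpace.single k 1) y) :=
      eventually_of_mem ((isOpen_extChartAt_target p).mem_nhds hx)
        fun y hy => christoffel_eq hφ p hy l j k
    have hΓ := differentiableAt_tangentialPart (contDiffAt_chartMap hφ.1 p hx)
      (injective_fderiv_chartMap hφ p hx) (EuclideanSpace.single j 1) (EuclideanSpace.single k 1)
    rw [pderiv, hev.fderiv_eq]
    have := ((EuclideanSpace.proj (𝕜 := ℝ) l).hasFDerivAt.comp x hΓ.hasFDerivAt).fderiv
    exact congrArg (fun T : E n →L[ℝ] ℝ => T (EuclideanSpace.single i 1)) this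
  have hq : ∀ (i : Fin n) (y : E n), tangentialPart (chartMap φ p) (EuclideanSpace.single i 1) y x l =
      ∑ s, y s * christoffel p l i s x := by
    intro i y
    have hy : y = ∑ k, y k • EuclideanSpace.single k (1 : ℝ) := by
      simpa using ((EuclideanSpace.basisFun (Fin n) ℝ).sum_repr y).symm
    conv_lhs => rw [hy]
    simp only [christoffel_eq hφ p hx, tangentialPart, map_sum, map_smul]
    simp
  rw [riemannCoeff, hd, hd, Finset.sum_sub_distrib]
  simp only [PiLp.add_apply, PiLp.sub_apply, hq]
  simp only [christoffel_eq hφ p hx]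

theorem curvature_eq_second (u v w z : TangentSpace (𝓡 n) p) :
    curvature p u v w z =
    ⟪fderiv ℝ (fderiv ℝ (chartMap φ p)) (extChartAt (𝓡 n) p p) (coords p v) (coords p w) -
      fderiv ℝ (chartMap φ p) (extChartAt (𝓡 n) p p)
        (tangentialPart (chartMap φ p) (coords p v) (coords p w) (extChartAt (𝓡 n) p p)),
      fderiv ℝ (fderiv ℝ (chartMap φ p)) (extChartAt (𝓡 n) p p) (coords p u) (coords p z)⟫ -
    ⟪fderiv ℝ (fderiv ℝ (chartMap φ p)) (extChartAt (𝓡 n) p p) (coords p u) (coords p w) -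
      fderiv ℝ (chartMap φ p) (extChartAt (𝓡 n) p p)
        (tangentialPart (chartMap φ p) (coords p u) (coords p w) (extChartAt (𝓡 n) p p)),
      fderiv ℝ (fderiv ℝ (chartMap φ p)) (extChartAt (𝓡 n) p p) (coords p v) (coords p z)⟫ := by
  have hx := mem_extChartAt_target (I := 𝓡 n) p
  let N : E n →L[ℝ] E n →L[ℝ] E (m + 1) := fderiv ℝ (fderiv ℝ (chartMap φ p)) (extChartAt (𝓡 n) p p)
    - (ContinuousLinearMap.compL ℝ (E n) (E (m + 1)) (E (m + 1))
      (fderiv ℝ (chartMap φ p) (extChartAt (𝓡 n) p p) ∘L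
        leftInv (fderiv ℝ (chartMap φ p) (extChartAt (𝓡 n) p p)))) ∘L
      fderiv ℝ (fderiv ℝ (chartMap φ p)) (extChartAt (𝓡 n) p p)
  have hcoef : ∀ i j k q : Fin n, ∑ l, riemannCoeff p l i j k (extChartAt (𝓡 n) p p) *
      metricCoeff p (extChartAt (𝓡 n) p p) l q =
    ⟪N (EuclideanSpace.single j 1) (EuclideanSpace.single k 1),
      fderiv ℝ (fderiv ℝ (chartMap φ p)) (extChartAt (𝓡 n) p p) (EuclideanSpace.single i 1)
        (EuclideanSpace.single q 1)⟫ -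
    ⟪N (EuclideanSpace.single i 1) (EuclideanSpace.single k 1),
      fderiv ℝ (fderiv ℝ (chartMap φ p)) (extChartAt (𝓡 n) p p) (EuclideanSpace.single j 1)
        (EuclideanSpace.single q 1)⟫ := by
    intro i j k q
    refine Eq.trans ?_ (gauss_equation_coordinates (isOpen_extChartAt_target p)
      (fun y hy => contDiffAt_chartMap hφ.1 p hy) (fun y hy => injective_fderiv_chartMap hφ p hy) hx
      _ _ _ _)
    rw [← metricCoeff_mulVec hφ p hx, Matrix.mulVec, dotProduct]
    refine Finset.sum_congr rfl fun l _ => ?_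
    rw [riemannCoeff_eq hφ, metricCoeff_eq hφ p hx, metricCoeff_eq hφ p hx, real_inner_comm, mul_comm]
  have h1 := inner_bilin_eq_sum N (fderiv ℝ (fderiv ℝ (chartMap φ p)) (extChartAt (𝓡 n) p p))
    (coords p u) (coords p z) (coords p v) (coords p w)
  have h2 := inner_bilin_eq_sum N (fderiv ℝ (fderiv ℝ (chartMap φ p)) (extChartAt (𝓡 n) p p))
    (coords p v) (coords p z) (coords p u) (coords p w)
  refine Eq.trans ?_ (congrArg₂ (· - ·) h1 h2).symm
  -- The second inner product has u and v interchanged; swapping its outer sums aligns the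
  -- coefficients.
  rw [Finset.sum_comm (f := fun i j => ∑ k, ∑ q, coords p v i * coords p u j * coords p w k *
    coords p z q * ⟪N (EuclideanSpace.single j 1) (EuclideanSpace.single k 1),
      fderiv ℝ (fderiv ℝ (chartMap φ p)) (extChartAt (𝓡 n) p p) (EuclideanSpace.single i 1)
        (EuclideanSpace.single q 1)⟫)]
  simp only [← Finset.sum_sub_distrib]
  refine Finset.sum_congr rfl fun i _ => Finset.sum_congr rfl fun j _ => Finset.sum_congr rfl
    fun k _ => Finset.sum_congr rfl fun q _ => ?_
  rw [hcoef]
  ring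

theorem differential_eq_coords (v : TangentSpace (𝓡 n) p) :
    differential n φ p v = fderiv ℝ (chartMap φ p) (extChartAt (𝓡 n) p p) (coords p v) := by
  have hx := mem_extChartAt_target (I := 𝓡 n) p
  have hd := (contDiffAt_chartMap hφ.1 p hx).differentiableAt (by simp)
  have hev : (fun q => (φ q : E (m + 1))) =ᶠ[𝓝 p] chartMap φ p ∘ extChartAt (𝓡 n) p := by
    filter_upwards [(isOpen_extChartAt_source (I := 𝓡 n) p).mem_nhds
      (mem_extChartAt_source (I := 𝓡 n) p)] with q hq
    simp only [Function.comp_apply, chartMap]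
    rw [(extChartAt (𝓡 n) p).left_inv hq]
  have h1 := mfderiv_comp p hd.mdifferentiableAt
    ((contMDiffAt_chart p (mem_extChartAt_source (I := 𝓡 n) p)).mdifferentiableAt (by simp))
  rw [mfderiv_eq_fderiv, ← hev.mfderiv_eq] at h1
  exact congrArg (fun T : TangentSpace (𝓡 n) p →L[ℝ] E (m + 1) => T v) h1

theorem secondFundamentalForm_eq (u v : TangentSpace (𝓡 n) p) :
    secondFundamentalForm n φ p u v =
      fderiv ℝ (fderiv ℝ (chartMap φ p)) (extChartAt (𝓡 n) p p) (coords p u) (coords p v) -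
      oscProj φ p (extChartAt (𝓡 n) p p)
        (fderiv ℝ (fderiv ℝ (chartMap φ p)) (extChartAt (𝓡 n) p p) (coords p u) (coords p v)) := by
  have h := starProjection_normalSpace hφ p (mem_extChartAt_target (I := 𝓡 n) p)
  rw [extChartAt_to_inv] at h
  exact h _

theorem secondFundamentalForm_symm (u v : TangentSpace (𝓡 n) p) :
    secondFundamentalForm n φ p u v = secondFundamentalForm n φ p v u := by
  have hs := ((contDiffAt_chartMap hφ.1 p (mem_extChartAt_target (I := 𝓡 n) p)).isSymmSndFDerivAt
    (by simpa using two_le_infty)) (coords p u) (coords p v)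
  rw [secondFundamentalForm_eq hφ, secondFundamentalForm_eq hφ, hs]

/-- The Gauss equation. -/
theorem curvature_eq (u v : TangentSpace (𝓡 n) p) :
    curvature p u v v u = ⟪secondFundamentalForm n φ p u u, secondFundamentalForm n φ p v v⟫ -
      ‖secondFundamentalForm n φ p u v‖ ^ 2 + (⟪u, u⟫ * ⟪v, v⟫ - ⟪u, v⟫ ^ 2) := by
  have hx := mem_extChartAt_target (I := 𝓡 n) p
  rw [curvature_eq_second hφ, ← hφ.2 p u u, ← hφ.2 p v v, ← hφ.2 p u v]
  simp only [differential_eq_coords hφ, ← real_inner_self_eq_norm_sq]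
  have hs := (contDiffAt_chartMap hφ.1 p hx).isSymmSndFDerivAt (by simpa using two_le_infty)
  rw [hs.eq (coords p v) (coords p u)]
  simp only [secondFundamentalForm_eq hφ]
  set x := extChartAt (𝓡 n) p p
  generalize coords p u = a
  generalize coords p v = b
  set S := fderiv ℝ (fderiv ℝ (chartMap φ p)) x
  -- The normal part in Euclidean space is the normal part in the sphere plus a multiple of the
  -- position vector; the latter produces the term ⟪u, u⟫⟪v, v⟫ - ⟪u, v⟫².
  have hN : ∀ a b, S a b - fderiv ℝ (chartMap φ p) x (tangentialPart (chartMap φ p) a b x) =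
      S a b - oscProj φ p x (S a b) -
        ⟪fderiv ℝ (chartMap φ p) x a, fderiv ℝ (chartMap φ p) x b⟫ • chartMap φ p x := by
    intro a b
    rw [oscProj_apply, inner_chartMap_second hφ.1 p hx, tangentialPart, neg_smul]
    abel
  have hortho : ∀ w z, ⟪w - oscProj φ p x w, oscProj φ p x z⟫ = 0 := by
    intro w z
    rw [← oscProj_symm hφ p hx, map_sub, oscProj_idem hφ p hx, sub_self, inner_zero_left]
  have hfS : ∀ a b, ⟪chartMap φ p x, S a b⟫ =
      -⟪fderiv ℝ (chartMap φ p) x a, fderiv ℝ (chartMap φ p) x b⟫ := inner_chartMap_second hφ.1 p hx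
  have hh : ∀ w z, ⟪w - oscProj φ p x w, z⟫ = ⟪w - oscProj φ p x w, z - oscProj φ p x z⟫ := by
    intro w z
    rw [inner_sub_right, hortho, sub_zero]
  rw [hN, hN]
  rw [inner_sub_left (S b b - _), inner_sub_left (S a b - _), hh, hh (S a b), inner_smul_left,
    inner_smul_left, hfS, hfS, real_inner_comm (S b b - _)]
  simp
  ring

end Gauss

/-! ### The pointwise algebra combined. -/

section Abstract

variable {V F : Type*} [NormedAddCommGroup V] [InnerProductSpace ℝ V] [FiniteDimensional ℝ V]
  [NormedAddCommGroup F] [InnerProductSpace ℝ F]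

/-- The equality case of Chen's inequality for a second fundamental form all of whose scalar
components have rank at most two. -/
theorem eq_zero_or_rank_two_of_delta_eq {n k : ℕ} {ν : Fin k → ℕ} {ι : Type*} [Fintype ι]
    (hdim : Module.finrank ℝ V = n) (hn : n ≠ 0)
    (hν : ν ∈ admissibleTuples n k) (h : V →ₗ[ℝ] V →ₗ[ℝ] F)
    (hs : ∀ u v, h u v = h v u) (N : Submodule ℝ F) (hN : ∀ u v, h u v ∈ N)
    (hdet : ∀ ξ ∈ N, ∀ x y : Fin 3 → V, (Matrix.of fun i j => ⟪h (x i) (y j), ξ⟫).det = 0)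
    (τ : Submodule ℝ V → ℝ)
    (hτ : ∀ (L : Submodule ℝ V) (s : ℕ) (b : OrthonormalBasis (Fin s) ℝ L),
      τ L = extrinsicScalar h (fun i => (b i : V)) + (s : ℝ) * (s - 1) / 2)
    (b : OrthonormalBasis ι ℝ V) {H : F} (hH : H = (1 / (n : ℝ)) • ∑ i, h (b i) (b i))
    (hdelta : τ ⊤ - sInf {t : ℝ | ∃ L : Fin k → Submodule ℝ V,
        (∀ j, Module.finrank ℝ (L j) = ν j) ∧ (Pairwise fun i j => L i ⟂ L j) ∧
        t = ∑ j, τ (L j)} =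
      ((n : ℝ) ^ 2 * (n + k - 1 - ∑ j, (ν j : ℝ))) / (2 * (n + k - ∑ j, (ν j : ℝ))) * ‖H‖ ^ 2
      + (1 / 2) * ((n : ℝ) * (n - 1) - ∑ j, (ν j : ℝ) * (ν j - 1))) :
    H = 0 ∨ ∃ u₁ u₂ : V, ‖u₁‖ = 1 ∧ ‖u₂‖ = 1 ∧ ⟪u₁, u₂⟫ = 0 ∧
      ∀ v w, h v w = (⟪u₁, v⟫ * ⟪u₁, w⟫ + ⟪u₂, v⟫ * ⟪u₂, w⟫) • ((n : ℝ) / 2) • H := by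
  obtain ⟨hk, hν2, hνn⟩ := hν
  set r := n - ∑ j, ν j with hr
  have hnr : n = ∑ j, ν j + r := by omega
  have hnr' : (n : ℝ) = ∑ j, (ν j : ℝ) + r := by exact_mod_cast hnr
  have hn' : (n : ℝ) ≠ 0 := by exact_mod_cast hn
  obtain ⟨e, he⟩ := exists_orthonormalBasis_sInf_eq (ν := ν) (r := r) (hdim.trans hnr) h τ hτ
  have hH' : (n : ℝ) • H = ∑ i, h (e i) (e i) := by
    rw [hH, smul_smul, mul_one_div_cancel hn', one_smul]
    exact sum_bilin_orthonormalBasis _ e h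
  have hHn : (n : ℝ) ^ 2 * ‖H‖ ^ 2 = ‖∑ i, h (e i) (e i)‖ ^ 2 := by
    rw [← hH', norm_smul, mul_pow, Real.norm_natCast]
  have htop : τ ⊤ = extrinsicScalar h e + (n : ℝ) * (n - 1) / 2 := by
    let e' := (e.reindex (Fintype.equivOfCardEq (by simp [← hnr]) : _ ≃ Fin n)).map
      (LinearIsometryEquiv.ofTop V ⊤ rfl).symm
    rw [hτ ⊤ n e', extrinsicScalar_eq h e' (e.map (LinearIsometryEquiv.ofTop V ⊤ rfl).symm)]
    rfl
  rw [he] at hdelta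
  obtain ⟨hcross, htr⟩ := block_structure_of_delta_eq (r := r) hk h e _ htop (by
    rw [hdelta]
    have h1 : (n : ℝ) + k - ∑ j, (ν j : ℝ) = k + r := by rw [hnr']; ring
    have h2 : (n : ℝ) + k - 1 - ∑ j, (ν j : ℝ) = k + r - 1 := by rw [hnr']; ring
    rw [h1, h2, ← hHn]
    ring)
  by_cases h0 : H = 0
  · exact Or.inl h0
  refine Or.inr ?_
  -- A single block is excluded by n_j < n: for k = 1 at least one vector is left over.
  have hkr : 2 ≤ k + r := by
    rcases Nat.lt_or_ge k 2 with hk2 | hk2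
    · obtain rfl : k = 1 := by omega
      have := (hν2 0).2
      simp only [Fin.sum_univ_one, Fin.isValue] at hnr
      omega
    · omega
  have hkr' : (0 : ℝ) < (k : ℝ) + r := by exact_mod_cast (by omega : 0 < k + r)
  have hT : (1 / ((k : ℝ) + r)) • ∑ i, h (e i) (e i) ≠ 0 := by
    rw [← hH']
    exact smul_ne_zero (by positivity) (smul_ne_zero hn' h0)
  obtain ⟨hcard, u₁, u₂, h1, h2, h12, hform⟩ := rank_two_structure e (block ν r) h
    hs N hN hdet hcross _ hT htr (by simpa using hkr)
  refine ⟨u₁, u₂, h1, h2, h12, fun v w => ?_⟩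
  -- With exactly two blocks each block trace is half of nH.
  have hc : (k : ℝ) + r = 2 := by
    simp at hcard
    exact_mod_cast hcard
  rw [hform, ← hH', hc, smul_smul (1 / 2 : ℝ), one_div_mul_eq_div]

end Abstract

/-! ### The second fundamental form at a point of the submanifold. -/

section Pointwise

variable {n : ℕ} {M : Type*} [TopologicalSpace M] [ChartedSpace (E n) M] [IsManifold (𝓡 n) ∞ M]
variable {m : ℕ} {φ : M → S m}
variable [RiemannianBundle (fun x : M => TangentSpace (𝓡 n) x)]
variable (hφ : IsIsometricImmersion n φ) (p : M)

theorem finrank_tangentSpace : Module.finrank ℝ (TangentSpace (𝓡 n) p) = n :=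
  finrank_euclideanSpace_fin (𝕜 := ℝ) (n := n)

include hφ

/-- On an orthonormal pair the Gauss equation turns the sectional curvature into the summand of
`sum_Ioi_extrinsic`; an arbitrary basis is then admissible by `extrinsicScalar_eq`. -/
theorem scalarCurvature_eq (L : Submodule ℝ (TangentSpace (𝓡 n) p)) (s : ℕ)
    (b : OrthonormalBasis (Fin s) ℝ L) :
    scalarCurvature p L = extrinsicScalar (secondFundamentalForm n φ p)
      (fun i => (b i : TangentSpace (𝓡 n) p)) + (s : ℝ) * (s - 1) / 2 := by
  have hs : s = Module.finrank ℝ L := by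
    rw [Module.finrank_eq_card_basis b.toBasis, Fintype.card_fin]
  rw [extrinsicScalar_eq _ b (stdOrthonormalBasis ℝ L), hs,
    ← sum_Ioi_extrinsic _ (secondFundamentalForm_symm hφ p), scalarCurvature]
  refine Finset.sum_congr rfl fun α _ => Finset.sum_congr rfl fun β hβ => ?_
  have hne : α ≠ β := (Finset.mem_Ioi.mp hβ).ne
  have ho := orthonormal_iff_ite.mp (stdOrthonormalBasis ℝ L).orthonormal
  have h1 : ⟪(stdOrthonormalBasis ℝ L α : TangentSpace (𝓡 n) p),
      (stdOrthonormalBasis ℝ L α : TangentSpace (𝓡 n) p)⟫ = (1 : ℝ) := by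
    rw [← Submodule.coe_inner, ho, if_pos rfl]
  have h2 : ⟪(stdOrthonormalBasis ℝ L β : TangentSpace (𝓡 n) p),
      (stdOrthonormalBasis ℝ L β : TangentSpace (𝓡 n) p)⟫ = (1 : ℝ) := by
    rw [← Submodule.coe_inner, ho, if_pos rfl]
  have h3 : ⟪(stdOrthonormalBasis ℝ L α : TangentSpace (𝓡 n) p),
      (stdOrthonormalBasis ℝ L β : TangentSpace (𝓡 n) p)⟫ = (0 : ℝ) := by
    rw [← Submodule.coe_inner, ho, if_neg hne]
  rw [sectionalCurvature, curvature_eq hφ, h1, h2, h3]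
  ring

theorem shapeOperator_isSymmetric (ξ : E (m + 1)) : (shapeOperator n φ p ξ).IsSymmetric := by
  intro v w
  rw [inner_shapeOperator, secondFundamentalForm_symm hφ, ← inner_shapeOperator]
  exact real_inner_comm _ _

/-- The type number bound concerns unit normals. Minors are homogeneous in ξ, so they vanish on the
whole normal space, which is linear and hence allows the perturbation ξ + tT. -/
theorem det_secondFundamentalForm (htype : TypeNumberLE n φ 2) {ξ : E (m + 1)}
    (hξ : ξ ∈ normalSpace n φ p) (x y : Fin 3 → TangentSpace (𝓡 n) p) :
    (Matrix.of fun i j => ⟪secondFundamentalForm n φ p (x i) (y j), ξ⟫).det = 0 := by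
  by_cases h0 : ξ = 0
  · subst h0
    simp only [inner_zero_right]
    exact Matrix.det_zero
  · have hn : ‖ξ‖ ≠ 0 := norm_ne_zero_iff.mpr h0
    have h1 := det_inner_eq_zero_of_card_roots_le
      (shapeOperator_isSymmetric hφ p (‖ξ‖⁻¹ • ξ)) (htype p (‖ξ‖⁻¹ • ξ)
      ((normalSpace n φ p).smul_mem _ hξ) (by rw [norm_smul, norm_inv, norm_norm,
        inv_mul_cancel₀ hn])) x y
    have h2 : (Matrix.of fun i j => ⟪secondFundamentalForm n φ p (x i) (y j), ξ⟫) =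
        ‖ξ‖ • Matrix.of fun i j => ⟪shapeOperator n φ p (‖ξ‖⁻¹ • ξ) (x i), y j⟫ := by
      ext i j
      simp only [Matrix.of_apply, Matrix.smul_apply, inner_shapeOperator, inner_smul_right,
        smul_eq_mul]
      rw [mul_inv_cancel_left₀ hn]
    rw [h2, Matrix.det_smul, h1, mul_zero]

theorem secondFundamentalForm_mem (u v : TangentSpace (𝓡 n) p) :
    secondFundamentalForm n φ p u v ∈ normalSpace n φ p :=
  Submodule.starProjection_apply_mem _ _

/-- At a point of an ideal submanifold of type number at most two, the mean curvature vector
vanishes, or the second fundamental form is that of a cylinder over an umbilical surface. -/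
theorem meanCurvature_eq_zero_or_rank_two (hn : n ≠ 0) {k : ℕ} {ν : Fin k → ℕ}
    (hν : ν ∈ admissibleTuples n k) (hideal : IsDeltaIdeal n ν φ) (htype : TypeNumberLE n φ 2) :
    meanCurvature n φ p = 0 ∨ ∃ u₁ u₂ : TangentSpace (𝓡 n) p, ‖u₁‖ = 1 ∧ ‖u₂‖ = 1 ∧
      ⟪u₁, u₂⟫ = (0 : ℝ) ∧ ∀ v w, secondFundamentalForm n φ p v w =
        (⟪u₁, v⟫ * ⟪u₁, w⟫ + ⟪u₂, v⟫ * ⟪u₂, w⟫) • ((n : ℝ) / 2) • meanCurvature n φ p := by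
  have h1 := hideal p
  have h2 : meanCurvature n φ p = (1 / (n : ℝ)) • ∑ i, secondFundamentalForm n φ p
    (stdOrthonormalBasis ℝ (TangentSpace (𝓡 n) p) i)
    (stdOrthonormalBasis ℝ (TangentSpace (𝓡 n) p) i) := rfl
  rw [deltaInvariant] at h1
  have h3 := secondFundamentalForm_symm hφ p
  have h4 := secondFundamentalForm_mem hφ p
  have h5 := fun ξ hξ x y => det_secondFundamentalForm hφ p htype (ξ := ξ) hξ x y
  have h6 := scalarCurvature_eq hφ p
  have h7 : Module.finrank ℝ (TangentSpace (𝓡 n) p) = n := finrank_tangentSpace p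
  generalize meanCurvature n φ p = H at *
  generalize secondFundamentalForm n φ p = h at *
  generalize normalSpace n φ p = N at *
  generalize (scalarCurvature p : Submodule ℝ (TangentSpace (𝓡 n) p) → ℝ) = τ at *
  exact eq_zero_or_rank_two_of_delta_eq h7 hn hν h h3 N h4 h5 τ h6
    (stdOrthonormalBasis ℝ (TangentSpace (𝓡 n) p)) h2 h1

end Pointwise

/-- The coefficients are (⟪e₂, w⟫, -⟪e₁, w⟫), normalized; if both vanish, e₁ itself serves. This
provides `P_two` for the principal plane. -/
theorem exists_unit_combination_orthogonal {F : Type*} [NormedAddCommGroup F]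
    [InnerProductSpace ℝ F] (e₁ e₂ w : F) :
    ∃ s t : ℝ, s ^ 2 + t ^ 2 = 1 ∧ ⟪s • e₁ + t • e₂, w⟫ = (0 : ℝ) := by
  by_cases h0 : (⟪e₁, w⟫ : ℝ) ^ 2 + (⟪e₂, w⟫ : ℝ) ^ 2 = 0
  · refine ⟨1, 0, by norm_num, ?_⟩
    have : (⟪e₁, w⟫ : ℝ) = 0 := by nlinarith [sq_nonneg (⟪e₁, w⟫ : ℝ), sq_nonneg (⟪e₂, w⟫ : ℝ)]
    simp [this]
  · have hpos : 0 < (⟪e₁, w⟫ : ℝ) ^ 2 + (⟪e₂, w⟫ : ℝ) ^ 2 := lt_of_le_of_ne (by positivity) (Ne.symm h0)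
    have hs := Real.sq_sqrt hpos.le
    have hs0 := (Real.sqrt_pos.mpr hpos).ne'
    refine ⟨⟪e₂, w⟫ / √((⟪e₁, w⟫ : ℝ) ^ 2 + (⟪e₂, w⟫ : ℝ) ^ 2),
      -⟪e₁, w⟫ / √((⟪e₁, w⟫ : ℝ) ^ 2 + (⟪e₂, w⟫ : ℝ) ^ 2), ?_, ?_⟩
    · rw [div_pow, div_pow, hs, ← add_div, neg_sq, add_comm, div_self h0]
    · simp only [inner_add_left, inner_smul_left, conj_trivial]
      ring

/-! ### Smooth data of the rank-two structure in a chart. -/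

section RankTwoCharts

variable (n : ℕ) {M : Type*} [TopologicalSpace M] [ChartedSpace (E n) M]
variable {m : ℕ} (φ : M → S m)
variable [RiemannianBundle (fun x : M => TangentSpace (𝓡 n) x)]

/-- The common value of the second fundamental form on the unit vectors of the principal plane. -/
def principalNormal (q : M) : E (m + 1) := ((n : ℝ) / 2) • meanCurvature n φ q

def principalCurvature (q : M) : ℝ := ‖principalNormal n φ q‖

/-- Zero where the principal normal vanishes, by the convention 0⁻¹ = 0; a unit vector elsewhere. -/
def unitNormal (q : M) : E (m + 1) := (principalCurvature n φ q)⁻¹ • principalNormal n φ q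

/-- `u₁, u₂` is an orthonormal basis of the plane carrying the second fundamental form. -/
def IsPrincipalPair (q : M) (u₁ u₂ : TangentSpace (𝓡 n) q) : Prop :=
  ‖u₁‖ = 1 ∧ ‖u₂‖ = 1 ∧ ⟪u₁, u₂⟫ = (0 : ℝ) ∧ ∀ v w, secondFundamentalForm n φ q v w =
    (⟪u₁, v⟫ * ⟪u₁, w⟫ + ⟪u₂, v⟫ * ⟪u₂, w⟫) • principalNormal n φ q

/-- The projection onto the image of the principal plane, in the chart at `p`. -/
def planeProj (p : M) (x : E n) : E (m + 1) →L[ℝ] E (m + 1) :=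
  ∑ a, ((principalCurvature n φ ((extChartAt (𝓡 n) p).symm x) ^ 2)⁻¹ •
    ((innerSL ℝ (principalNormal n φ ((extChartAt (𝓡 n) p).symm x))) ∘L
      (fderiv ℝ (fderiv ℝ (chartMap φ p)) x
        (leftInv (fderiv ℝ (chartMap φ p) x) (EuclideanSpace.basisFun (Fin (m + 1)) ℝ a))) ∘L
      leftInv (fderiv ℝ (chartMap φ p) x))).smulRight (EuclideanSpace.basisFun (Fin (m + 1)) ℝ a)

/-- The image under `dφ` of the gradient of the logarithm of the principal curvature, in the chart
at `p`. -/
def logGradient (p : M) (x : E n) : E (m + 1) :=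
  ∑ a, ((principalCurvature n φ ((extChartAt (𝓡 n) p).symm x))⁻¹ *
    fderiv ℝ (fun y => principalCurvature n φ ((extChartAt (𝓡 n) p).symm y)) x
      (leftInv (fderiv ℝ (chartMap φ p) x) (EuclideanSpace.basisFun (Fin (m + 1)) ℝ a))) •
    EuclideanSpace.basisFun (Fin (m + 1)) ℝ a

variable {n φ}

theorem inner_logGradient (p : M) (x : E n) (w : E (m + 1)) :
    ⟪logGradient n φ p x, w⟫ = (principalCurvature n φ ((extChartAt (𝓡 n) p).symm x))⁻¹ *
      fderiv ℝ (fun y => principalCurvature n φ ((extChartAt (𝓡 n) p).symm y)) x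
        (leftInv (fderiv ℝ (chartMap φ p) x) w) := by
  conv_rhs => rw [← (EuclideanSpace.basisFun (Fin (m + 1)) ℝ).sum_repr' w]
  simp only [logGradient, sum_inner, inner_smul_left, map_sum, map_smul, smul_eq_mul,
    Finset.mul_sum, conj_trivial]
  refine Finset.sum_congr rfl fun a _ => ?_
  ring

theorem principalCurvature_pos {q : M} (hq : principalNormal n φ q ≠ 0) :
    0 < principalCurvature n φ q := norm_pos_iff.mpr hq

theorem principalCurvature_smul_unitNormal {q : M} (hq : principalNormal n φ q ≠ 0) :
    principalCurvature n φ q • unitNormal n φ q = principalNormal n φ q := by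
  rw [unitNormal, smul_smul, mul_inv_cancel₀ (principalCurvature_pos hq).ne', one_smul]

theorem inner_unitNormal_self {q : M} (hq : principalNormal n φ q ≠ 0) :
    ⟪unitNormal n φ q, unitNormal n φ q⟫ = (1 : ℝ) := by
  have h := (principalCurvature_pos hq).ne'
  rw [unitNormal, inner_smul_left, inner_smul_right, real_inner_self_eq_norm_sq,
    ← principalCurvature, conj_trivial]
  field_simp

variable [IsManifold (𝓡 n) ∞ M]
variable (hφ : IsIsometricImmersion n φ)
include hφ

theorem contMDiff_principalNormal (hn : n ≠ 0) :
    ContMDiff (𝓡 n) 𝓘(ℝ, E (m + 1)) ∞ (principalNormal n φ) := by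
  have := (contMDiff_const (I := 𝓡 n) (I' := 𝓘(ℝ, ℝ)) (M := M) (n := ∞) (c := (n : ℝ) / 2)).smul
    (contMDiff_meanCurvature hφ hn)
  exact this

theorem contMDiffAt_principalCurvature (hn : n ≠ 0) {q : M} (hq : principalNormal n φ q ≠ 0) :
    ContMDiffAt (𝓡 n) 𝓘(ℝ, ℝ) ∞ (principalCurvature n φ) q :=
  (contDiffAt_norm ℝ hq).contMDiffAt.comp q (contMDiff_principalNormal hφ hn q)

theorem contMDiffAt_unitNormal (hn : n ≠ 0) {q : M} (hq : principalNormal n φ q ≠ 0) :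
    ContMDiffAt (𝓡 n) 𝓘(ℝ, E (m + 1)) ∞ (unitNormal n φ) q :=
  ((contMDiffAt_principalCurvature hφ hn hq).inv₀ (principalCurvature_pos hq).ne').smul
    (contMDiff_principalNormal hφ hn q)

theorem principalNormal_mem (q : M) : principalNormal n φ q ∈ normalSpace n φ q :=
  Submodule.smul_mem _ _ (Submodule.smul_mem _ _
    (Submodule.sum_mem _ fun _ _ => secondFundamentalForm_mem hφ q _ _))

theorem unitNormal_mem (q : M) : unitNormal n φ q ∈ normalSpace n φ q :=
  Submodule.smul_mem _ _ (principalNormal_mem hφ q)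

variable (p : M) {x : E n} (hx : x ∈ (extChartAt (𝓡 n) p).target)
include hx

theorem inner_second_of_mem_normalSpace {η : E (m + 1)}
    (hη : η ∈ normalSpace n φ ((extChartAt (𝓡 n) p).symm x)) (u v : E n) :
    ⟪η, fderiv ℝ (fderiv ℝ (chartMap φ p)) x u v⟫ =
    ⟪η, secondFundamentalForm n φ ((extChartAt (𝓡 n) p).symm x)
      (mfderiv 𝓘(ℝ, E n) (𝓡 n) (extChartAt (𝓡 n) p).symm x u)
      (mfderiv 𝓘(ℝ, E n) (𝓡 n) (extChartAt (𝓡 n) p).symm x v)⟫ := by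
  rw [secondFundamentalForm_chart hφ p hx, inner_sub_right, ← oscProj_symm hφ p hx,
    (mem_normalSpace_iff hφ p hx η).mp hη, inner_zero_left, sub_zero]

theorem inner_mfderiv_leftInv (w : E (m + 1))
    (u : TangentSpace (𝓡 n) ((extChartAt (𝓡 n) p).symm x)) :
    ⟪u, mfderiv 𝓘(ℝ, E n) (𝓡 n) (extChartAt (𝓡 n) p).symm x
      (leftInv (fderiv ℝ (chartMap φ p) x) w)⟫ = ⟪differential n φ _ u, w⟫ := by
  obtain ⟨v', hv'⟩ := (range_fderiv_chartMap hφ.1 p hx _).mp ⟨u, rfl⟩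
  rw [← hφ.2, ← fderiv_chartMap hφ.1 p hx, ← hv', real_inner_comm,
    inner_apply_leftInv (injective_fderiv_chartMap hφ p hx), real_inner_comm]

/-- The defining formula contracts the Hessian of the immersion with the principal normal and is
visibly smooth. For any principal pair it equals the projection onto the image plane, so no pair has
to be chosen smoothly. -/
theorem planeProj_apply {q : M} (hxq : (extChartAt (𝓡 n) p).symm x = q)
    (hq : principalNormal n φ q ≠ 0) {u₁ u₂ : TangentSpace (𝓡 n) q}
    (hu : IsPrincipalPair n φ q u₁ u₂) (w : E (m + 1)) :
    planeProj n φ p x w = ⟪differential n φ q u₁, w⟫ • differential n φ q u₁ +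
      ⟪differential n φ q u₂, w⟫ • differential n φ q u₂ := by
  subst hxq
  have hlam := (principalCurvature_pos hq).ne'
  have hN : ⟪principalNormal n φ ((extChartAt (𝓡 n) p).symm x),
      principalNormal n φ ((extChartAt (𝓡 n) p).symm x)⟫ =
      principalCurvature n φ ((extChartAt (𝓡 n) p).symm x) ^ 2 := real_inner_self_eq_norm_sq _
  have key : ∀ a, (principalCurvature n φ ((extChartAt (𝓡 n) p).symm x) ^ 2)⁻¹ *
      ⟪principalNormal n φ ((extChartAt (𝓡 n) p).symm x),
      fderiv ℝ (fderiv ℝ (chartMap φ p)) x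
        (leftInv (fderiv ℝ (chartMap φ p) x) (EuclideanSpace.basisFun (Fin (m + 1)) ℝ a))
        (leftInv (fderiv ℝ (chartMap φ p) x) w)⟫ =
      ⟪EuclideanSpace.basisFun (Fin (m + 1)) ℝ a,
        ⟪differential n φ _ u₁, w⟫ • differential n φ _ u₁ +
        ⟪differential n φ _ u₂, w⟫ • differential n φ _ u₂⟫ := by
    intro a
    rw [inner_second_of_mem_normalSpace hφ p hx (principalNormal_mem hφ _), hu.2.2.2,
      inner_smul_right, hN, inner_mfderiv_leftInv hφ p hx, inner_mfderiv_leftInv hφ p hx,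
      inner_mfderiv_leftInv hφ p hx, inner_mfderiv_leftInv hφ p hx, inner_add_right,
      inner_smul_right, inner_smul_right, real_inner_comm (differential n φ _ u₁),
      real_inner_comm (differential n φ _ u₂)]
    field_simp
  conv_rhs => rw [← (EuclideanSpace.basisFun (Fin (m + 1)) ℝ).sum_repr' (_ + _)]
  rw [planeProj, sum_apply]
  refine Finset.sum_congr rfl fun a _ => ?_
  rw [← key a]
  rfl

theorem logGradient_range : ∃ v, logGradient n φ p x = fderiv ℝ (chartMap φ p) x v := by
  have hinj := injective_fderiv_chartMap hφ p hx
  refine ⟨leftInv (fderiv ℝ (chartMap φ p) x) (logGradient n φ p x), ?_⟩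
  refine ext_inner_right ℝ fun w => ?_
  rw [apply_leftInv_symm hinj, inner_logGradient, inner_logGradient, leftInv_apply_self hinj]

theorem inner_logGradient_fderiv (v : E n) :
    ⟪logGradient n φ p x, fderiv ℝ (chartMap φ p) x v⟫ =
      fderiv ℝ (fun y => principalCurvature n φ ((extChartAt (𝓡 n) p).symm y)) x v /
        principalCurvature n φ ((extChartAt (𝓡 n) p).symm x) := by
  rw [inner_logGradient, leftInv_apply_self (injective_fderiv_chartMap hφ p hx), div_eq_inv_mul]

/-- The gradient of the logarithm of the principal curvature does not depend on the chart. -/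
theorem logGradient_eq (hn : n ≠ 0) (hq : principalNormal n φ ((extChartAt (𝓡 n) p).symm x) ≠ 0)
    {p' : M} {x' : E n} (hx' : x' ∈ (extChartAt (𝓡 n) p').target)
    (h : (extChartAt (𝓡 n) p').symm x' = (extChartAt (𝓡 n) p).symm x) :
    logGradient n φ p' x' = logGradient n φ p x := by
  -- Paired with the image of a tangent vector, the gradient yields the differential of log λ, an
  -- expression free of the chart. Both gradients are tangent, hence equal.
  have key : ∀ {p : M} {x : E n}, x ∈ (extChartAt (𝓡 n) p).target → ∀ {q : M},
      (extChartAt (𝓡 n) p).symm x = q → principalNormal n φ q ≠ 0 →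
      ∀ D : TangentSpace (𝓡 n) q →L[ℝ] ℝ, D = mfderiv (𝓡 n) 𝓘(ℝ, ℝ) (principalCurvature n φ) q →
      ∀ v, ⟪logGradient n φ p x, differential n φ q v⟫ = D v / principalCurvature n φ q := by
    intro p x hx q hxq hq D hD v
    subst hxq
    obtain ⟨e, he⟩ := isInvertible_mfderiv_chart_symm p hx
    obtain ⟨w, rfl⟩ : ∃ w : E n, mfderiv 𝓘(ℝ, E n) (𝓡 n) (extChartAt (𝓡 n) p).symm x w = v := by
      rw [← he]
      exact e.surjective v
    rw [← fderiv_chartMap hφ.1 p hx, inner_logGradient_fderiv hφ p hx,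
      fderiv_comp_chart_symm p hx (contMDiffAt_principalCurvature hφ hn hq), hD]
    rfl
  have hr : ∀ {p : M} {x : E n}, x ∈ (extChartAt (𝓡 n) p).target → ∀ {q : M},
      (extChartAt (𝓡 n) p).symm x = q → ∃ v, differential n φ q v = logGradient n φ p x := by
    intro p x hx q hxq
    subst hxq
    obtain ⟨v, hv⟩ := logGradient_range hφ p hx
    exact (range_fderiv_chartMap hφ.1 p hx _).mpr ⟨v, hv.symm⟩
  obtain ⟨v, hv⟩ := hr hx rfl
  obtain ⟨v', hv'⟩ := hr hx' h
  rw [← hv, ← hv', ← sub_eq_zero, ← map_sub, ← inner_self_eq_zero (𝕜 := ℝ)]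
  conv_lhs => rw [map_sub, inner_sub_left, ← map_sub, hv, hv', key hx rfl hq _ rfl, key hx' h hq _ rfl, sub_self]

theorem contDiffAt_planeProj (hn : n ≠ 0)
    (hq : principalNormal n φ ((extChartAt (𝓡 n) p).symm x) ≠ 0) :
    ContDiffAt ℝ ∞ (planeProj n φ p) x := by
  have h1 : ContDiffAt ℝ ∞ (fderiv ℝ (chartMap φ p)) x :=
    (contDiffAt_chartMap hφ.1 p hx).fderiv_right (m := ∞) (by simp)
  have h2 : ContDiffAt ℝ ∞ (fderiv ℝ (fderiv ℝ (chartMap φ p))) x :=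
    h1.fderiv_right (m := ∞) (by simp)
  have hJ := contDiffAt_leftInv h1 (injective_fderiv_chartMap hφ p hx)
  have hT := contDiffAt_comp_chart_symm p hx (contMDiff_principalNormal hφ hn).contMDiffAt
  have hl := contDiffAt_comp_chart_symm p hx (contMDiffAt_principalCurvature hφ hn hq)
  refine ContDiffAt.sum fun a _ => ContDiffAt.smulRight ?_ contDiffAt_const
  refine ContDiffAt.smul ((hl.pow 2).inv (pow_ne_zero 2 (principalCurvature_pos hq).ne')) ?_
  refine ((innerSL ℝ (E := E (m + 1))).contDiff.contDiffAt.comp x hT).clm_comp ?_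
  exact (h2.clm_apply (hJ.clm_apply contDiffAt_const)).clm_comp hJ

theorem contDiffAt_logGradient (hn : n ≠ 0)
    (hq : principalNormal n φ ((extChartAt (𝓡 n) p).symm x) ≠ 0) :
    ContDiffAt ℝ ∞ (logGradient n φ p) x := by
  have h1 : ContDiffAt ℝ ∞ (fderiv ℝ (chartMap φ p)) x :=
    (contDiffAt_chartMap hφ.1 p hx).fderiv_right (m := ∞) (by simp)
  have hJ := contDiffAt_leftInv h1 (injective_fderiv_chartMap hφ p hx)
  have hl := contDiffAt_comp_chart_symm p hx (contMDiffAt_principalCurvature hφ hn hq)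
  refine ContDiffAt.sum fun a _ => ContDiffAt.fun_smul ?_ contDiffAt_const
  refine ContDiffAt.mul (hl.inv (principalCurvature_pos hq).ne') ?_
  exact (hl.fderiv_right (m := ∞) (by simp)).clm_apply (hJ.clm_apply contDiffAt_const)

end RankTwoCharts

/-! ### The local theory applies wherever the mean curvature is nonzero. -/

section Invariants

variable {n : ℕ} {M : Type*} [TopologicalSpace M] [ChartedSpace (E n) M]
variable {m : ℕ} {φ : M → S m}
variable [RiemannianBundle (fun x : M => TangentSpace (𝓡 n) x)]
variable [IsManifold (𝓡 n) ∞ M]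
variable (hφ : IsIsometricImmersion n φ) (hn : n ≠ 0)
  (hpair : ∀ q, principalNormal n φ q ≠ 0 → ∃ u₁ u₂, IsPrincipalPair n φ q u₁ u₂)
include hφ hn hpair

theorem isRankTwoImmersion_chart (p : M) :
    IsRankTwoImmersion ((extChartAt (𝓡 n) p).target ∩
        (extChartAt (𝓡 n) p).symm ⁻¹' {q | principalNormal n φ q ≠ 0}) (chartMap φ p)
      (fun x => unitNormal n φ ((extChartAt (𝓡 n) p).symm x))
      (fun x => principalCurvature n φ ((extChartAt (𝓡 n) p).symm x))
      (planeProj n φ p) (oscProj φ p) where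
  isOpen := (continuousOn_extChartAt_symm p).isOpen_inter_preimage (isOpen_extChartAt_target p)
    (isOpen_ne_fun (contMDiff_principalNormal hφ hn).continuous continuous_const)
  smooth_f := fun x hx => contDiffAt_chartMap hφ.1 p hx.1
  smooth_ξ := fun x hx => contDiffAt_comp_chart_symm p hx.1 (contMDiffAt_unitNormal hφ hn hx.2)
  smooth_lam := fun x hx =>
    contDiffAt_comp_chart_symm p hx.1 (contMDiffAt_principalCurvature hφ hn hx.2)
  smooth_P := fun x hx => contDiffAt_planeProj hφ p hx.1 hn hx.2
  smooth_τ := fun x hx => contDiffAt_oscProj hφ p hx.1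
  f_f := fun x _ => inner_chartMap_self φ p x
  ξ_ξ := fun x hx => inner_unitNormal_self hx.2
  ξ_f := fun x hx => by
    have := (mem_normalSpace_iff hφ p hx.1 _).mp (unitNormal_mem hφ _)
    rw [← oscProj_self hφ p hx.1, ← oscProj_symm hφ p hx.1, this, inner_zero_left]
  ξ_df := fun x hx v => by
    have := (mem_normalSpace_iff hφ p hx.1 _).mp (unitNormal_mem hφ _)
    rw [← oscProj_fderiv hφ p hx.1, ← oscProj_symm hφ p hx.1, this, inner_zero_left]
  lam_pos := fun x hx => principalCurvature_pos hx.2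
  τ_symm := fun x hx => oscProj_symm hφ p hx.1
  τ_df := fun x hx => oscProj_fderiv hφ p hx.1
  τ_f := fun x hx => oscProj_self hφ p hx.1
  τ_range := fun x _ w => ⟨_, _, oscProj_apply φ p x w⟩
  P_symm := fun x hx v w => by
    obtain ⟨u₁, u₂, hu⟩ := hpair _ hx.2
    rw [planeProj_apply hφ p hx.1 rfl hx.2 hu, planeProj_apply hφ p hx.1 rfl hx.2 hu]
    simp only [inner_add_left, inner_add_right, inner_smul_left, inner_smul_right, conj_trivial,
      real_inner_comm v]
    ring
  P_idem := fun x hx v => by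
    obtain ⟨u₁, u₂, hu⟩ := hpair _ hx.2
    have h1 : ⟪u₁, u₁⟫ = (1 : ℝ) := by rw [real_inner_self_eq_norm_sq, hu.1, one_pow]
    have h2 : ⟪u₂, u₂⟫ = (1 : ℝ) := by rw [real_inner_self_eq_norm_sq, hu.2.1, one_pow]
    have h12 : ⟪u₁, u₂⟫ = (0 : ℝ) := hu.2.2.1
    have h21 : ⟪u₂, u₁⟫ = (0 : ℝ) := by rw [real_inner_comm, h12]
    rw [← hφ.2] at h1 h2 h12 h21
    rw [planeProj_apply hφ p hx.1 rfl hx.2 hu v, planeProj_apply hφ p hx.1 rfl hx.2 hu]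
    simp only [inner_add_right, inner_smul_right, h1, h2, h12, h21, mul_one, mul_zero, add_zero,
      zero_add]
  P_range := fun x hx w => by
    obtain ⟨u₁, u₂, hu⟩ := hpair _ hx.2
    rw [planeProj_apply hφ p hx.1 rfl hx.2 hu, ← map_smul, ← map_smul, ← map_add]
    obtain ⟨v, hv⟩ := (range_fderiv_chartMap hφ.1 p hx.1 _).mp ⟨_, rfl⟩
    exact ⟨v, hv.symm⟩
  P_two := fun x hx w => by
    obtain ⟨u₁, u₂, hu⟩ := hpair _ hx.2
    have h1 : ⟪u₁, u₁⟫ = (1 : ℝ) := by rw [real_inner_self_eq_norm_sq, hu.1, one_pow]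
    have h2 : ⟪u₂, u₂⟫ = (1 : ℝ) := by rw [real_inner_self_eq_norm_sq, hu.2.1, one_pow]
    have h12 : ⟪u₁, u₂⟫ = (0 : ℝ) := hu.2.2.1
    have h21 : ⟪u₂, u₁⟫ = (0 : ℝ) := by rw [real_inner_comm, h12]
    rw [← hφ.2] at h1 h2 h12 h21
    obtain ⟨s, t, hst, h0⟩ := exists_unit_combination_orthogonal (differential n φ _ u₁)
      (differential n φ _ u₂) w
    refine ⟨s • differential n φ _ u₁ + t • differential n φ _ u₂, ?_, ?_, h0⟩
    · rw [planeProj_apply hφ p hx.1 rfl hx.2 hu]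
      simp only [inner_add_right, inner_smul_right, h1, h2, h12, h21, mul_one, mul_zero, add_zero,
        zero_add]
    · simp only [inner_add_right, inner_add_left, inner_smul_right, inner_smul_left, h1, h2, h12,
        h21, mul_one, mul_zero, add_zero, zero_add, conj_trivial]
      linarith
  second := fun x hx u v => by
    obtain ⟨u₁, u₂, hu⟩ := hpair _ hx.2
    have h := secondFundamentalForm_chart hφ p hx.1 u v
    rw [hu.2.2.2, ← principalCurvature_smul_unitNormal hx.2, smul_smul] at h
    rw [planeProj_apply hφ p hx.1 rfl hx.2 hu, eq_sub_iff_add_eq, ← eq_sub_iff_add_eq', ← h,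
      inner_add_left, inner_smul_left, inner_smul_left, fderiv_chartMap hφ.1 p hx.1,
      fderiv_chartMap hφ.1 p hx.1, hφ.2, hφ.2, hφ.2, hφ.2, conj_trivial, conj_trivial, mul_comm]

end Invariants

/-! ### The three invariants as locally constant functions on the manifold. -/

section LocallyConstant

variable {n : ℕ} {M : Type*} [TopologicalSpace M] [ChartedSpace (E n) M]
variable {m : ℕ} (φ : M → S m)
variable [RiemannianBundle (fun x : M => TangentSpace (𝓡 n) x)]

variable (n) in
/-- The normal direction of the principal sphere through `q`, scaled so that its component along
the position vector is `-1`. -/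
def sphereNormal (q : M) : E (m + 1) :=
  principalCurvature n φ q • unitNormal n φ q - φ q + logGradient n φ q (extChartAt (𝓡 n) q q)

variable (n) in
/-- The part of the unit normal orthogonal to `sphereNormal`. -/
def axisVector (q : M) : E (m + 1) :=
  unitNormal n φ q - (principalCurvature n φ q *
    (⟪sphereNormal n φ q, sphereNormal n φ q⟫ : ℝ)⁻¹) • sphereNormal n φ q

variable (n) in
/-- The projection onto the three-dimensional space spanned by the principal plane and
`sphereNormal`. -/
def sphereSpaceProj (q : M) (w : E (m + 1)) : E (m + 1) :=
  planeProj n φ q (extChartAt (𝓡 n) q q) w +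
    ((⟪sphereNormal n φ q, sphereNormal n φ q⟫ : ℝ)⁻¹ * ⟪sphereNormal n φ q, w⟫) •
      sphereNormal n φ q

variable (n) in
/-- The projection onto the span of the tangent space, the position vector and the unit normal. -/
def firstNormalProj (q : M) (w : E (m + 1)) : E (m + 1) :=
  oscProj φ q (extChartAt (𝓡 n) q q) w + ⟪unitNormal n φ q, w⟫ • unitNormal n φ q

variable {φ}
variable [IsManifold (𝓡 n) ∞ M]
variable (hφ : IsIsometricImmersion n φ)
include hφ

/-- It is the identity minus the projection onto the normal space, which involves no chart at `p` or
`p'`. -/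
theorem oscProj_eq {p p' : M} {x x' : E n} (hx : x ∈ (extChartAt (𝓡 n) p).target)
    (hx' : x' ∈ (extChartAt (𝓡 n) p').target)
    (h : (extChartAt (𝓡 n) p').symm x' = (extChartAt (𝓡 n) p).symm x) :
    oscProj φ p' x' = oscProj φ p x := by
  ext1 w
  have h1 := starProjection_normalSpace hφ p hx w
  have h2 := starProjection_normalSpace hφ p' hx' w
  rw [h, h1] at h2
  exact (sub_right_injective h2).symm

variable (hn : n ≠ 0)
  (hpair : ∀ q, principalNormal n φ q ≠ 0 → ∃ u₁ u₂, IsPrincipalPair n φ q u₁ u₂)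
include hn hpair

theorem planeProj_eq {p p' : M} {x x' : E n} (hx : x ∈ (extChartAt (𝓡 n) p).target)
    (hx' : x' ∈ (extChartAt (𝓡 n) p').target)
    (h : (extChartAt (𝓡 n) p').symm x' = (extChartAt (𝓡 n) p).symm x)
    (hq : principalNormal n φ ((extChartAt (𝓡 n) p).symm x) ≠ 0) :
    planeProj n φ p' x' = planeProj n φ p x := by
  obtain ⟨u₁, u₂, hu⟩ := hpair _ hq
  ext1 w
  rw [planeProj_apply hφ p hx rfl hq hu, planeProj_apply hφ p' hx' h hq hu]

theorem sphereNormal_chart (p : M) {x : E n} (hx : x ∈ (extChartAt (𝓡 n) p).target)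
    (hq : principalNormal n φ ((extChartAt (𝓡 n) p).symm x) ≠ 0) :
    sphereNormal n φ ((extChartAt (𝓡 n) p).symm x) =
      principalCurvature n φ ((extChartAt (𝓡 n) p).symm x) •
        unitNormal n φ ((extChartAt (𝓡 n) p).symm x) - chartMap φ p x + logGradient n φ p x := by
  rw [sphereNormal, logGradient_eq hφ p hx hn hq (mem_extChartAt_target _) (extChartAt_to_inv _)]
  rfl

/-- The axis, the space of the principal spheres and the first normal space are locally constant. -/
theorem eventually_invariants_eq (p : M) (hp : principalNormal n φ p ≠ 0) :
    ∀ᶠ q in 𝓝 p, axisVector n φ q = axisVector n φ p ∧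
      sphereSpaceProj n φ q = sphereSpaceProj n φ p ∧
      firstNormalProj n φ q = firstNormalProj n φ p := by
  have H := isRankTwoImmersion_chart hφ hn hpair p
  set Ω := (extChartAt (𝓡 n) p).target ∩
    (extChartAt (𝓡 n) p).symm ⁻¹' {q | principalNormal n φ q ≠ 0} with hΩ
  have hpΩ : extChartAt (𝓡 n) p p ∈ Ω := by
    refine ⟨mem_extChartAt_target p, ?_⟩
    rw [Set.mem_preimage, extChartAt_to_inv]
    exact hp
  obtain ⟨r, hr, hball⟩ := Metric.isOpen_iff.mp H.isOpen _ hpΩ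
  have hR : ∀ x ∈ Ω, ∃ v, logGradient n φ p x = fderiv ℝ (chartMap φ p) x v := fun x hx =>
    logGradient_range hφ p hx.1
  have hRX : ∀ x ∈ Ω, ∀ v, ⟪logGradient n φ p x, fderiv ℝ (chartMap φ p) x v⟫ =
      fderiv ℝ (fun y => principalCurvature n φ ((extChartAt (𝓡 n) p).symm y)) x v /
        principalCurvature n φ ((extChartAt (𝓡 n) p).symm x) := fun x hx =>
    inner_logGradient_fderiv hφ p hx.1
  have hRd : ∀ x ∈ Ω, DifferentiableAt ℝ (logGradient n φ p) x := fun x hx =>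
    (contDiffAt_logGradient hφ p hx.1 hn hx.2).differentiableAt (by simp)
  have hLd : ∀ x ∈ Ω, DifferentiableAt ℝ (fun y =>
      principalCurvature n φ ((extChartAt (𝓡 n) p).symm y) •
        unitNormal n φ ((extChartAt (𝓡 n) p).symm y) - chartMap φ p y + logGradient n φ p y) x :=
    fun x hx => (((H.diff_lam hx).fun_smul (H.diff_ξ hx)).fun_sub (H.diff_f hx)).fun_add (hRd x hx)
  have hκd : ∀ x ∈ Ω, _ := fun x hx => (H.fderiv_inv_normSq_L hR hRX hx hRd 0).1
  -- A coordinate ball is connected, so a vanishing derivative forces constancy there.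
  have hconst : ∀ g : E n → E (m + 1), (∀ x ∈ Ω, DifferentiableAt ℝ g x) →
      (∀ x ∈ Ω, fderiv ℝ g x = 0) → ∀ x ∈ ball (extChartAt (𝓡 n) p p) r,
      g x = g (extChartAt (𝓡 n) p p) := fun g hg hg' x hx =>
    isOpen_ball.is_const_of_fderiv_eq_zero (𝕜 := ℝ) (convex_ball _ _).isPreconnected
      (fun y hy => (hg y (hball hy)).differentiableWithinAt) (fun y hy => hg' y (hball hy)) hx
      (mem_ball_self hr)
  have hA := hconst _ (fun x hx => (H.diff_ξ hx).fun_sub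
    (((H.diff_lam hx).fun_mul (hκd x hx)).fun_smul (hLd x hx)))
    (fun x hx => H.fderiv_axis hR hRX hx hRd)
  have hS := fun w => hconst _ (fun x hx => ((H.diff_P hx).clm_apply
    (differentiableAt_const w)).fun_add (((hκd x hx).fun_mul ((hLd x hx).inner ℝ
      (differentiableAt_const w))).fun_smul (hLd x hx)))
    (fun x hx => H.fderiv_projection hR hRX hx hRd w)
  have hF := fun w => hconst _ (fun x hx => ((H.diff_τ hx).clm_apply
    (differentiableAt_const w)).fun_add (((H.diff_ξ hx).inner ℝ
      (differentiableAt_const w)).fun_smul (H.diff_ξ hx)))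
    (fun x hx => H.fderiv_osculating hx w)
  have hsrc : ∀ᶠ q in 𝓝 p, q ∈ (extChartAt (𝓡 n) p).source :=
    (isOpen_extChartAt_source p).mem_nhds (mem_extChartAt_source p)
  have hb : ∀ᶠ q in 𝓝 p, extChartAt (𝓡 n) p q ∈ ball (extChartAt (𝓡 n) p p) r :=
    (continuousAt_extChartAt p).eventually_mem (ball_mem_nhds _ hr)
  filter_upwards [hsrc, hb] with q hq hqb
  have hqe : (extChartAt (𝓡 n) p).symm (extChartAt (𝓡 n) p q) = q := (extChartAt (𝓡 n) p).left_inv hq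
  have hpe : (extChartAt (𝓡 n) p).symm (extChartAt (𝓡 n) p p) = p := extChartAt_to_inv p
  -- The invariants are defined with the chart at each point; they are rewritten here in the single
  -- chart at `p`, where they were differentiated.
  have hax : ∀ x ∈ Ω, axisVector n φ ((extChartAt (𝓡 n) p).symm x) = _ := fun x hx => by
    rw [axisVector, sphereNormal_chart hφ hn hpair p hx.1 hx.2]
  have hsp : ∀ w, ∀ x ∈ Ω, sphereSpaceProj n φ ((extChartAt (𝓡 n) p).symm x) w = _ :=
    fun w x hx => by
    rw [sphereSpaceProj, sphereNormal_chart hφ hn hpair p hx.1 hx.2,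
      planeProj_eq hφ hn hpair hx.1 (mem_extChartAt_target _) (extChartAt_to_inv _) hx.2]
  have hfn : ∀ w, ∀ x ∈ Ω, firstNormalProj n φ ((extChartAt (𝓡 n) p).symm x) w = _ :=
    fun w x hx => by
    rw [firstNormalProj, oscProj_eq hφ hx.1 (mem_extChartAt_target _) (extChartAt_to_inv _)]
  refine ⟨?_, funext fun w => ?_, funext fun w => ?_⟩
  · have := hA _ hqb
    rw [← hax _ (hball hqb), ← hax _ hpΩ, hqe, hpe] at this
    exact this
  · have := hS w _ hqb
    rw [← hsp w _ (hball hqb), ← hsp w _ hpΩ, hqe, hpe] at this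
    exact this
  · have := hF w _ hqb
    rw [← hfn w _ (hball hqb), ← hfn w _ hpΩ, hqe, hpe] at this
    exact this

end LocallyConstant

/-! ### From local constants to a quadratic cone. -/

section Rigidity

variable {n : ℕ} {M : Type*} [TopologicalSpace M] [ChartedSpace (E n) M]
variable {m : ℕ} {φ : M → S m}
variable [RiemannianBundle (fun x : M => TangentSpace (𝓡 n) x)]
variable [IsManifold (𝓡 n) ∞ M]
variable (hφ : IsIsometricImmersion n φ) (hn : n ≠ 0)
  (hpair : ∀ q, principalNormal n φ q ≠ 0 → ∃ u₁ u₂, IsPrincipalPair n φ q u₁ u₂)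
include hφ hn hpair

section Pointwise

variable {q : M} (hq : principalNormal n φ q ≠ 0)
include hq

theorem sphereNormal_relations :
    ⟪sphereNormal n φ q, (φ q : E (m + 1))⟫ = (-1 : ℝ) ∧
    ⟪sphereNormal n φ q, unitNormal n φ q⟫ = principalCurvature n φ q ∧
    ⟪unitNormal n φ q, (φ q : E (m + 1))⟫ = (0 : ℝ) ∧
    (∀ w, ⟪sphereNormal n φ q, planeProj n φ q (extChartAt (𝓡 n) q q) w⟫ = (0 : ℝ)) ∧
    (∀ v, ⟪unitNormal n φ q, fderiv ℝ (chartMap φ q) (extChartAt (𝓡 n) q q) v⟫ = (0 : ℝ)) ∧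
    planeProj n φ q (extChartAt (𝓡 n) q q) (φ q) = 0 ∧
    oscProj φ q (extChartAt (𝓡 n) q q) (φ q) = φ q := by
  have H := isRankTwoImmersion_chart hφ hn hpair q
  have hx : extChartAt (𝓡 n) q q ∈ (extChartAt (𝓡 n) q).target ∩
      (extChartAt (𝓡 n) q).symm ⁻¹' {q | principalNormal n φ q ≠ 0} := by
    refine ⟨mem_extChartAt_target q, ?_⟩
    rw [Set.mem_preimage, extChartAt_to_inv]
    exact hq
  have hR : ∀ x ∈ (extChartAt (𝓡 n) q).target ∩
      (extChartAt (𝓡 n) q).symm ⁻¹' {q | principalNormal n φ q ≠ 0},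
      ∃ v, logGradient n φ q x = fderiv ℝ (chartMap φ q) x v := fun x hx =>
    logGradient_range hφ q hx.1
  have hRX : ∀ x ∈ (extChartAt (𝓡 n) q).target ∩
      (extChartAt (𝓡 n) q).symm ⁻¹' {q | principalNormal n φ q ≠ 0},
      ∀ v, ⟪logGradient n φ q x, fderiv ℝ (chartMap φ q) x v⟫ =
      fderiv ℝ (fun y => principalCurvature n φ ((extChartAt (𝓡 n) q).symm y)) x v /
        principalCurvature n φ ((extChartAt (𝓡 n) q).symm x) := fun x hx =>
    inner_logGradient_fderiv hφ q hx.1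
  have hc : chartMap φ q (extChartAt (𝓡 n) q q) = φ q := by rw [chartMap, extChartAt_to_inv]
  have hL : principalCurvature n φ q • unitNormal n φ q - (φ q : E (m + 1)) +
      logGradient n φ q (extChartAt (𝓡 n) q q) = sphereNormal n φ q := rfl
  have h1 := H.L_f hR hRX hx
  have h2 := H.L_ξ hR hRX hx
  have h3 := H.ξ_f _ hx
  have h4 := H.P_L hR hRX hx
  have h5 := H.ξ_df _ hx
  have h6 := H.P_f hx
  have h7 := H.τ_f _ hx
  rw [extChartAt_to_inv, hc, hL] at h1
  rw [extChartAt_to_inv, hc, hL] at h2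
  rw [extChartAt_to_inv, hc] at h3
  rw [extChartAt_to_inv, hc, hL] at h4
  rw [extChartAt_to_inv] at h5
  rw [hc] at h6 h7
  exact ⟨h1, h2, h3, fun w => by rw [← H.P_symm _ hx, h4, inner_zero_left], h5, h6, h7⟩

/-- The vectors λξ and f are orthogonal components of L; what remains is the gradient term, whose
square length is nonnegative. -/
theorem sq_principalCurvature_add_one_le :
    principalCurvature n φ q ^ 2 + 1 ≤ ⟪sphereNormal n φ q, sphereNormal n φ q⟫ := by
  obtain ⟨h1, h2, h3, -⟩ := sphereNormal_relations hφ hn hpair hq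
  have h4 := inner_unitNormal_self hq
  have h5 : ⟪(φ q : E (m + 1)), (φ q : E (m + 1))⟫ = (1 : ℝ) := by
    rw [real_inner_self_eq_norm_sq, norm_eq_of_mem_sphere, one_pow]
  have h := real_inner_self_nonneg
    (x := sphereNormal n φ q - principalCurvature n φ q • unitNormal n φ q + φ q)
  have h1' : ⟪(φ q : E (m + 1)), sphereNormal n φ q⟫ = (-1 : ℝ) := by rw [real_inner_comm, h1]
  have h2' : ⟪unitNormal n φ q, sphereNormal n φ q⟫ = principalCurvature n φ q := by
    rw [real_inner_comm, h2]
  have h3' : ⟪(φ q : E (m + 1)), unitNormal n φ q⟫ = (0 : ℝ) := by rw [real_inner_comm, h3]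
  simp only [inner_add_left, inner_add_right, inner_sub_left, inner_sub_right, inner_smul_left,
    inner_smul_right, conj_trivial, h1, h2, h3, h4, h5, h1', h2', h3'] at h
  nlinarith

/-- The axis is ξ minus its projection onto L, and ⟪L, ξ⟫ = λ. -/
theorem inner_axisVector_self :
    ⟪axisVector n φ q, axisVector n φ q⟫ = 1 - principalCurvature n φ q ^ 2 *
      (⟪sphereNormal n φ q, sphereNormal n φ q⟫ : ℝ)⁻¹ := by
  obtain ⟨h1, h2, h3, -⟩ := sphereNormal_relations hφ hn hpair hq
  have h4 := inner_unitNormal_self hq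
  have h0 : (⟪sphereNormal n φ q, sphereNormal n φ q⟫ : ℝ) ≠ 0 := by
    have := sq_principalCurvature_add_one_le hφ hn hpair hq
    nlinarith [sq_nonneg (principalCurvature n φ q)]
  have h2' : ⟪unitNormal n φ q, sphereNormal n φ q⟫ = principalCurvature n φ q := by
    rw [real_inner_comm, h2]
  rw [axisVector]
  simp only [inner_sub_left, inner_sub_right, inner_smul_left, inner_smul_right, conj_trivial, h2,
    h2', h4]
  field_simp
  ring

theorem inner_axisVector_position :
    ⟪axisVector n φ q, (φ q : E (m + 1))⟫ = principalCurvature n φ q *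
      (⟪sphereNormal n φ q, sphereNormal n φ q⟫ : ℝ)⁻¹ := by
  obtain ⟨h1, h2, h3, -⟩ := sphereNormal_relations hφ hn hpair hq
  rw [axisVector, inner_sub_left, inner_smul_left, h1, h3, conj_trivial]
  ring

/-- The position is orthogonal to the plane, so only its component -1 along L counts. -/
theorem inner_sphereSpaceProj_position :
    ⟪sphereSpaceProj n φ q (φ q), (φ q : E (m + 1))⟫ =
      (⟪sphereNormal n φ q, sphereNormal n φ q⟫ : ℝ)⁻¹ := by
  obtain ⟨h1, h2, h3, h4, h5, h6, h7⟩ := sphereNormal_relations hφ hn hpair hq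
  rw [sphereSpaceProj, h6, zero_add, inner_smul_left, h1, conj_trivial]
  ring

theorem firstNormalProj_position : firstNormalProj n φ q (φ q) = φ q := by
  obtain ⟨h1, h2, h3, h4, h5, h6, h7⟩ := sphereNormal_relations hφ hn hpair hq
  rw [firstNormalProj, h7, h3, zero_smul, add_zero]

/-- The `(n + 2)`-dimensional first osculating space with an adapted orthonormal frame. -/
theorem exists_frame_at : ∃ (W : Submodule ℝ (E (m + 1))) (e₁ e₂ e₃ : E (m + 1)),
    Module.finrank ℝ W = n + 2 ∧ (∀ w, firstNormalProj n φ q w ∈ W) ∧ e₁ ∈ W ∧ e₂ ∈ W ∧ e₃ ∈ W ∧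
    axisVector n φ q ∈ W ∧ Orthonormal ℝ ![e₁, e₂, e₃] ∧
    (∀ i, ⟪axisVector n φ q, ![e₁, e₂, e₃] i⟫ = (0 : ℝ)) ∧
    ∀ w, sphereSpaceProj n φ q w = ⟪e₁, w⟫ • e₁ + ⟪e₂, w⟫ • e₂ + ⟪e₃, w⟫ • e₃ := by
  obtain ⟨h1, h2, h3, h4, h5, h6, h7⟩ := sphereNormal_relations hφ hn hpair hq
  have hξ := inner_unitNormal_self hq
  have hφφ : ⟪(φ q : E (m + 1)), (φ q : E (m + 1))⟫ = (1 : ℝ) := by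
    rw [real_inner_self_eq_norm_sq, norm_eq_of_mem_sphere, one_pow]
  have hLL : (0 : ℝ) < ⟪sphereNormal n φ q, sphereNormal n φ q⟫ := by
    have := sq_principalCurvature_add_one_le hφ hn hpair hq
    nlinarith [sq_nonneg (principalCurvature n φ q)]
  have hx := mem_extChartAt_target (I := 𝓡 n) q
  have hfd : ∀ v, ⟪(φ q : E (m + 1)), fderiv ℝ (chartMap φ q) (extChartAt (𝓡 n) q q) v⟫ = (0 : ℝ) := by
    have := inner_chartMap_fderiv hφ.1 q hx
    rwa [chartMap, extChartAt_to_inv] at this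
  set D := fderiv ℝ (chartMap φ q) (extChartAt (𝓡 n) q q) with hD
  have hinj : Function.Injective D := injective_fderiv_chartMap hφ q hx
  obtain ⟨u₁, u₂, hu⟩ := hpair q hq
  have hu1 : ⟪u₁, u₁⟫ = (1 : ℝ) := by rw [real_inner_self_eq_norm_sq, hu.1, one_pow]
  have hu2 : ⟪u₂, u₂⟫ = (1 : ℝ) := by rw [real_inner_self_eq_norm_sq, hu.2.1, one_pow]
  have hu12 : ⟪u₁, u₂⟫ = (0 : ℝ) := hu.2.2.1
  have hu21 : ⟪u₂, u₁⟫ = (0 : ℝ) := by rw [real_inner_comm, hu12]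
  rw [← hφ.2] at hu1 hu2 hu12 hu21
  have hP := planeProj_apply hφ q hx (extChartAt_to_inv q) hq hu
  obtain ⟨v₁, hv₁⟩ := (range_differential_self hφ.1 q _).mp ⟨u₁, rfl⟩
  obtain ⟨v₂, hv₂⟩ := (range_differential_self hφ.1 q _).mp ⟨u₂, rfl⟩
  rw [← hD] at hv₁ hv₂
  set e₁ := differential n φ q u₁ with he₁
  set e₂ := differential n φ q u₂ with he₂
  have hL1 : ⟪sphereNormal n φ q, e₁⟫ = (0 : ℝ) := by
    have := h4 e₁
    rwa [hP, hu1, hu21, one_smul, zero_smul, add_zero] at this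
  have hL2 : ⟪sphereNormal n φ q, e₂⟫ = (0 : ℝ) := by
    have := h4 e₂
    rwa [hP, hu2, hu12, one_smul, zero_smul, zero_add] at this
  have hξ1 : ⟪unitNormal n φ q, e₁⟫ = (0 : ℝ) := by rw [← hv₁, h5]
  have hξ2 : ⟪unitNormal n φ q, e₂⟫ = (0 : ℝ) := by rw [← hv₂, h5]
  have hlen : ‖sphereNormal n φ q‖ ^ 2 = ⟪sphereNormal n φ q, sphereNormal n φ q⟫ :=
    (real_inner_self_eq_norm_sq _).symm
  have hlen0 : ‖sphereNormal n φ q‖ ≠ 0 := fun h => by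
    rw [← hlen, h] at hLL
    norm_num at hLL
  -- The space W is the range of this injective map: tangent space, position and unit normal, of
  -- dimension n + 1 + 1. The frame consists of the principal pair and L/|L|.
  let Ψ : (E n × ℝ) × ℝ →ₗ[ℝ] E (m + 1) := LinearMap.coprod (LinearMap.coprod D.toLinearMap
    (LinearMap.toSpanSingleton ℝ _ (φ q : E (m + 1))))
    (LinearMap.toSpanSingleton ℝ _ (unitNormal n φ q))
  have hΨ : ∀ v s t, Ψ ((v, s), t) = D v + s • (φ q : E (m + 1)) + t • unitNormal n φ q :=
    fun v s t => by simp [Ψ]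
  have hΨi : Function.Injective Ψ := by
    refine (injective_iff_map_eq_zero _).mpr ?_
    rintro ⟨⟨v, s⟩, t⟩ h0
    rw [hΨ] at h0
    have ha := congrArg (fun z => (⟪(φ q : E (m + 1)), z⟫ : ℝ)) h0
    have hb := congrArg (fun z => (⟪unitNormal n φ q, z⟫ : ℝ)) h0
    simp only [inner_add_right, inner_smul_right, inner_zero_right, hfd, hφφ, h3, h5, hξ,
      real_inner_comm (unitNormal n φ q)] at ha hb
    have h3' : ⟪(φ q : E (m + 1)), unitNormal n φ q⟫ = (0 : ℝ) := by rw [real_inner_comm, h3]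
    have hs : s = 0 := by linarith
    have ht : t = 0 := by linarith
    subst hs ht
    rw [zero_smul, zero_smul, add_zero, add_zero] at h0
    rw [hinj (h0.trans (map_zero D).symm)]
    rfl
  have hmem : ∀ v s t, D v + s • (φ q : E (m + 1)) + t • unitNormal n φ q ∈ Ψ.range :=
    fun v s t => ⟨((v, s), t), hΨ v s t⟩
  have hLmem : sphereNormal n φ q ∈ Ψ.range := by
    obtain ⟨v, hv⟩ := logGradient_range hφ q hx
    have := hmem v (-1) (principalCurvature n φ q)
    rw [← hv] at this
    convert this using 1
    rw [sphereNormal]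
    module
  have hξmem : unitNormal n φ q ∈ Ψ.range := by simpa using hmem 0 0 1
  refine ⟨Ψ.range, e₁, e₂, ‖sphereNormal n φ q‖⁻¹ • sphereNormal n φ q, ?_, fun w => ?_, ?_, ?_,
    Submodule.smul_mem _ _ hLmem, ?_, ?_, ?_, fun w => ?_⟩
  · rw [LinearMap.finrank_range_of_inj hΨi]
    simp
  · rw [firstNormalProj, oscProj_apply]
    have := hmem (leftInv D w) ⟪(φ q : E (m + 1)), w⟫ ⟪unitNormal n φ q, w⟫
    rwa [chartMap, extChartAt_to_inv, ← hD]
  · rw [← hv₁]; simpa using hmem v₁ 0 0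
  · rw [← hv₂]; simpa using hmem v₂ 0 0
  · exact Submodule.sub_mem _ hξmem (Submodule.smul_mem _ _ hLmem)
  · rw [orthonormal_iff_ite]
    have h33 : ⟪‖sphereNormal n φ q‖⁻¹ • sphereNormal n φ q,
        ‖sphereNormal n φ q‖⁻¹ • sphereNormal n φ q⟫ = (1 : ℝ) := by
      rw [inner_smul_left, inner_smul_right, ← hlen, conj_trivial]
      field_simp
    have h31 : ⟪‖sphereNormal n φ q‖⁻¹ • sphereNormal n φ q, e₁⟫ = (0 : ℝ) := by
      rw [inner_smul_left, hL1, mul_zero]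
    have h32 : ⟪‖sphereNormal n φ q‖⁻¹ • sphereNormal n φ q, e₂⟫ = (0 : ℝ) := by
      rw [inner_smul_left, hL2, mul_zero]
    have h13 := (real_inner_comm (‖sphereNormal n φ q‖⁻¹ • sphereNormal n φ q) e₁).trans h31
    have h23 := (real_inner_comm (‖sphereNormal n φ q‖⁻¹ • sphereNormal n φ q) e₂).trans h32
    intro i j
    fin_cases i <;> fin_cases j
    exacts [hu1, hu12, h13, hu21, hu2, h23, h31, h32, h33]
  · have hcL : ⟪axisVector n φ q, sphereNormal n φ q⟫ = (0 : ℝ) := by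
      rw [axisVector, inner_sub_left, inner_smul_left, real_inner_comm, h2, conj_trivial,
        inv_mul_cancel_right₀ hLL.ne', sub_self]
    have hc1 : ⟪axisVector n φ q, e₁⟫ = (0 : ℝ) := by
      rw [axisVector, inner_sub_left, inner_smul_left, hξ1, hL1, mul_zero, sub_self]
    have hc2 : ⟪axisVector n φ q, e₂⟫ = (0 : ℝ) := by
      rw [axisVector, inner_sub_left, inner_smul_left, hξ2, hL2, mul_zero, sub_self]
    intro i
    fin_cases i
    · exact hc1
    · exact hc2
    · exact (inner_smul_right _ _ _).trans (by rw [hcL, mul_zero])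
  · rw [sphereSpaceProj, hP, inner_smul_left, smul_smul, ← hlen, conj_trivial]
    congr 2
    field_simp

end Pointwise

variable [ConnectedSpace M]

/-- If the mean curvature vector is nonzero at some point, it vanishes nowhere. -/
theorem invariants_eq {p : M} (hp : principalNormal n φ p ≠ 0) (q : M) :
    principalNormal n φ q ≠ 0 ∧ axisVector n φ q = axisVector n φ p ∧
      sphereSpaceProj n φ q = sphereSpaceProj n φ p ∧
      firstNormalProj n φ q = firstNormalProj n φ p := by
  set A : Set M := {q | principalNormal n φ q ≠ 0 ∧ axisVector n φ q = axisVector n φ p ∧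
      sphereSpaceProj n φ q = sphereSpaceProj n φ p ∧
      firstNormalProj n φ q = firstNormalProj n φ p} with hA
  have hcont := (contMDiff_principalNormal hφ hn).continuous
  have hopen : IsOpen A := by
    rw [isOpen_iff_mem_nhds]
    rintro q ⟨hq, h1, h2, h3⟩
    filter_upwards [eventually_invariants_eq hφ hn hpair q hq,
      hcont.continuousAt.eventually_ne hq] with q' ⟨h1', h2', h3'⟩ hq'
    exact ⟨hq', h1'.trans h1, h2'.trans h2, h3'.trans h3⟩
  -- Since |L|² ≥ 1, λ² ≥ λ²/|L|² = 1 - |axis|², and the right side is the same positive number at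
  -- every point of A. So λ cannot tend to 0 at the boundary of A.
  have hb : ∀ q ∈ A, 1 - ⟪axisVector n φ p, axisVector n φ p⟫ ≤ ‖principalNormal n φ q‖ ^ 2 := by
    rintro q ⟨hq, h1, -, -⟩
    rw [← h1, inner_axisVector_self hφ hn hpair hq, sub_sub_cancel]
    have := sq_principalCurvature_add_one_le hφ hn hpair hq
    have h3 := sq_nonneg (principalCurvature n φ q)
    exact mul_le_of_le_one_right h3 (inv_le_one_of_one_le₀ (by linarith))
  have hpos : 0 < 1 - ⟪axisVector n φ p, axisVector n φ p⟫ := by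
    rw [inner_axisVector_self hφ hn hpair hp, sub_sub_cancel]
    have := sq_principalCurvature_add_one_le hφ hn hpair hp
    have h2 := principalCurvature_pos hp
    exact mul_pos (by positivity) (inv_pos.mpr (by nlinarith))
  have hclosed : IsClosed A := by
    rw [← closure_subset_iff_isClosed]
    intro q hq
    have h1 : 1 - ⟪axisVector n φ p, axisVector n φ p⟫ ≤ ‖principalNormal n φ q‖ ^ 2 :=
      closure_minimal (t := {q | 1 - ⟪axisVector n φ p, axisVector n φ p⟫ ≤
        ‖principalNormal n φ q‖ ^ 2}) hb (isClosed_le continuous_const (hcont.norm.pow 2)) hq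
    have hq0 : principalNormal n φ q ≠ 0 := fun h => by
      rw [h, norm_zero] at h1
      linarith
    -- A limit point has nonzero mean curvature, so the invariants are constant near it and agree
    -- with those of a nearby point of A.
    obtain ⟨q', ⟨-, h5, h6, h7⟩, h2, h3, h4⟩ := ((mem_closure_iff_frequently.mp hq).and_eventually
      (eventually_invariants_eq hφ hn hpair q hq0)).exists
    exact ⟨hq0, h2.symm.trans h5, h3.symm.trans h6, h4.symm.trans h7⟩
  have huniv : A = Set.univ := IsClopen.eq_univ ⟨hclosed, hopen⟩ ⟨p, hp, rfl, rfl, rfl⟩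
  exact huniv.ge (Set.mem_univ q)

/-- The image of an ideal submanifold of type number at most two that is not minimal lies on a
quadratic cone. -/
theorem exists_quadratic_cone {p : M} (hp : principalNormal n φ p ≠ 0) :
    ∃ (W : Submodule ℝ (E (m + 1))) (e₀ e₁ e₂ e₃ : E (m + 1)) (a : ℝ),
      Module.finrank ℝ W = n + 2 ∧ (∀ i, ![e₀, e₁, e₂, e₃] i ∈ W) ∧
      Orthonormal ℝ ![e₀, e₁, e₂, e₃] ∧ 0 < a ∧ a < 1 ∧
      ∀ q, (φ q : E (m + 1)) ∈ W ∧ 0 < ⟪e₀, (φ q : E (m + 1))⟫ ∧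
        (1 - a ^ 2) * (⟪e₁, (φ q : E (m + 1))⟫ ^ 2 + ⟪e₂, (φ q : E (m + 1))⟫ ^ 2 +
          ⟪e₃, (φ q : E (m + 1))⟫ ^ 2) = a ^ 2 * ⟪e₀, (φ q : E (m + 1))⟫ ^ 2 := by
  obtain ⟨W, e₁, e₂, e₃, hW, hWF, h1, h2, h3, h0, ho, h0o, hproj⟩ :=
    exists_frame_at hφ hn hpair hp
  have hinv := invariants_eq hφ hn hpair hp
  have hle := sq_principalCurvature_add_one_le hφ hn hpair hp
  have hself := inner_axisVector_self hφ hn hpair hp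
  -- The parameter is the length of the axis: a² = 1 - λ²/|L|², positive because |L|² > λ² and below
  -- 1 because λ > 0.
  set a := ‖axisVector n φ p‖ with ha
  have ha2 : ⟪axisVector n φ p, axisVector n φ p⟫ = a ^ 2 := real_inner_self_eq_norm_sq _
  have hlam := principalCurvature_pos hp
  have hL0 : (0 : ℝ) < ⟪sphereNormal n φ p, sphereNormal n φ p⟫ := by nlinarith
  have hlt1 : principalCurvature n φ p ^ 2 * (⟪sphereNormal n φ p, sphereNormal n φ p⟫ : ℝ)⁻¹ < 1 := by
    rw [← div_eq_mul_inv, div_lt_one hL0]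
    linarith
  have hgt0 : 0 < principalCurvature n φ p ^ 2 *
      (⟪sphereNormal n φ p, sphereNormal n φ p⟫ : ℝ)⁻¹ := by positivity
  have ha0 : 0 < a := by
    refine lt_of_le_of_ne (norm_nonneg _) fun h => ?_
    rw [ha2, ← h] at hself
    linarith
  have ha1 : a < 1 := by nlinarith
  refine ⟨W, a⁻¹ • axisVector n φ p, e₁, e₂, e₃, a, hW, ?_, ?_, ha0, ha1, fun q => ⟨?_, ?_, ?_⟩⟩
  · intro i
    fin_cases i
    exacts [W.smul_mem _ h0, h1, h2, h3]
  · have hoo := orthonormal_iff_ite.mp ho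
    rw [orthonormal_iff_ite]
    have hz : ∀ i, ⟪a⁻¹ • axisVector n φ p, ![e₁, e₂, e₃] i⟫ = (0 : ℝ) := fun i => by
      rw [inner_smul_left, h0o, mul_zero]
    have hs : ⟪a⁻¹ • axisVector n φ p, a⁻¹ • axisVector n φ p⟫ = (1 : ℝ) := by
      rw [inner_smul_left, inner_smul_right, ha2, conj_trivial]
      field_simp
    intro i j
    refine Fin.cases (Fin.cases ?_ (fun j => ?_) j) (fun i => Fin.cases ?_ (fun j => ?_) j) i
    · exact hs
    · exact hz j
    · exact (real_inner_comm _ _).trans (hz i)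
    · exact (hoo i j).trans (by simp)
  · rw [← firstNormalProj_position hφ hn hpair (hinv q).1, (hinv q).2.2.2]
    exact hWF _
  · rw [inner_smul_left, ← (hinv q).2.1, inner_axisVector_position hφ hn hpair (hinv q).1,
      conj_trivial]
    have h4 := sq_principalCurvature_add_one_le hφ hn hpair (hinv q).1
    have h5 := principalCurvature_pos (hinv q).1
    have h6 : (0 : ℝ) < ⟪sphereNormal n φ q, sphereNormal n φ q⟫ := by nlinarith
    positivity
  -- With κ = |L|⁻²: the squares in the 3-space add up to κ, 1 - a² = λ²κ, and the axis pairs with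
  -- the position to λκ. Both sides equal λ²κ².
  · have h4 := inner_sphereSpaceProj_position hφ hn hpair (hinv q).1
    rw [(hinv q).2.2.1, hproj] at h4
    simp only [inner_add_left, inner_smul_left, conj_trivial, ← pow_two] at h4
    have h5 := inner_axisVector_self hφ hn hpair (hinv q).1
    rw [(hinv q).2.1, ha2] at h5
    have h6 := inner_axisVector_position hφ hn hpair (hinv q).1
    rw [(hinv q).2.1] at h6
    have h7 : a ^ 2 * a⁻¹ ^ 2 = 1 := by field_simp
    have h8 : 1 - a ^ 2 = principalCurvature n φ q ^ 2 *
      (⟪sphereNormal n φ q, sphereNormal n φ q⟫ : ℝ)⁻¹ := by rw [h5]; ring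
    rw [h4, inner_smul_left, h6, conj_trivial, h8]
    linear_combination (-(principalCurvature n φ q *
      (⟪sphereNormal n φ q, sphereNormal n φ q⟫ : ℝ)⁻¹) ^ 2) * h7

end Rigidity

/-! ### The inverse function theorem in smooth form. -/

section InverseFunction

variable {V : Type*} [NormedAddCommGroup V] [NormedSpace ℝ V] [FiniteDimensional ℝ V]

/-- The inverse function theorem for smooth maps, as a statement on partial diffeomorphisms. -/
theorem exists_partialDiffeomorph {f : V → V} {s : Set V} (hs : IsOpen s)
    (hf : ∀ x ∈ s, ContDiffAt ℝ ∞ f x) {a : V} (ha : a ∈ s)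
    (hinj : Function.Injective (fderiv ℝ f a)) :
    ∃ Φ : PartialDiffeomorph 𝓘(ℝ, V) 𝓘(ℝ, V) V V ∞, a ∈ Φ.source ∧ ∀ x, Φ x = f x := by
  have : CompleteSpace V := FiniteDimensional.complete ℝ V
  have hequiv : fderiv ℝ f a ∈ Set.range ((↑) : (V ≃L[ℝ] V) → V →L[ℝ] V) :=
    ⟨(LinearEquiv.ofInjectiveEndo (fderiv ℝ f a).toLinearMap hinj).toContinuousLinearEquiv, by
      ext; simp⟩
  obtain ⟨f', hf'⟩ := id hequiv
  have hd : HasFDerivAt f (f' : V →L[ℝ] V) a := by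
    rw [hf']
    exact ((hf a ha).differentiableAt (by simp)).hasFDerivAt
  set e := (hf a ha).toOpenPartialHomeomorph f hd (by simp) with he
  have hcont : ContinuousOn (fderiv ℝ f) s := fun x hx =>
    ((hf x hx).fderiv_right (m := ∞) (by simp)).continuousAt.continuousWithinAt
  -- Restricting to points where the derivative is invertible makes the inverse smooth on its whole
  -- domain.
  set t := s ∩ fderiv ℝ f ⁻¹' Set.range ((↑) : (V ≃L[ℝ] V) → V →L[ℝ] V) with ht
  have htopen : IsOpen t := hcont.isOpen_inter_preimage hs ContinuousLinearEquiv.isOpen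
  let e' := e.restrOpen t htopen
  refine ⟨⟨e'.toPartialEquiv, e'.open_source, e'.open_target, ?_, ?_⟩, ?_, fun x => rfl⟩
  · intro x hx
    exact (hf x hx.2.1).contMDiffAt.contMDiffWithinAt
  · intro y hy
    have hx : e'.symm y ∈ e'.source := e'.map_target hy
    obtain ⟨g', hg'⟩ := hx.2.2
    have h1 : HasFDerivAt f (g' : V →L[ℝ] V) (e'.symm y) := by
      rw [hg']
      exact ((hf _ hx.2.1).differentiableAt (by simp)).hasFDerivAt
    have h2 := e'.contDiffAt_symm hy (f₀' := g') h1 (hf _ hx.2.1)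
    exact h2.contMDiffAt.contMDiffWithinAt
  · exact ⟨(hf a ha).mem_toOpenPartialHomeomorph_source hd (by simp), ha, hequiv⟩

end InverseFunction

/-! ### The intersection of the unit sphere with the quadratic cone. -/

section Cone

variable {m : ℕ}

/-- The `i`-th coordinate of a vector of `E (m + 1)`, zero if `i` is out of range. -/
def coordinate (m i : ℕ) : E (m + 1) →L[ℝ] ℝ :=
  if h : i < m + 1 then EuclideanSpace.proj ⟨i, h⟩ else 0

theorem coordinate_apply {i : ℕ} (h : i < m + 1) (y : E (m + 1)) : coordinate m i y = y ⟨i, h⟩ := by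
  rw [coordinate, dif_pos h]
  rfl

theorem coordinate_of_le {i : ℕ} (h : m + 1 ≤ i) (y : E (m + 1)) : coordinate m i y = 0 := by
  rw [coordinate, dif_neg h.not_gt]
  rfl

theorem ext_coordinate {y z : E (m + 1)} (h : ∀ i, coordinate m i y = coordinate m i z) : y = z := by
  ext ⟨i, hi⟩
  rw [← coordinate_apply hi, h, coordinate_apply hi]

theorem inner_eq_sum_coordinate (y z : E (m + 1)) :
    ⟪y, z⟫ = ∑ i ∈ Finset.range (m + 1), coordinate m i y * coordinate m i z := by
  rw [Finset.sum_range, PiLp.inner_apply]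
  refine Finset.sum_congr rfl fun i _ => ?_
  rw [coordinate_apply i.2, coordinate_apply i.2]
  simp [mul_comm]

/-- The quadratic form `(1 - a²)(y_{n-1}² + y_n² + y_{n+1}²) - a² y_0²`, polarized. -/
def coneForm (n m : ℕ) (a : ℝ) : E (m + 1) →L[ℝ] E (m + 1) →L[ℝ] ℝ :=
  (1 - a ^ 2) • ((coordinate m (n - 1)).smulRight (coordinate m (n - 1)) +
    (coordinate m n).smulRight (coordinate m n) +
    (coordinate m (n + 1)).smulRight (coordinate m (n + 1))) -
  a ^ 2 • (coordinate m 0).smulRight (coordinate m 0)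

set_option synthInstance.maxHeartbeats 200000 in
theorem coneForm_apply (n m : ℕ) (a : ℝ) (y z : E (m + 1)) : coneForm n m a y z =
    (1 - a ^ 2) * (coordinate m (n - 1) y * coordinate m (n - 1) z +
      coordinate m n y * coordinate m n z + coordinate m (n + 1) y * coordinate m (n + 1) z) -
    a ^ 2 * (coordinate m 0 y * coordinate m 0 z) := by
  rw [coneForm, sub_apply, sub_apply, smul_apply, smul_apply, smul_apply, smul_apply, add_apply,
    add_apply, add_apply, add_apply]
  simp only [ContinuousLinearMap.smulRight_apply, smul_apply, smul_eq_mul]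

theorem coneForm_comm (n m : ℕ) (a : ℝ) (y z : E (m + 1)) :
    coneForm n m a y z = coneForm n m a z y := by
  rw [coneForm_apply, coneForm_apply]
  ring

/-- The points of the unit sphere of the first `n + 2` coordinates on the quadratic cone. -/
structure OnCone (n : ℕ) (a : ℝ) (y : E (m + 1)) : Prop where
  inner_self : ⟪y, y⟫ = (1 : ℝ)
  form_self : coneForm n m a y y = 0
  coordinate_eq_zero : ∀ i, n + 2 ≤ i → coordinate m i y = 0

/-- The vectors tangent to the cone at `y`. -/
structure TangentToCone (n : ℕ) (a : ℝ) (y v : E (m + 1)) : Prop where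
  inner_eq_zero : ⟪y, v⟫ = (0 : ℝ)
  form_eq_zero : coneForm n m a y v = 0
  coordinate_eq_zero : ∀ i, n + 2 ≤ i → coordinate m i v = 0

theorem tangentToCone_fderiv {V : Type*} [NormedAddCommGroup V] [NormedSpace ℝ V] {n : ℕ} {a : ℝ}
    {g : V → E (m + 1)} {x : V} (hg : DifferentiableAt ℝ g x)
    (hcone : ∀ᶠ x' in 𝓝 x, OnCone n a (g x')) (v : V) :
    TangentToCone n a (g x) (fderiv ℝ g x v) where
  inner_eq_zero := by
    have hev : (fun y => ⟪g y, g y⟫) =ᶠ[𝓝 x] fun _ => (1 : ℝ) := hcone.mono fun _ h => h.inner_self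
    have h1 := congrArg (fun T : V →L[ℝ] ℝ => T v) hev.fderiv_eq
    rw [fderiv_inner_apply ℝ hg hg] at h1
    simp only [fderiv_fun_const, Pi.zero_apply, zero_apply] at h1
    rw [real_inner_comm (g x)] at h1
    linarith
  form_eq_zero := by
    have hev : (fun y => coneForm n m a (g y) (g y)) =ᶠ[𝓝 x] fun _ => (0 : ℝ) :=
      hcone.mono fun _ h => h.form_self
    have h1 := congrArg (fun T : V →L[ℝ] ℝ => T v) hev.fderiv_eq
    have h2 : HasFDerivAt (fun y => coneForm n m a (g y)) (coneForm n m a ∘L fderiv ℝ g x) x :=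
      (coneForm n m a).hasFDerivAt.comp x hg.hasFDerivAt
    rw [(h2.clm_apply hg.hasFDerivAt).fderiv] at h1
    simp only [fderiv_fun_const, Pi.zero_apply, zero_apply, add_apply,
      ContinuousLinearMap.comp_apply, ContinuousLinearMap.flip_apply] at h1
    rw [coneForm_comm n m a (fderiv ℝ g x v)] at h1
    linarith
  coordinate_eq_zero := fun i hi => by
    have hev : (fun y => coordinate m i (g y)) =ᶠ[𝓝 x] fun _ => (0 : ℝ) :=
      hcone.mono fun _ h => h.coordinate_eq_zero i hi
    have h1 := congrArg (fun T : V →L[ℝ] ℝ => T v) hev.fderiv_eq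
    have h2 := ((coordinate m i).hasFDerivAt.comp x hg.hasFDerivAt).fderiv
    rw [show (fun y => coordinate m i (g y)) = coordinate m i ∘ g from rfl, h2] at h1
    simpa using h1

variable {n : ℕ} {a : ℝ}

/-- The tangent space of the cone has dimension `n`. -/
theorem exists_eq_of_tangentToCone {V : Type*} [NormedAddCommGroup V] [NormedSpace ℝ V]
    [FiniteDimensional ℝ V] (hV : Module.finrank ℝ V = n) (hn : 2 ≤ n)
    (ha : a ≠ 0) {y : E (m + 1)} (hy : OnCone n a y) (hy0 : coordinate m 0 y ≠ 0)
    {D : V →L[ℝ] E (m + 1)} (hD : Function.Injective D) (hDy : ∀ v, TangentToCone n a y (D v))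
    {w : E (m + 1)} (hw : TangentToCone n a y w) : ∃ v, D v = w := by
  let W : Submodule ℝ (E (m + 1)) := ⨅ i ∈ Set.Ici (n + 2), (coordinate m i).toLinearMap.ker
  have hW : ∀ v, v ∈ W ↔ ∀ i, n + 2 ≤ i → coordinate m i v = 0 := fun v => by
    simp [W, Submodule.mem_iInf]
  have hWdim : Module.finrank ℝ W ≤ n + 2 := by
    let κ : W →ₗ[ℝ] Fin (n + 2) → ℝ :=
      (LinearMap.pi fun j : Fin (n + 2) => (coordinate m j).toLinearMap) ∘ₗ W.subtype
    have hκ : Function.Injective κ := by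
      refine (injective_iff_map_eq_zero κ).mpr fun v hv => ?_
      refine Subtype.ext (ext_coordinate fun i => ?_)
      rw [Submodule.coe_zero, map_zero]
      rcases Nat.lt_or_ge i (n + 2) with hi | hi
      · exact congrFun hv ⟨i, hi⟩
      · exact (hW _).mp v.2 i hi
    simpa using LinearMap.finrank_le_finrank_of_injective hκ
  let ℓ : W →ₗ[ℝ] ℝ × ℝ :=
    ((innerSL ℝ y).toLinearMap.prod (coneForm n m a y).toLinearMap) ∘ₗ W.subtype
  have hℓ : ∀ v : W, ℓ v = (⟪y, (v : E (m + 1))⟫, coneForm n m a y v) := fun v => rfl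
  have h0 : (0 : ℕ) < m + 1 := by omega
  set ε : E (m + 1) := EuclideanSpace.single ⟨0, h0⟩ 1 with hε
  have hεi : ∀ i, i ≠ 0 → coordinate m i ε = 0 := fun i hi => by
    rcases Nat.lt_or_ge i (m + 1) with h | h
    · rw [coordinate_apply h, hε]
      simp [hi]
    · exact coordinate_of_le h _
  have hε0 : coordinate m 0 ε = 1 := by
    rw [coordinate_apply h0, hε]
    simp
  have hεW : ε ∈ W := (hW _).mpr fun i hi => hεi i (by omega)
  have hyW : y ∈ W := (hW _).mpr hy.coordinate_eq_zero
  have hform : coneForm n m a y ε = -(a ^ 2 * coordinate m 0 y) := by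
    rw [coneForm_apply, hεi _ (by omega), hεi n (by omega), hεi _ (by omega), hε0]
    ring
  -- The two tangency conditions are independent: y has unit length and is isotropic for the cone
  -- form, while the form pairs y with the first basis vector to -a² y₀ ≠ 0. Hence the tangent space
  -- has dimension at most n.
  have hsurj : Function.Surjective ℓ := by
    rintro ⟨s, t⟩
    set c := -t / (a ^ 2 * coordinate m 0 y) with hc
    refine ⟨(s - c * ⟪y, ε⟫) • ⟨y, hyW⟩ + c • ⟨ε, hεW⟩, ?_⟩
    rw [hℓ]
    simp only [Submodule.coe_add, Submodule.coe_smul, inner_add_right, inner_smul_right,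
      hy.inner_self, map_add, map_smul, hy.form_self, hform, smul_eq_mul]
    refine Prod.ext (by simp) ?_
    simp only [hc]
    field_simp
    ring
  have hker : Module.finrank ℝ ℓ.ker ≤ n := by
    have := ℓ.finrank_range_add_finrank_ker
    rw [LinearMap.range_eq_top.mpr hsurj, finrank_top] at this
    simp at this
    omega
  have hle : D.range ≤ ℓ.ker.map W.subtype := by
    rintro _ ⟨v, rfl⟩
    refine ⟨⟨D v, (hW _).mpr (hDy v).coordinate_eq_zero⟩, ?_, rfl⟩
    rw [SetLike.mem_coe, LinearMap.mem_ker, hℓ, (hDy v).inner_eq_zero, (hDy v).form_eq_zero]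
    rfl
  have heq := Submodule.eq_of_le_of_finrank_le hle (by
    rw [LinearMap.finrank_range_of_inj hD, hV]
    exact (Submodule.finrank_map_le _ _).trans hker)
  have hwm : w ∈ ℓ.ker.map W.subtype := by
    refine ⟨⟨w, (hW _).mpr hw.coordinate_eq_zero⟩, ?_, rfl⟩
    rw [SetLike.mem_coe, LinearMap.mem_ker, hℓ, hw.inner_eq_zero, hw.form_eq_zero]
    rfl
  rw [← heq] at hwm
  exact hwm

/-- A linear map that is injective on the tangent space of the cone is injective on the cone
near that point. -/
theorem eventually_injective_on_cone {V : Type*} [NormedAddCommGroup V] [NormedSpace ℝ V]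
    {y : E (m + 1)} {pr : E (m + 1) →L[ℝ] V}
    (hpr : ∀ v, TangentToCone n a y v → pr v = 0 → v = 0) :
    ∀ᶠ z : E (m + 1) × E (m + 1) in 𝓝 (y, y), OnCone n a z.1 → OnCone n a z.2 →
      pr z.1 = pr z.2 → z.1 = z.2 := by
  let Λ : E (m + 1) →ₗ[ℝ] V × ℝ × ℝ × (Fin (m + 1) → ℝ) :=
    pr.toLinearMap.prod ((innerSL ℝ y).toLinearMap.prod ((coneForm n m a y).toLinearMap.prod
      (LinearMap.pi fun i : Fin (m + 1) => (if n + 2 ≤ (i : ℕ) then (1 : ℝ) else 0) •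
        (coordinate m i).toLinearMap)))
  have hΛ : ∀ v, Λ v = (pr v, ⟪y, v⟫, coneForm n m a y v,
      fun i : Fin (m + 1) => (if n + 2 ≤ (i : ℕ) then (1 : ℝ) else 0) * coordinate m i v) :=
    fun v => rfl
  have hker : Λ.ker = ⊥ := by
    refine LinearMap.ker_eq_bot'.mpr fun v hv => ?_
    rw [hΛ] at hv
    simp only [Prod.mk_eq_zero] at hv
    obtain ⟨h1, h2, h3, h4⟩ := hv
    refine hpr v ⟨h2, h3, fun i hi => ?_⟩ h1
    rcases Nat.lt_or_ge i (m + 1) with h | h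
    · have := congrFun h4 ⟨i, h⟩
      simpa [hi] using this
    · exact coordinate_of_le h _
  -- Together with the equations of the tangent space, the linear map `pr` is injective on the whole
  -- space, hence bounded below.
  obtain ⟨K, hK0, hK⟩ := LinearMap.exists_antilipschitzWith Λ hker
  have hlim : Tendsto (fun z : E (m + 1) × E (m + 1) =>
      (K : ℝ) * max ‖y - (2 : ℝ)⁻¹ • (z.1 + z.2)‖
        ‖coneForm n m a (y - (2 : ℝ)⁻¹ • (z.1 + z.2))‖) (𝓝 (y, y)) (𝓝 0) := by
    have hc : Continuous (fun z : E (m + 1) × E (m + 1) =>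
      (K : ℝ) * max ‖y - (2 : ℝ)⁻¹ • (z.1 + z.2)‖
        ‖coneForm n m a (y - (2 : ℝ)⁻¹ • (z.1 + z.2))‖) := by fun_prop
    have h0 : y - (2 : ℝ)⁻¹ • (y + y) = 0 := by module
    refine (hc.tendsto' (y, y) 0 ?_)
    rw [h0, map_zero, norm_zero, norm_zero, max_self, mul_zero]
  filter_upwards [hlim.eventually_lt_const zero_lt_one] with z hz h1 h2 hprz
  set d := z.1 - z.2 with hd
  set u := y - (2 : ℝ)⁻¹ • (z.1 + z.2) with hu
  -- Two points of a quadric have difference orthogonal to their sum for the corresponding form. So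
  -- y may be replaced by its distance vector u from the midpoint, which is small: the tangency
  -- equations for d hold up to an error small compared with ‖d‖.
  have hyd : ⟪y, d⟫ = ⟪u, d⟫ := by
    have h3 : ⟪z.1 + z.2, d⟫ = (0 : ℝ) := by
      rw [hd, inner_add_left, inner_sub_right, inner_sub_right, h1.inner_self, h2.inner_self,
        real_inner_comm z.1 z.2]
      ring
    rw [hu, inner_sub_left, inner_smul_left, h3, mul_zero, sub_zero]
  have hyB : coneForm n m a y d = coneForm n m a u d := by
    have h3 : coneForm n m a (z.1 + z.2) d = 0 := by
      rw [hd, map_add, add_apply, map_sub, map_sub, h1.form_self, h2.form_self,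
        coneForm_comm n m a z.1 z.2]
      ring
    rw [hu, (coneForm n m a).map_sub, (coneForm n m a).map_smul, sub_apply, smul_apply, h3,
      smul_zero, sub_zero]
  have hnorm : ‖Λ d‖ ≤ max ‖u‖ ‖coneForm n m a u‖ * ‖d‖ := by
    have h4 : (fun i : Fin (m + 1) =>
        (if n + 2 ≤ (i : ℕ) then (1 : ℝ) else 0) * coordinate m i d) = 0 := by
      funext i
      split_ifs with hi
      · rw [hd, map_sub, h1.coordinate_eq_zero _ hi, h2.coordinate_eq_zero _ hi, sub_self,
          mul_zero]
        rfl
      · exact zero_mul _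
    have h5 : 0 ≤ max ‖u‖ ‖coneForm n m a u‖ * ‖d‖ := by positivity
    rw [hΛ, h4, hyd, hyB, hd, map_sub, hprz, sub_self, ← hd]
    refine norm_prod_le_iff.mpr ⟨by simpa using h5, norm_prod_le_iff.mpr ⟨?_,
      norm_prod_le_iff.mpr ⟨?_, by simpa using h5⟩⟩⟩
    · exact (norm_inner_le_norm u d).trans (by gcongr; exact le_max_left _ _)
    · exact ((coneForm n m a u).le_opNorm d).trans (by gcongr; exact le_max_right _ _)
  have : ‖d‖ ≤ ((K : ℝ) * max ‖u‖ ‖coneForm n m a u‖) * ‖d‖ := by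
    calc ‖d‖ ≤ K * ‖Λ d‖ := hK.le_mul_norm (map_zero Λ) d
      _ ≤ K * (max ‖u‖ ‖coneForm n m a u‖ * ‖d‖) := by gcongr
      _ = _ := by ring
  have hd0 : ‖d‖ = 0 := by
    by_contra h
    have hpos : 0 < ‖d‖ := lt_of_le_of_ne (norm_nonneg _) (Ne.symm h)
    nlinarith
  exact sub_eq_zero.mp (norm_eq_zero.mp hd0)

end Cone

/-! ### Polar coordinates in any dimension. -/

section PolarCoordinates

/-- The angle is the argument of t + is, shifted by π when r is negative. -/
theorem exists_angle_of_sq_add_sq {s t r : ℝ} (h : s ^ 2 + t ^ 2 = r ^ 2) :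
    ∃ θ : ℝ, s = r * Real.sin θ ∧ t = r * Real.cos θ := by
  have hz : ‖(⟨t, s⟩ : ℂ)‖ = |r| := by
    rw [← Real.sqrt_sq_eq_abs, ← h, Complex.norm_def, Complex.normSq_mk]
    congr 1
    ring
  have hc := Complex.norm_mul_cos_arg ⟨t, s⟩
  have hs := Complex.norm_mul_sin_arg ⟨t, s⟩
  rw [hz] at hc hs
  rcases abs_cases r with ⟨h1, -⟩ | ⟨h1, -⟩
  · rw [h1] at hc hs
    exact ⟨_, hs.symm, hc.symm⟩
  · rw [h1] at hc hs
    refine ⟨Complex.arg ⟨t, s⟩ + Real.pi, ?_, ?_⟩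
    · rw [Real.sin_add_pi, mul_neg, ← neg_mul]
      exact hs.symm
    · rw [Real.cos_add_pi, mul_neg, ← neg_mul]
      exact hc.symm

theorem sum_sq_polar (θ : ℕ → ℝ) (d : ℕ) :
    ∑ i ∈ Finset.range d, (Real.sin (θ i) * ∏ j ∈ Finset.range i, Real.cos (θ j)) ^ 2 +
      (∏ j ∈ Finset.range d, Real.cos (θ j)) ^ 2 = 1 := by
  induction d with
  | zero => simp
  | succ d ih =>
    rw [Finset.sum_range_succ, Finset.prod_range_succ, ← ih]
    linear_combination (∏ j ∈ Finset.range d, Real.cos (θ j)) ^ 2 * Real.sin_sq_add_cos_sq (θ d)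

/-- Induction by merging the last two coordinates into their common length, then splitting that
length again with one more angle. -/
theorem exists_polar {d : ℕ} (hd : 1 ≤ d) (z : ℕ → ℝ) (r : ℝ)
    (h : ∑ i ∈ Finset.range d, z i ^ 2 + z d ^ 2 = r ^ 2) :
    ∃ θ : ℕ → ℝ, (∀ i < d, z i = r * (Real.sin (θ i) * ∏ j ∈ Finset.range i, Real.cos (θ j))) ∧
      z d = r * ∏ j ∈ Finset.range d, Real.cos (θ j) := by
  induction d, hd using Nat.le_induction generalizing z with
  | base =>
    rw [Finset.sum_range_one] at h
    obtain ⟨θ, h1, h2⟩ := exists_angle_of_sq_add_sq h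
    refine ⟨fun _ => θ, fun i hi => ?_, by simpa using h2⟩
    obtain rfl : i = 0 := by omega
    simpa using h1
  | succ d hd ih =>
    have hp : (0 : ℝ) ≤ z d ^ 2 + z (d + 1) ^ 2 := by positivity
    set t := √(z d ^ 2 + z (d + 1) ^ 2) with ht
    have ht2 : z d ^ 2 + z (d + 1) ^ 2 = t ^ 2 := (Real.sq_sqrt hp).symm
    obtain ⟨θ, h1, h2⟩ := ih (Function.update z d t) (by
      rw [Function.update_self, ← ht2, ← h, Finset.sum_range_succ, add_assoc]
      congr 1
      refine Finset.sum_congr rfl fun i hi => ?_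
      rw [Function.update_of_ne (Finset.mem_range.mp hi).ne])
    obtain ⟨α, h3, h4⟩ := exists_angle_of_sq_add_sq ht2
    have hprod : ∀ i ≤ d, ∏ j ∈ Finset.range i, Real.cos (Function.update θ d α j) =
        ∏ j ∈ Finset.range i, Real.cos (θ j) := fun i hi =>
      Finset.prod_congr rfl fun j hj => by
        rw [Function.update_of_ne ((Finset.mem_range.mp hj).trans_le hi).ne]
    rw [Function.update_self] at h2
    refine ⟨Function.update θ d α, fun i hi => ?_, ?_⟩
    · rcases Nat.lt_succ_iff_lt_or_eq.mp hi with hi | rfl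
      · rw [hprod i hi.le, Function.update_of_ne hi.ne, ← h1 i hi, Function.update_of_ne hi.ne]
      · rw [hprod i le_rfl, Function.update_self, h3, h2]
        ring
    · rw [Finset.prod_range_succ, hprod d le_rfl, Function.update_self, h4, h2]
      ring

theorem prod_Icc_one (f : ℕ → ℝ) (i : ℕ) :
    ∏ j ∈ Finset.Icc 1 i, f j = ∏ j ∈ Finset.range i, f (j + 1) := by
  induction i with
  | zero => simp
  | succ i ih => rw [Finset.prod_Icc_succ_top (by omega), ih, Finset.prod_range_succ]

end PolarCoordinates

/-! ### The model map parametrizes the cone. -/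

section Model

variable {n m : ℕ} (hn : 3 ≤ n) (hm : n + 2 ≤ m + 1) (a : ℝ) (x : E n)

theorem contDiff_angle (j : ℕ) : ContDiff ℝ ∞ fun x : E n => angle x j := by
  unfold angle
  split_ifs <;> fun_prop

theorem contDiff_modelMap : ContDiff ℝ ∞ (modelMap m a : E n → E (m + 1)) := by
  rw [contDiff_euclidean]
  intro i
  have hs : ∀ j, ContDiff ℝ ∞ fun x : E n => Real.sin (angle x j) := fun j =>
    (contDiff_angle j).sin
  have hc : ∀ j, ContDiff ℝ ∞ fun x : E n => Real.cos (angle x j) := fun j =>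
    (contDiff_angle j).cos
  have hp : ∀ k, ContDiff ℝ ∞ fun x : E n => ∏ j ∈ Finset.Icc 1 k, Real.cos (angle x j) :=
    fun k => contDiff_prod fun j _ => hc j
  simp only [modelMap]
  split_ifs
  · exact contDiff_const.mul (hs _)
  · exact (hs _).mul (hp _)
  · exact hp _
  · exact (contDiff_const.mul (hs _)).mul (hs _)
  · exact ((contDiff_const.mul (hs _)).mul (hc _)).mul (hs _)
  · exact ((contDiff_const.mul (hs _)).mul (hc _)).mul (hc _)
  · exact contDiff_const

include hn hm

theorem coordinate_modelMap_zero :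
    coordinate m 0 (modelMap m a x) = √(1 - a ^ 2) * Real.sin (angle x 1) := by
  rw [coordinate_apply (by omega)]
  rfl

theorem coordinate_modelMap_of_lt {i : ℕ} (h0 : 0 < i) (hi : i < n - 2) :
    coordinate m i (modelMap m a x) =
      Real.sin (angle x (i + 1)) * ∏ j ∈ Finset.range i, Real.cos (angle x (j + 1)) := by
  rw [coordinate_apply (by omega), ← prod_Icc_one fun j => Real.cos (angle x j)]
  simp only [modelMap]
  rw [if_neg (by omega), if_pos hi]

theorem coordinate_modelMap_sub_two :
    coordinate m (n - 2) (modelMap m a x) =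
      ∏ j ∈ Finset.range (n - 2), Real.cos (angle x (j + 1)) := by
  rw [coordinate_apply (by omega), ← prod_Icc_one fun j => Real.cos (angle x j)]
  simp only [modelMap]
  rw [if_neg (by omega), if_neg (by omega), if_true]

theorem coordinate_modelMap_sub_one : coordinate m (n - 1) (modelMap m a x) =
    a * Real.sin (angle x 1) * Real.sin (angle x (n - 1)) := by
  rw [coordinate_apply (by omega)]
  simp only [modelMap]
  rw [if_neg (by omega), if_neg (by omega), if_neg (by omega), if_true]

theorem coordinate_modelMap_self : coordinate m n (modelMap m a x) =
    a * Real.sin (angle x 1) * Real.cos (angle x (n - 1)) * Real.sin (angle x n) := by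
  rw [coordinate_apply (by omega)]
  simp only [modelMap]
  rw [if_neg (by omega), if_neg (by omega), if_neg (by omega), if_neg (by omega), if_true]

theorem coordinate_modelMap_add_one : coordinate m (n + 1) (modelMap m a x) =
    a * Real.sin (angle x 1) * Real.cos (angle x (n - 1)) * Real.cos (angle x n) := by
  rw [coordinate_apply (by omega)]
  simp only [modelMap]
  rw [if_neg (by omega), if_neg (by omega), if_neg (by omega), if_neg (by omega),
    if_neg (by omega), if_true]

omit hm in
theorem coordinate_modelMap_of_le {i : ℕ} (hi : n + 2 ≤ i) :
    coordinate m i (modelMap m a x) = 0 := by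
  rcases Nat.lt_or_ge i (m + 1) with h | h
  · rw [coordinate_apply h]
    simp only [modelMap]
    rw [if_neg (by omega), if_neg (by omega), if_neg (by omega), if_neg (by omega),
      if_neg (by omega), if_neg (by omega)]
  · exact coordinate_of_le h _

/-- The square norm of a vector supported in the first `n + 2` coordinates. -/
theorem inner_self_eq_of_coordinate {y : E (m + 1)} (hy : ∀ i, n + 2 ≤ i → coordinate m i y = 0) :
    ⟪y, y⟫ = coordinate m 0 y ^ 2 + ∑ i ∈ Finset.range (n - 3), coordinate m (i + 1) y ^ 2 +
      coordinate m (n - 2) y ^ 2 + (coordinate m (n - 1) y ^ 2 + coordinate m n y ^ 2 +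
      coordinate m (n + 1) y ^ 2) := by
  obtain ⟨k, rfl⟩ : ∃ k, n = k + 3 := ⟨n - 3, by omega⟩
  rw [inner_eq_sum_coordinate]
  have h1 : Finset.range (k + 3 + 2) ⊆ Finset.range (m + 1) := Finset.range_subset_range.mpr hm
  rw [← Finset.sum_subset h1 fun i _ hi => by
    rw [hy i (by simpa using hi), mul_zero]]
  rw [Finset.sum_range_succ, Finset.sum_range_succ, Finset.sum_range_succ, Finset.sum_range_succ,
    Finset.sum_range_succ']
  simp only [← pow_two]
  have h2 : k + 3 - 3 = k := by omega
  have h3 : k + 3 - 2 = k + 1 := by omega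
  have h4 : k + 3 - 1 = k + 2 := by omega
  rw [h2, h3, h4]
  ring

/-- The last three coordinates have square sum a² sin² x₁. Added to the (1 - a²) sin² x₁ of the axis
this restores sin² x₁, and the remaining sum is `sum_sq_polar` in n - 2 angles. -/
theorem onCone_modelMap (ha : a ^ 2 ≤ 1) : OnCone n a (modelMap m a x) where
  inner_self := by
    have h0 : √(1 - a ^ 2) ^ 2 = 1 - a ^ 2 := Real.sq_sqrt (by linarith)
    have h1 := sum_sq_polar (fun j => angle x (j + 1)) (n - 2)
    obtain ⟨k, rfl⟩ : ∃ k, n = k + 3 := ⟨n - 3, by omega⟩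
    have h2 : k + 3 - 2 = k + 1 := by omega
    have h3 : ∀ i ∈ Finset.range (k + 3 - 3), coordinate m (i + 1) (modelMap m a x) ^ 2 =
        (Real.sin (angle x (i + 1 + 1)) *
          ∏ j ∈ Finset.range (i + 1), Real.cos (angle x (j + 1))) ^ 2 := fun i hi => by
      rw [Finset.mem_range] at hi
      rw [coordinate_modelMap_of_lt hn hm a x (by omega) (by omega)]
    rw [inner_self_eq_of_coordinate hn hm fun i hi => coordinate_modelMap_of_le hn a x hi,
      coordinate_modelMap_zero hn hm, coordinate_modelMap_sub_two hn hm,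
      coordinate_modelMap_sub_one hn hm, coordinate_modelMap_self hn hm,
      coordinate_modelMap_add_one hn hm, Finset.sum_congr rfl h3]
    rw [h2, Finset.sum_range_succ'] at h1
    simp only [Finset.range_zero, Finset.prod_empty, zero_add, mul_one] at h1
    rw [h2, show k + 3 - 3 = k by omega]
    have e1 := Real.sin_sq_add_cos_sq (angle x (k + 3 - 1))
    have e2 := Real.sin_sq_add_cos_sq (angle x (k + 3))
    rw [mul_pow, h0]
    linear_combination h1 + a ^ 2 * Real.sin (angle x 1) ^ 2 * e1 +
      a ^ 2 * Real.sin (angle x 1) ^ 2 * Real.cos (angle x (k + 3 - 1)) ^ 2 * e2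
  form_self := by
    have h0 : √(1 - a ^ 2) ^ 2 = 1 - a ^ 2 := Real.sq_sqrt (by linarith)
    rw [coneForm_apply, coordinate_modelMap_zero hn hm,
      coordinate_modelMap_sub_one hn hm, coordinate_modelMap_self hn hm,
      coordinate_modelMap_add_one hn hm]
    have e1 := Real.sin_sq_add_cos_sq (angle x (n - 1))
    have e2 := Real.sin_sq_add_cos_sq (angle x n)
    linear_combination (1 - a ^ 2) * a ^ 2 * Real.sin (angle x 1) ^ 2 * e1 +
      (1 - a ^ 2) * a ^ 2 * Real.sin (angle x 1) ^ 2 * Real.cos (angle x (n - 1)) ^ 2 * e2 -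
      a ^ 2 * Real.sin (angle x 1) ^ 2 * h0
  coordinate_eq_zero := fun i hi => coordinate_modelMap_of_le hn a x hi

omit x in
/-- Every point of the cone with positive first coordinate is a value of the model map. -/
theorem exists_modelMap_eq (ha1 : a ^ 2 < 1) {y : E (m + 1)}
    (hy : OnCone n a y) (hy0 : 0 < coordinate m 0 y) :
    ∃ x : E n, 0 < Real.sin (angle x 1) ∧ y = modelMap m a x := by
  have hpos : 0 < 1 - a ^ 2 := by linarith
  have hsq : √(1 - a ^ 2) ^ 2 = 1 - a ^ 2 := Real.sq_sqrt hpos.le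
  have hsq0 : 0 < √(1 - a ^ 2) := Real.sqrt_pos.mpr hpos
  -- The future value of sin x₁. The cone equation makes a s the radius of the last three
  -- coordinates, and (s, y₁, …, y_{n-2}) becomes a unit vector; polar coordinates are applied to
  -- each group.
  set s := coordinate m 0 y / √(1 - a ^ 2) with hs
  have hys : coordinate m 0 y = √(1 - a ^ 2) * s := by
    rw [hs]
    field_simp
  have hs0 : 0 < s := div_pos hy0 hsq0
  have hform := hy.form_self
  rw [coneForm_apply, hys] at hform
  have h3 : coordinate m (n - 1) y ^ 2 + coordinate m n y ^ 2 + coordinate m (n + 1) y ^ 2 =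
      (a * s) ^ 2 := by
    refine mul_left_cancel₀ hpos.ne' ?_
    linear_combination hform + a ^ 2 * s ^ 2 * hsq
  have hnorm := hy.inner_self
  rw [inner_self_eq_of_coordinate hn hm hy.coordinate_eq_zero, h3, hys, mul_pow, hsq] at hnorm
  obtain ⟨θ, hθ1, hθ2⟩ := exists_polar (d := n - 2) (by omega)
    (fun i => if i = 0 then s else coordinate m i y) 1 (by
      obtain ⟨k, rfl⟩ : ∃ k, n = k + 3 := ⟨n - 3, by omega⟩
      have h2 : k + 3 - 2 = k + 1 := by omega
      have h2' : k + 3 - 3 = k := by omega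
      rw [h2, h2'] at hnorm
      rw [h2, Finset.sum_range_succ']
      simp only [if_true, Nat.add_eq_zero_iff, one_ne_zero, and_false, if_false]
      linear_combination hnorm)
  obtain ⟨η, hη1, hη2⟩ := exists_polar (d := 2) (by omega)
    (fun i => coordinate m (n - 1 + i) y) (a * s) (by
      have h4 : n - 1 + 1 = n := by omega
      have h5 : n - 1 + 2 = n + 1 := by omega
      rw [Finset.sum_range_succ, Finset.sum_range_one, h4, h5]
      exact h3)
  have hη3 := hη1 0 (by omega)
  have hη4 := hη1 1 (by omega)
  simp only [add_zero, Finset.range_zero, Finset.prod_empty, mul_one, Finset.prod_range_one] at hη3 hη4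
  rw [Finset.prod_range_succ, Finset.prod_range_one] at hη2
  -- The n - 2 angles of the first group come first, then the two of the second. `angle` counts from
  -- 1 whereas `θ` and `η` count from 0.
  set x : E n := WithLp.toLp 2 fun j : Fin n =>
    if (j : ℕ) < n - 2 then θ j else η (j - (n - 2)) with hx
  have hang : ∀ j, j < n - 2 → angle x (j + 1) = θ j := fun j hj => by
    rw [angle, dif_pos ⟨by omega, by omega⟩, hx]
    simp [hj]
  have hang1 : angle x (n - 1) = η 0 := by
    rw [angle, dif_pos ⟨by omega, by omega⟩, hx]
    have h6 : ¬ n - 1 - 1 < n - 2 := by omega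
    have h7 : n - 1 - 1 - (n - 2) = 0 := by omega
    simp only [h6, h7, if_false]
  have hang2 : angle x n = η 1 := by
    rw [angle, dif_pos ⟨by omega, by omega⟩, hx]
    have h6 : ¬ n - 1 < n - 2 := by omega
    have h7 : n - 1 - (n - 2) = 1 := by omega
    simp only [h6, h7, if_false]
  have hsin : Real.sin (angle x 1) = s := by
    have h6 := hθ1 0 (by omega)
    simp only [if_true, Finset.range_zero, Finset.prod_empty, mul_one, one_mul] at h6
    rw [hang 0 (by omega), ← h6]
  have hprod : ∀ i ≤ n - 2, ∏ j ∈ Finset.range i, Real.cos (angle x (j + 1)) =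
      ∏ j ∈ Finset.range i, Real.cos (θ j) := fun i hi =>
    Finset.prod_congr rfl fun j hj => by
      rw [hang j ((Finset.mem_range.mp hj).trans_le hi)]
  refine ⟨x, by rwa [hsin], ext_coordinate fun i => ?_⟩
  rcases Nat.lt_or_ge i (n - 2) with hi | hi
  · rcases Nat.eq_zero_or_pos i with rfl | h0
    · rw [coordinate_modelMap_zero hn hm, hsin, hys]
    · have h6 := hθ1 i hi
      rw [if_neg h0.ne', one_mul] at h6
      rw [coordinate_modelMap_of_lt hn hm a x h0 hi, hang i hi, hprod i hi.le, h6]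
  rcases Nat.lt_or_ge i (n + 2) with hi2 | hi2
  · obtain rfl | rfl | h | rfl : i = n - 2 ∨ i = n - 1 ∨ i = n ∨ i = n + 1 := by omega
    · rw [if_neg (by omega), one_mul] at hθ2
      rw [coordinate_modelMap_sub_two hn hm, hprod _ le_rfl, hθ2]
    · rw [coordinate_modelMap_sub_one hn hm, hsin, hang1, hη3]
    · rw [h, coordinate_modelMap_self hn hm, hsin, hang1, hang2]
      have h4 : n - 1 + 1 = n := by omega
      rw [h4] at hη4
      rw [hη4]
      ring
    · rw [coordinate_modelMap_add_one hn hm, hsin, hang1, hang2]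
      have h4 : n - 1 + 2 = n + 1 := by omega
      rw [h4] at hη2
      rw [hη2]
      ring
  · rw [coordinate_modelMap_of_le hn a x hi2, hy.coordinate_eq_zero i hi2]

end Model

/-! ### Moving the frame into standard position. -/

section OrthonormalExtension

theorem exists_orthonormalBasis_comp_eq {V κ ι : Type*} [NormedAddCommGroup V]
    [InnerProductSpace ℝ V] [FiniteDimensional ℝ V] [Fintype ι] {e : κ → V} (he : Orthonormal ℝ e)
    {σ : κ → ι} (hσ : Function.Injective σ) (hdim : Module.finrank ℝ V = Fintype.card ι) :
    ∃ b : OrthonormalBasis ι ℝ V, ∀ k, b (σ k) = e k := by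
  have hv : Orthonormal ℝ ((Set.range σ).domRestrict (Function.extend σ e 0)) := by
    convert! he.comp _ (Equiv.ofInjective σ hσ).symm.injective using 1
    funext ⟨i, k, hk⟩
    subst hk
    simp only [Function.comp_apply]
    rw [Equiv.ofInjective_symm_apply hσ k]
    exact hσ.extend_apply e 0 k
  obtain ⟨b, hb⟩ := hv.exists_orthonormalBasis_extension_of_card_eq hdim
  exact ⟨b, fun k => (hb _ ⟨k, rfl⟩).trans (hσ.extend_apply e 0 k)⟩

/-- The frame is extended twice: to a basis of W, with its vectors at prescribed positions, then to
the whole space with W on the first n + 2 coordinates. The coordinate map of the result is the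
inverse of the isometry. -/
theorem exists_isometry_of_frame {n m : ℕ} (hn : 3 ≤ n) {W : Submodule ℝ (E (m + 1))}
    {e₀ e₁ e₂ e₃ : E (m + 1)} (hW : Module.finrank ℝ W = n + 2)
    (hmem : ∀ i, ![e₀, e₁, e₂, e₃] i ∈ W) (he : Orthonormal ℝ ![e₀, e₁, e₂, e₃]) :
    n + 2 ≤ m + 1 ∧ ∃ A : E (m + 1) ≃ₗᵢ[ℝ] E (m + 1), ∀ w ∈ W,
      coordinate m 0 (A.symm w) = ⟪e₀, w⟫ ∧ coordinate m (n - 1) (A.symm w) = ⟪e₁, w⟫ ∧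
      coordinate m n (A.symm w) = ⟪e₂, w⟫ ∧ coordinate m (n + 1) (A.symm w) = ⟪e₃, w⟫ ∧
      ∀ i, n + 2 ≤ i → coordinate m i (A.symm w) = 0 := by
  have hm : n + 2 ≤ m + 1 := by
    rw [← hW]
    exact (Submodule.finrank_le W).trans (by simp)
  refine ⟨hm, ?_⟩
  have heW : Orthonormal ℝ (fun i => (⟨_, hmem i⟩ : W)) := by
    rw [orthonormal_iff_ite] at he ⊢
    exact he
  -- The positions are those of the coordinates entering `coneForm`: the axis at 0, the 3-space at n
  -- - 1, n, n + 1.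
  let σ : Fin 4 → Fin (n + 2) := ![⟨0, by omega⟩, ⟨n - 1, by omega⟩, ⟨n, by omega⟩, ⟨n + 1, by omega⟩]
  have hσ : Function.Injective σ := by
    intro i j hij
    fin_cases i <;> fin_cases j <;> simp [σ] at hij <;> first | rfl | omega
  obtain ⟨c, hc⟩ := exists_orthonormalBasis_comp_eq heW hσ (by simpa using hW)
  have hcW : Orthonormal ℝ (fun i => (c i : E (m + 1))) := c.orthonormal.comp_linearIsometry W.subtypeₗᵢ
  obtain ⟨b, hb⟩ := exists_orthonormalBasis_comp_eq hcW (Fin.castLE_injective hm)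
    (by simp : Module.finrank ℝ (E (m + 1)) = Fintype.card (Fin (m + 1)))
  have hcoord : ∀ (i : Fin (m + 1)) w, coordinate m i (b.repr w) = ⟪b i, w⟫ := fun i w => by
    rw [coordinate_apply i.2, ← b.repr_apply_apply]
  have hval : ∀ (k : Fin 4) w, coordinate m (σ k) (b.repr w) = ⟪![e₀, e₁, e₂, e₃] k, w⟫ := fun k w => by
    have := hcoord (Fin.castLE hm (σ k)) w
    rw [hb, hc] at this
    exact this
  refine ⟨b.repr.symm, fun w hw => ?_⟩
  rw [LinearIsometryEquiv.symm_symm]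
  refine ⟨hval 0 w, hval 1 w, hval 2 w, hval 3 w, fun i hi => ?_⟩
  rcases Nat.lt_or_ge i (m + 1) with h | h
  · rw [hcoord ⟨i, h⟩]
    have hsum := c.sum_repr' ⟨w, hw⟩
    have hsum' := congrArg (Subtype.val) hsum
    simp only [Submodule.coe_sum, Submodule.coe_smul] at hsum'
    rw [← hsum', inner_sum]
    refine Finset.sum_eq_zero fun j _ => ?_
    rw [inner_smul_right, ← hb j, b.inner_eq_ite, if_neg, mul_zero]
    intro hij
    have := congrArg Fin.val hij
    simp at this
    omega
  · exact coordinate_of_le h _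

end OrthonormalExtension

/-! ### The angles as local coordinates of the submanifold. -/

section Congruence

variable {n : ℕ} {M : Type*} [TopologicalSpace M] [ChartedSpace (E n) M]
variable {m : ℕ} {φ : M → S m}
variable [IsManifold (𝓡 n) ∞ M]

def chartPartialDiffeomorph (p : M) : PartialDiffeomorph (𝓡 n) 𝓘(ℝ, E n) M (E n) ∞ where
  toPartialEquiv := extChartAt (𝓡 n) p
  open_source := isOpen_extChartAt_source p
  open_target := isOpen_extChartAt_target p
  contMDiffOn_toFun := fun _ hq => (contMDiffAt_chart p hq).contMDiffWithinAt
  contMDiffOn_invFun := fun _ hx => (contMDiffAt_chart_symm p hx).contMDiffWithinAt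

variable [RiemannianBundle (fun x : M => TangentSpace (𝓡 n) x)]
variable (hφ : IsIsometricImmersion n φ)
include hφ

/-- An immersion into the cone has the angles of the model map as local coordinates, wherever the
model map is an immersion. -/
theorem exists_angle_coordinates (hn : 3 ≤ n) (hm : n + 2 ≤ m + 1) {a : ℝ} (ha0 : 0 < a)
    (ha1 : a < 1) (A : E (m + 1) ≃ₗᵢ[ℝ] E (m + 1))
    (hcone : ∀ q, OnCone n a (A.symm (φ q : E (m + 1))))
    (hpos : ∀ q, 0 < coordinate m 0 (A.symm (φ q : E (m + 1)))) (p : M) (x : E n)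
    (hpx : (φ p : E (m + 1)) = A (modelMap m a x))
    (hinj : Function.Injective (fderiv ℝ (modelMap m a : E n → E (m + 1)) x)) :
    ∃ ψ : M → E n, ψ p = x ∧ IsLocalDiffeomorphAt (𝓡 n) 𝓘(ℝ, E n) ∞ ψ p ∧
      ∀ᶠ q in 𝓝 p, (φ q : E (m + 1)) = A (modelMap m a (ψ q)) := by
  have hfin : Module.finrank ℝ (E n) = n := by simp
  have hyx : A.symm (φ p : E (m + 1)) = modelMap m a x := by rw [hpx, A.symm_apply_apply]
  have hFd : Differentiable ℝ (modelMap m a : E n → E (m + 1)) :=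
    (contDiff_modelMap a).differentiable (by simp)
  have hFc : ∀ x' : E n, OnCone n a (modelMap m a x' : E (m + 1)) := fun x' =>
    onCone_modelMap hn hm a x' (by nlinarith)
  have hFt : ∀ v, TangentToCone n a (modelMap m a x) (fderiv ℝ (modelMap m a : E n → E (m + 1)) x v) :=
    tangentToCone_fderiv (hFd x) (Eventually.of_forall hFc)
  set D := fderiv ℝ (modelMap m a : E n → E (m + 1)) x with hD
  -- One linear projection serves both immersions. It is injective on the tangent space of the cone,
  -- which for dimension reasons is the range of D, so composing it with either immersion gives a
  -- local diffeomorphism of n-dimensional spaces.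
  set J := leftInv D with hJ
  have hy0 : coordinate m 0 (modelMap m a x) ≠ 0 := by
    rw [← hyx]
    exact (hpos p).ne'
  have hJinj : ∀ w, TangentToCone n a (modelMap m a x) w → J w = 0 → w = 0 := by
    intro w hw hw0
    obtain ⟨v, rfl⟩ := exists_eq_of_tangentToCone hfin (by omega) ha0.ne' (hFc x) hy0 hinj hFt hw
    rw [hJ, leftInv_apply_self hinj] at hw0
    rw [hw0, map_zero]
  obtain ⟨Φ, hxΦ, hΦ⟩ := exists_partialDiffeomorph (f := fun x' : E n => J (modelMap m a x' : E (m + 1)))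
    isOpen_univ (fun x' _ => (J.contDiff.comp (contDiff_modelMap a)).contDiffAt) (Set.mem_univ x) (by
      have h1 : HasFDerivAt (fun x' : E n => J (modelMap m a x' : E (m + 1))) (J ∘L D) x :=
        J.hasFDerivAt.comp x (hFd x).hasFDerivAt
      rw [h1.fderiv]
      intro v w hvw
      simpa [hJ, leftInv_apply_self hinj] using hvw)
  have hys : ∀ z ∈ (extChartAt (𝓡 n) p).target,
      ContDiffAt ℝ ∞ (fun z => A.symm (chartMap φ p z)) z := fun z hz =>
    (A.symm.contDiff.contDiffAt).comp z (contDiffAt_chartMap hφ.1 p hz)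
  have hpt := mem_extChartAt_target (I := 𝓡 n) p
  have hpy : A.symm (chartMap φ p (extChartAt (𝓡 n) p p)) = modelMap m a x := by
    rw [chartMap, extChartAt_to_inv, hyx]
  obtain ⟨Θ, hpΘ, hΘ⟩ := exists_partialDiffeomorph (f := fun z => J (A.symm (chartMap φ p z)))
    (isOpen_extChartAt_target (I := 𝓡 n) p) (fun z hz => J.contDiff.contDiffAt.comp z (hys z hz)) hpt (by
      have h1 := (contDiffAt_chartMap hφ.1 p hpt).differentiableAt (by simp)
      have h2 : HasFDerivAt (fun z => A.symm (chartMap φ p z))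
          ((A.symm.toContinuousLinearEquiv : E (m + 1) →L[ℝ] E (m + 1)) ∘L
            fderiv ℝ (chartMap φ p) (extChartAt (𝓡 n) p p)) (extChartAt (𝓡 n) p p) :=
        A.symm.toContinuousLinearEquiv.hasFDerivAt.comp _ h1.hasFDerivAt
      have h3 : HasFDerivAt (fun z => J (A.symm (chartMap φ p z))) (J ∘L
          ((A.symm.toContinuousLinearEquiv : E (m + 1) →L[ℝ] E (m + 1)) ∘L
            fderiv ℝ (chartMap φ p) (extChartAt (𝓡 n) p p))) (extChartAt (𝓡 n) p p) :=
        J.hasFDerivAt.comp _ h2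
      rw [h3.fderiv]
      refine (injective_iff_map_eq_zero _).mpr fun v hv => ?_
      have h4 := tangentToCone_fderiv h2.differentiableAt
        (Eventually.of_forall fun z => hcone ((extChartAt (𝓡 n) p).symm z)) v
      rw [h2.fderiv] at h4
      change TangentToCone n a (A.symm (chartMap φ p (extChartAt (𝓡 n) p p))) _ at h4
      rw [hpy] at h4
      have h5 := hJinj _ h4 hv
      have h6 : fderiv ℝ (chartMap φ p) (extChartAt (𝓡 n) p p) v = 0 :=
        A.symm.injective (h5.trans (map_zero A.symm).symm)
      exact injective_fderiv_chartMap hφ p hpt (h6.trans (map_zero _).symm))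
  set C := chartPartialDiffeomorph (n := n) p with hC
  -- The coordinate change matches points with equal image under J.
  set Ψ := (C.trans Θ).trans Φ.symm with hΨ
  have hval : ∀ q ∈ (extChartAt (𝓡 n) p).source,
      Ψ q = Φ.symm (J (A.symm (φ q : E (m + 1)))) := fun q hq => by
    have h1 : Ψ q = Φ.symm (Θ (extChartAt (𝓡 n) p q)) := rfl
    rw [h1, hΘ, chartMap, (extChartAt (𝓡 n) p).left_inv hq]
  have hps := mem_extChartAt_source (I := 𝓡 n) p
  have hΨp : Ψ p = x := by
    rw [hval p hps, hyx, ← hΦ x]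
    exact Φ.left_inv hxΦ
  have hpΨ : p ∈ Ψ.source := by
    have h1 : (C.trans Θ) p = Φ x := by
      have h1 : (C.trans Θ) p = Θ (extChartAt (𝓡 n) p p) := rfl
      rw [h1, hΘ, hpy, hΦ]
    refine ⟨⟨hps, hpΘ⟩, ?_⟩
    change (C.trans Θ) p ∈ Φ.target
    rw [h1]
    exact Φ.map_source hxΦ
  refine ⟨Ψ, hΨp, Ψ.isLocalDiffeomorphAt _ _ _ hpΨ, ?_⟩
  have hΨc : ContinuousAt Ψ p :=
    (Ψ.contMDiffOn.continuousOn).continuousAt (Ψ.open_source.mem_nhds hpΨ)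
  have hFΨ : Tendsto (fun q => (modelMap m a (Ψ q) : E (m + 1))) (𝓝 p) (𝓝 (modelMap m a x)) := by
    rw [← hΨp]
    exact hFd.continuous.continuousAt.comp hΨc
  have hyc : Tendsto (fun q => A.symm (φ q : E (m + 1))) (𝓝 p) (𝓝 (modelMap m a x)) := by
    rw [← hyx]
    exact (A.symm.continuous.comp (contMDiff_coe_comp hφ.1).continuous).continuousAt
  -- Equality after J is equality, since J is injective on the cone near the common point.
  have hev := (hFΨ.prodMk_nhds hyc).eventually (eventually_injective_on_cone hJinj)
  filter_upwards [hev, (isOpen_extChartAt_source (I := 𝓡 n) p).mem_nhds hps,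
    Ψ.open_source.mem_nhds hpΨ] with q h1 hq hqΨ
  have h2 : J (modelMap m a (Ψ q) : E (m + 1)) = J (A.symm (φ q : E (m + 1))) := by
    rw [hval q hq, ← hΦ]
    refine Φ.right_inv ?_
    have h3 : (C.trans Θ) q ∈ Φ.target := hqΨ.2
    have h4 : (C.trans Θ) q = Θ (extChartAt (𝓡 n) p q) := rfl
    rw [h4, hΘ, chartMap, (extChartAt (𝓡 n) p).left_inv hq] at h3
    exact h3
  rw [h1 (hFc _) (hcone q) h2, A.apply_symm_apply]

end Congruence

end IdealSubmanifold

end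


/-! ### The classification theorem. -/

open IdealSubmanifold
theorem theorem2 (n m : ℕ) (hn : 3 ≤ n)
    {M : Type*} [TopologicalSpace M] [T2Space M] [SecondCountableTopology M] [ConnectedSpace M]
    [ChartedSpace (E n) M] [IsManifold (𝓡 n) ∞ M]
    [RiemannianBundle (fun x : M => TangentSpace (𝓡 n) x)]
    [IsContMDiffRiemannianBundle (𝓡 n) ∞ (E n) (fun x : M => TangentSpace (𝓡 n) x)]
    (φ : M → S m) (hφ : IsIsometricImmersion n φ) (hideal : IsIdeal n φ)
    (htype : TypeNumberLE n φ 2) :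
    IsMinimal n φ ∨
      (LiesInTotallyGeodesicSphere φ (n + 1) ∧
        ∃ a : ℝ, 0 < a ∧ a < 1 ∧ IsCongruentToModel n φ a) := by
  have hn0 : n ≠ 0 := by omega
  obtain ⟨k, ν, hν, hδ⟩ := hideal
  have hpair : ∀ q, principalNormal n φ q ≠ 0 → ∃ u₁ u₂, IsPrincipalPair n φ q u₁ u₂ := by
    intro q hq
    rcases meanCurvature_eq_zero_or_rank_two hφ q hn0 hν hδ htype with h | h
    · exact absurd (by rw [principalNormal, h, smul_zero]) hq
    · exact h
  by_cases hmin : IsMinimal n φ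
  · exact Or.inl hmin
  -- One point with nonzero mean curvature suffices; connectedness spreads the cone equation to all
  -- of M.
  obtain ⟨p, hp⟩ := not_forall.mp hmin
  have hn' : (n : ℝ) / 2 ≠ 0 := div_ne_zero (by exact_mod_cast hn0) two_ne_zero
  obtain ⟨W, e₀, e₁, e₂, e₃, a, hW, hmem, he, ha0, ha1, hq⟩ :=
    exists_quadratic_cone hφ hn0 hpair (p := p) (smul_ne_zero hn' hp)
  obtain ⟨hm, A, hA⟩ := exists_isometry_of_frame hn hW hmem he
  have hcone : ∀ q, OnCone n a (A.symm (φ q : E (m + 1))) := fun q => by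
    obtain ⟨h1, h2, h3⟩ := hq q
    obtain ⟨c0, c1, c2, c3, c4⟩ := hA _ h1
    refine ⟨?_, ?_, c4⟩
    · rw [LinearIsometryEquiv.inner_map_map, real_inner_self_eq_norm_sq, norm_eq_of_mem_sphere,
        one_pow]
    · rw [coneForm_apply, c0, c1, c2, c3]
      linear_combination h3
  have hpos : ∀ q, 0 < coordinate m 0 (A.symm (φ q : E (m + 1))) := fun q => by
    rw [(hA _ (hq q).1).1]
    exact (hq q).2.1
  refine Or.inr ⟨⟨W, hW, fun q => (hq q).1⟩, a, ha0, ha1, A, fun q => ?_, fun q x hqx hinj =>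
    exists_angle_coordinates hφ hn hm ha0 ha1 A hcone hpos q x hqx hinj⟩
  obtain ⟨x, hx, hyx⟩ := exists_modelMap_eq hn hm a (by nlinarith) (hcone q) (hpos q)
  exact ⟨x, hx, by rw [← hyx, A.apply_symm_apply]⟩
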